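/- Let $\gamma,\beta>0$ with $\gamma\beta<1$, let $0<\kappa<1/2$, and let $k\ge 1$ be an integer. For $N\ge 0$ identify the real trigonometric polynomials of degree at most $N$ on the torus $\mathbb T$ of length $2\pi$ with $\mathbb R^{2N+1}$ through $u(x)=\sum_{|n|\le N}\hat u(n)e_n(x)$, where $e_0=1$, $e_n(x)=\pi^{-1/2}\cos(nx)$ and $e_{-n}(x)=\pi^{-1/2}\sin(nx)$ for $n>0$. Put $u_\perp=u-\hat u(0)$ and $$F(u)=\int_{\mathbb T}\Big(\frac{|u'(x)|^2}{2}-\frac{\gamma}{\beta}\cos(\beta u(x))\Big)\,dx+\max\Big(0,|\hat u(0)|-\frac{2\pi k}{\beta}\Big)^2 .$$ For $\epsilon>0$ and $c_0>0$ let $$A_\epsilon=\{u:|\hat u(0)|>2\pi/\beta-\sqrt\epsilon\,\log(1/\epsilon)\},$$ $$B_\epsilon=\{u:|\hat u(0)|<\sqrt\epsilon\,\log(1/\epsilon),\ \|u_\perp\|_{\mathcal C^{1/2-\kappa}}<\sqrt{c_0\,\epsilon\log(1/\epsilon)}\},$$ where $\mathcal C^{s}=B^{s}_{\infty,\infty}$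 is the Besov--H\"older space, normed by means of an arbitrary fixed smooth dyadic partition of unity. For disjoint $X,Y\subset\mathbb R^{2N+1}$ let $$\operatorname{cap}(X,Y)=\inf_g\ \epsilon\int_{\mathbb R^{2N+1}}|\nabla g(z)|^2e^{-F(z)/\epsilon}\,dz,$$ where $dz$ and $\nabla$ are the Lebesgue measure and the Euclidean gradient in the coordinates $\hat u(n)$, and the infimum is over all $g$ in the weighted Sobolev space $H^1(\mathbb R^{2N+1},e^{-F/\epsilon}dz)$ (that is, $g$ and its weak gradient are square integrable with respect to $e^{-F/\epsilon}dz$) with $g\ge 1$ on $X$ and $g=0$ on $Y$, almost everywhere. Then there is a constant $c_1>0$, depending only on $\gamma,\beta,\kappa$ and the partition of unity, such that for every $c_0\ge c_1$ there are $\epsilon_0>0$ and $C>0$, independent of $N$ and $\epsilon$, such that for all $0<\epsilon<\epsilon_0$ and all $N\ge 0$ $$\Lambda_{\epsilon,N}\,(1-C\epsilon)\ \le\ \operatorname{cap}(A_\epsilon,B_\epsilon)\ \le\ \Lambda_{\epsilon,N}\,(1+C\epsilon),\qquad \Lambda_{\epsilon,N}=2\sqrt{\epsilon\gamma\beta\prod_{0<|n|\le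 N}\frac{2\pi\epsilon}{n^2-\gamma\beta}}\;e^{-2\pi\gamma/(\epsilon\beta)} .$$ -/

import Mathlib

open MeasureTheory
open scoped ContDiff

noncomputable section

namespace SineGordon

/-- The real trigonometric system on the torus of length `2π` (functions on the torus are viewed as
`2π`-periodic functions on `ℝ`): `e₀ = 1` (not normalized), `eₙ = cos (n x) / √π` and
`e₋ₙ = sin (n x) / √π` for `n > 0`. -/
def trigBasis (n : ℤ) (x : ℝ) : ℝ :=
  if n = 0 then 1
  else if 0 < n then Real.cos (n * x) / √Real.pi
  else Real.sin (-n * x) / √Real.pi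

/-- The wavenumbers `n` with `|n| ≤ N`. -/
abbrev Modes (N : ℕ) : Type := {n : ℤ // n ∈ Finset.Icc (-(N : ℤ)) N}

/-- The truncated state space `ℝ^(2N+1)`: a function is identified with its Fourier coefficients
`û(n)`, `|n| ≤ N`. It carries the Euclidean structure and the Lebesgue measure of the
coefficients. -/
abbrev State (N : ℕ) : Type := EuclideanSpace ℝ (Modes N)

/-- The mean `û(0)`. -/
def mean {N : ℕ} (u : State N) : ℝ := u ⟨0, by simp⟩

/-- The oscillatory part `u_⊥ = u - û(0)`. -/
def oscillation {N : ℕ} (u : State N) : State N :=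
  WithLp.toLp 2 fun n => if (n : ℤ) = 0 then 0 else u n

/-- The function `x ↦ ∑ û(n) eₙ(x)` with the given Fourier coefficients. -/
def toFun {N : ℕ} (u : State N) (x : ℝ) : ℝ := ∑ n : Modes N, u n * trigBasis n x

/-- The sine-Gordon potential energy with confining term. -/
def energy (γ β : ℝ) (k : ℕ) {N : ℕ} (u : State N) : ℝ :=
  (∫ x in (0 : ℝ)..(2 * Real.pi),
      ((deriv (toFun u) x) ^ 2 / 2 - γ / β * Real.cos (β * toFun u x)))
    + (max 0 (|mean u| - k * (2 * Real.pi / β))) ^ 2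

/-- A smooth dyadic partition of unity on the frequency line:
`χ(x) + ∑_{j ≥ 0} φ(2^{-j} x) = 1`, where `χ` is supported in a ball and `φ` in an annulus. -/
structure DyadicPartition where
  χ : ℝ → ℝ
  φ : ℝ → ℝ
  inner : ℝ
  outer : ℝ
  inner_pos : 0 < inner
  smooth_χ : ContDiff ℝ ∞ χ
  smooth_φ : ContDiff ℝ ∞ φ
  even_χ : ∀ x, χ (-x) = χ x
  even_φ : ∀ x, φ (-x) = φ x
  nonneg_χ : ∀ x, 0 ≤ χ x
  nonneg_φ : ∀ x, 0 ≤ φ x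
  support_χ : ∀ x, χ x ≠ 0 → |x| ≤ outer
  support_φ : ∀ x, φ x ≠ 0 → inner ≤ |x| ∧ |x| ≤ outer
  sum_eq : ∀ x, HasSum (fun j : ℕ => φ (x / 2 ^ j)) (1 - χ x)

/-- Such partitions of unity exist. -/
theorem DyadicPartition.nonempty : Nonempty DyadicPartition := by
  have hsm : ContDiff ℝ ∞ fun x : ℝ => Real.smoothTransition (2 - x ^ 2) :=
    Real.smoothTransition.contDiff.comp (by fun_prop)
  refine ⟨⟨fun x => Real.smoothTransition (2 - x ^ 2),
    fun x => Real.smoothTransition (2 - (x / 2) ^ 2) - Real.smoothTransition (2 - x ^ 2),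
    1, 3, one_pos, hsm, ?_, ?_, ?_, ?_, ?_, ?_, ?_, ?_⟩⟩
  · exact (hsm.comp (by fun_prop : ContDiff ℝ ∞ fun x : ℝ => x / 2)).sub hsm
  · intro x; simp
  · intro x; simp [neg_div]
  · intro x; exact Real.smoothTransition.nonneg _
  · intro x
    have := Real.smoothTransition.monotone
      (show 2 - x ^ 2 ≤ 2 - (x / 2) ^ 2 by nlinarith [sq_nonneg x])
    exact sub_nonneg.2 this
  · intro x hx
    by_contra! h
    refine hx (Real.smoothTransition.zero_of_nonpos ?_)
    nlinarith [sq_abs x]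
  · intro x hx
    constructor
    · by_contra! h
      refine hx ?_
      have h2 : x ^ 2 ≤ 1 := by nlinarith [sq_abs x, abs_nonneg x]
      rw [Real.smoothTransition.one_of_one_le (by nlinarith : (1 : ℝ) ≤ 2 - (x / 2) ^ 2),
        Real.smoothTransition.one_of_one_le (by linarith), sub_self]
    · by_contra! h
      refine hx ?_
      have h2 : 9 ≤ x ^ 2 := by nlinarith [sq_abs x, abs_nonneg x]
      rw [Real.smoothTransition.zero_of_nonpos (by nlinarith : 2 - (x / 2) ^ 2 ≤ 0),
        Real.smoothTransition.zero_of_nonpos (by linarith), sub_self]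
  · intro x
    have hmono (j : ℕ) : 0 ≤ Real.smoothTransition (2 - (x / 2 ^ j / 2) ^ 2) -
        Real.smoothTransition (2 - (x / 2 ^ j) ^ 2) := by
      have := Real.smoothTransition.monotone
        (show 2 - (x / 2 ^ j) ^ 2 ≤ 2 - (x / 2 ^ j / 2) ^ 2 by nlinarith [sq_nonneg (x / 2 ^ j)])
      linarith
    rw [hasSum_iff_tendsto_nat_of_nonneg hmono]
    have hsum (n : ℕ) : ∑ j ∈ Finset.range n,
        (Real.smoothTransition (2 - (x / 2 ^ j / 2) ^ 2) -
          Real.smoothTransition (2 - (x / 2 ^ j) ^ 2)) =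
        Real.smoothTransition (2 - (x / 2 ^ n) ^ 2) - Real.smoothTransition (2 - x ^ 2) := by
      have := Finset.sum_range_sub
        (fun j : ℕ => Real.smoothTransition (2 - (x / 2 ^ j) ^ 2)) n
      simpa [pow_succ, div_div] using this
    simp only [hsum]
    refine Filter.Tendsto.sub_const ?_ _
    have h0 : Filter.Tendsto (fun n : ℕ => x / 2 ^ n) Filter.atTop (nhds 0) :=
      tendsto_const_nhds.div_atTop (tendsto_pow_atTop_atTop_of_one_lt one_lt_two)
    have h1 : Filter.Tendsto (fun n : ℕ => Real.smoothTransition (2 - (x / 2 ^ n) ^ 2))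
        Filter.atTop (nhds (Real.smoothTransition (2 - 0 ^ 2))) :=
      (hsm.continuous.tendsto 0).comp h0
    rwa [Real.smoothTransition.one_of_one_le (by norm_num)] at h1

/-- The Fourier multipliers of the Littlewood-Paley blocks. The index `j : ℕ` stands for the
frequency scale `2^(j-1)`, so that `j = 0` is the low-frequency block. -/
def DyadicPartition.multiplier (P : DyadicPartition) : ℕ → ℝ → ℝ
  | 0, x => P.χ x
  | j + 1, x => P.φ (x / 2 ^ j)

/-- The Littlewood-Paley block of `u` with index `j`, as a function of `x`. -/
def lpBlock (P : DyadicPartition) (j : ℕ) {N : ℕ} (u : State N) (x : ℝ) : ℝ :=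
  ∑ n : Modes N, P.multiplier j ((n : ℤ) : ℝ) * u n * trigBasis n x

/-- The norm of the Besov-Hölder space `𝒞^s = B^s_{∞,∞}`. -/
def besovNorm (P : DyadicPartition) (s : ℝ) {N : ℕ} (u : State N) : ENNReal :=
  ⨆ j : ℕ, ENNReal.ofReal ((2 : ℝ) ^ (((j : ℝ) - 1) * s)) * ⨆ x : ℝ, ‖lpBlock P j u x‖ₑ

/-- The set `A_ε` around the neighbouring potential minima. -/
def setA (β ε : ℝ) (N : ℕ) : Set (State N) :=
  {u | 2 * Real.pi / β - √ε * Real.log (1 / ε) < |mean u|}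

/-- The set `B_ε` around the potential minimum at `0`. -/
def setB (P : DyadicPartition) (κ c₀ ε : ℝ) (N : ℕ) : Set (State N) :=
  {u | |mean u| < √ε * Real.log (1 / ε) ∧
    besovNorm P (1 / 2 - κ) (oscillation u) < ENNReal.ofReal (√(c₀ * ε * Real.log (1 / ε)))}

section Capacity

variable {E : Type*} [NormedAddCommGroup E] [InnerProductSpace ℝ E] [FiniteDimensional ℝ E]
  [MeasurableSpace E] [BorelSpace E]

/-- The Gibbs measure `exp (-F(z)/ε) dz` (not normalized). -/
def gibbs (F : E → ℝ) (ε : ℝ) : Measure E :=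
  volume.withDensity fun z => ENNReal.ofReal (Real.exp (-F z / ε))

/-- `G` is the weak (distributional) gradient of `g` on the whole space. -/
def IsWeakGradient (g : E → ℝ) (G : E → E) : Prop :=
  LocallyIntegrable g ∧ LocallyIntegrable G ∧
    ∀ ψ : E → ℝ, ContDiff ℝ ∞ ψ → HasCompactSupport ψ → ∀ v : E,
      ∫ z, g z * fderiv ℝ ψ z v = -∫ z, ψ z * inner ℝ (G z) v

/-- `(g, G)` is an admissible pair for the capacity of `X` and `Y`: `g` belongs to the Sobolev space
`H¹` with respect to the Gibbs measure, `G` is its weak gradient, `g ≥ 1` on `X` and `g = 0` on `Y`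
(almost everywhere). -/
def IsAdmissible (F : E → ℝ) (ε : ℝ) (X Y : Set E) (g : E → ℝ) (G : E → E) : Prop :=
  MemLp g 2 (gibbs F ε) ∧ MemLp G 2 (gibbs F ε) ∧ IsWeakGradient g G ∧
    (∀ᵐ z, z ∈ X → 1 ≤ g z) ∧ (∀ᵐ z, z ∈ Y → g z = 0)

/-- The capacity `inf_g ε ∫ |∇g|² exp (-F/ε) dz`; it is `∞` if there is no admissible `g`. -/
def capacity (F : E → ℝ) (ε : ℝ) (X Y : Set E) : ENNReal :=
  ⨅ (g : E → ℝ) (G : E → E) (_ : IsAdmissible F ε X Y g G),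
    ENNReal.ofReal ε * ∫⁻ z, ‖G z‖ₑ ^ 2 ∂(gibbs F ε)

end Capacity

/-- The Eyring-Kramers asymptotics of the capacity,
`2 √(εγβ ∏_{0<|n|≤N} 2πε/(n²-γβ)) e^{-2πγ/(εβ)}`. -/
def capacityAsymptotics (γ β ε : ℝ) (N : ℕ) : ℝ :=
  2 * √(ε * γ * β *
      ∏ n ∈ (Finset.Icc (-(N : ℤ)) N).filter (fun n => 0 < |n|),
        2 * Real.pi * ε / ((n : ℝ) ^ 2 - γ * β))
    * Real.exp (-(2 * Real.pi * γ) / (ε * β))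

end SineGordon

end

open MeasureTheory
open scoped ContDiff

noncomputable section

namespace SineGordon

/-! ### Product Gaussian laws and their exponential moments -/

section Gaussian

open ProbabilityTheory

variable {ι : Type*} [Fintype ι]

/-! The transitions pass near the two constant saddles ±π/β. The difficulty is to obtain a relative
error of order ε that does not see N. For this, the oscillation v = u_⊥ is never estimated mode by
mode: under the Gaussian law given by the Hessian at the saddle, its variance at each point x is at
most a constant times ε, because ∑ 1/n² converges, and all errors are reduced to exponential moments
of v(x)² at a single x.

Upper bound. The capacity is an infimum, so it suffices to test with a function of the mean alone
(`capacity_le_of_profile`) whose derivative is a truncated Gaussian with the width dictated by the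
saddle (`exists_profile`). What remains is the integral of e^{-F/ε} over the oscillations when the
mean is ±(π/β + s). The energy is bounded below by the quadratic form of the saddle minus a
remainder that carries a factor |s| (`le_energy_near_saddle`). Jensen's inequality in x and the
Gaussian moments turn this remainder into a factor 1 + O(s² + ε) (`lintegral_exp_neg_energy_le`),
and s² averages to O(ε) under the profile.

Lower bound. Only the derivative in the direction of the mean is kept. On a line with fixed
oscillation, the one-dimensional Dirichlet energy is at least the inverse of the resistance ∫
e^{F/ε} da (`inv_lintegral_exp_le`). This resistance is explicit: apart from the confining term, the
mean a enters F only through cos βa and sin βa, so integration over one full period gives a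
Bessel-type integral of the amplitude √(c² + s²), where c and s are the integrals of cos βv and sin
βv (`integral_exp_energy_line`). A Laplace bound and the expansion of c and s restore the Gaussian
weight of the saddle up to a factor 1 - error (`le_inv_lintegral_exp_energy_line`), and the error
has Gaussian mean O(ε) (`lintegral_lineError_le`). The argument needs lines that cross both sets;
for large c₀ the oscillations outside the Besov ball have Gaussian probability O(ε)
(`gaussPi_not_small_le`). The two directions from the central well produce the factor 2 in Λ. -/

/-- The product of the centred Gaussian laws with variances `1 / b i`. -/
def gaussPi (b : ι → ℝ) : Measure (ι → ℝ) :=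
  Measure.pi fun i => gaussianReal 0 (1 / b i).toNNReal

instance (b : ι → ℝ) : IsProbabilityMeasure (gaussPi b) := by
  unfold gaussPi; infer_instance

theorem gaussPi_eq_withDensity {b : ι → ℝ} (hb : ∀ i, 0 < b i) :
    gaussPi b = volume.withDensity fun y : ι → ℝ =>
      ENNReal.ofReal (∏ i, gaussianPDFReal 0 (1 / b i).toNNReal (y i)) := by
  refine Measure.pi_eq fun s hs => ?_
  have hv (i : ι) : (1 / b i).toNNReal ≠ 0 := by
    simp [hb i]
  rw [withDensity_apply _ (MeasurableSet.univ_pi hs), volume_pi, Measure.restrict_pi_pi,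
    ← ofReal_integral_eq_lintegral_ofReal, integral_fintype_prod_eq_prod, ENNReal.ofReal_prod_of_nonneg]
  · refine Finset.prod_congr rfl fun i _ => ?_
    rw [gaussianReal_apply_eq_integral _ (hv i)]
  · exact fun i _ => integral_nonneg fun x => gaussianPDFReal_nonneg _ _ _
  · exact Integrable.fintype_prod fun i => (integrable_gaussianPDFReal _ _).integrableOn
  · exact Filter.Eventually.of_forall fun y =>
      Finset.prod_nonneg fun i _ => gaussianPDFReal_nonneg _ _ _

theorem lintegral_exp_mul_eq_gaussPi {b : ι → ℝ} (hb : ∀ i, 0 < b i) {f : (ι → ℝ) → ENNReal}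
    (hf : Measurable f) :
    ∫⁻ y : ι → ℝ, ENNReal.ofReal (Real.exp (-∑ i, b i * y i ^ 2 / 2)) * f y =
      ENNReal.ofReal (∏ i, √(2 * Real.pi / b i)) * ∫⁻ y, f y ∂gaussPi b := by
  rw [gaussPi_eq_withDensity hb, lintegral_withDensity_eq_lintegral_mul _ _ hf,
    ← lintegral_const_mul]
  · refine lintegral_congr fun y => ?_
    rw [Pi.mul_apply, ← mul_assoc, ← ENNReal.ofReal_mul
      (Finset.prod_nonneg fun i _ => Real.sqrt_nonneg _), ← Finset.prod_mul_distrib]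
    congr 2
    rw [← Finset.sum_neg_distrib, Real.exp_sum]
    refine Finset.prod_congr rfl fun i _ => ?_
    have := hb i
    rw [gaussianPDFReal, Real.coe_toNNReal _ (by positivity), ← mul_assoc,
      show 2 * Real.pi * (1 / b i) = 2 * Real.pi / b i by ring, mul_inv_cancel₀ (by positivity),
      one_mul]
    congr 1
    field_simp
    ring
  · refine Measurable.mul ?_ hf
    exact (Finset.measurable_prod _ fun i _ =>
      (measurable_gaussianPDFReal _ _).comp (measurable_pi_apply i)).ennreal_ofReal
  · exact (Finset.measurable_prod _ fun i _ =>
      (measurable_gaussianPDFReal _ _).comp (measurable_pi_apply i)).ennreal_ofReal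

/-- The characteristic function of a sum of independent coordinates factorizes. This reduces every
moment of v(x), or of one of its Littlewood-Paley blocks at x, to a one-dimensional Gaussian
integral. -/
theorem map_linear_gaussPi {b : ι → ℝ} (hb : ∀ i, 0 < b i) (c : ι → ℝ) :
    (gaussPi b).map (fun y => ∑ i, c i * y i) =
      gaussianReal 0 (∑ i, c i ^ 2 / b i).toNNReal := by
  have hv (i : ι) : 0 ≤ 1 / b i := (one_div_pos.2 (hb i)).le
  have hmeas : Measurable fun y : ι → ℝ => ∑ i, c i * y i :=
    Finset.measurable_sum _ fun i _ => (measurable_pi_apply i).const_mul _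
  have : IsProbabilityMeasure ((gaussPi b).map fun y => ∑ i, c i * y i) :=
    Measure.isProbabilityMeasure_map hmeas.aemeasurable
  refine Measure.ext_of_charFun (funext fun t => ?_)
  rw [charFun_apply_real, integral_map hmeas.aemeasurable
    (by fun_prop : Measurable _).aestronglyMeasurable, charFun_gaussianReal]
  have h1 (y : ι → ℝ) : Complex.exp (t * (∑ i, c i * y i : ℝ) * Complex.I) =
      ∏ i, Complex.exp ((t * c i : ℝ) * y i * Complex.I) := by
    rw [← Complex.exp_sum]
    push_cast
    rw [Finset.mul_sum, Finset.sum_mul]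
    congr 1
    exact Finset.sum_congr rfl fun i _ => by ring
  simp_rw [h1]
  rw [gaussPi, integral_fintype_prod_eq_prod
    (f := fun i (x : ℝ) => Complex.exp ((t * c i : ℝ) * x * Complex.I))]
  simp_rw [← charFun_apply_real, charFun_gaussianReal]
  rw [← Complex.exp_sum]
  congr 1
  rw [Real.coe_toNNReal _ (Finset.sum_nonneg fun i _ => by have := hb i; positivity)]
  push_cast
  rw [mul_zero, zero_mul, zero_sub, Finset.sum_mul, Finset.sum_div, ← Finset.sum_neg_distrib]
  refine Finset.sum_congr rfl fun i _ => ?_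
  rw [Real.coe_toNNReal _ (hv i)]
  push_cast
  ring

/-- For a v ≤ 1/4 the weight consumes at most half of the Gaussian exponent, so the integrand is at
most √2 ≤ 2 times the density of variance 2v. -/
theorem lintegral_exp_sq_gaussianReal_le {v : NNReal} {a : ℝ} (h : a * v ≤ 1 / 4) :
    ∫⁻ x, ENNReal.ofReal (Real.exp (a * x ^ 2)) ∂gaussianReal 0 v ≤ 2 := by
  rcases eq_or_ne v 0 with rfl | hv
  · simp [gaussianReal_zero_var]
  have hv0 : (0 : ℝ) < v := NNReal.coe_pos.2 (pos_iff_ne_zero.2 hv)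
  have hm : Measurable fun x : ℝ => ENNReal.ofReal (Real.exp (a * x ^ 2)) := by fun_prop
  rw [gaussianReal_of_var_ne_zero _ hv, lintegral_withDensity_eq_lintegral_mul _
    (measurable_gaussianPDF _ _) hm]
  calc _ ≤ ∫⁻ x, 2 * gaussianPDF 0 (2 * v) x := by
        refine lintegral_mono fun x => ?_
        simp only [Pi.mul_apply, gaussianPDF]
        rw [← ENNReal.ofReal_mul (gaussianPDFReal_nonneg _ _ _),
          show (2 : ENNReal) = ENNReal.ofReal 2 by simp, ← ENNReal.ofReal_mul (by norm_num)]
        refine ENNReal.ofReal_le_ofReal ?_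
        simp only [gaussianPDFReal, NNReal.coe_mul, NNReal.coe_ofNat, sub_zero]
        rw [mul_assoc, ← Real.exp_add, ← mul_assoc]
        refine mul_le_mul ?_ (Real.exp_le_exp.2 ?_) (Real.exp_pos _).le (by positivity)
        · rw [inv_le_iff_one_le_mul₀ (by positivity), mul_comm, ← mul_assoc, ← div_eq_mul_inv,
            le_div_iff₀ (by positivity), one_mul, mul_comm]
          rw [← Real.sqrt_sq (show (0:ℝ) ≤ 2 by norm_num), ← Real.sqrt_mul (by positivity)]
          refine Real.sqrt_le_sqrt ?_
          norm_num
          nlinarith [Real.pi_pos]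
        · have h2 : a ≤ 1 / (4 * v) := by
            rw [le_div_iff₀ (by positivity)]; linarith
          have h3 := mul_le_mul_of_nonneg_right h2 (sq_nonneg x)
          have h4 : -x ^ 2 / (2 * v) = -2 * (1 / (4 * v) * x ^ 2) := by field_simp; norm_num
          have h5 : -x ^ 2 / (2 * (2 * v)) = -(1 / (4 * v) * x ^ 2) := by field_simp; norm_num
          rw [h4, h5]; linarith
    _ = 2 := by
        rw [lintegral_const_mul _ (measurable_gaussianPDF _ _),
          lintegral_gaussianPDF_eq_one _ (by simpa using hv), mul_one]

theorem lintegral_exp_sq_linear_gaussPi_le {b : ι → ℝ} (hb : ∀ i, 0 < b i) {c : ι → ℝ} {a : ℝ}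
    (h : a * ∑ i, c i ^ 2 / b i ≤ 1 / 4) :
    ∫⁻ y, ENNReal.ofReal (Real.exp (a * (∑ i, c i * y i) ^ 2)) ∂gaussPi b ≤ 2 := by
  have hmeas : Measurable fun y : ι → ℝ => ∑ i, c i * y i :=
    Finset.measurable_sum _ fun i _ => (measurable_pi_apply i).const_mul _
  rw [← lintegral_map (f := fun x : ℝ => ENNReal.ofReal (Real.exp (a * x ^ 2))) (by fun_prop) hmeas,
    map_linear_gaussPi hb]
  refine lintegral_exp_sq_gaussianReal_le ?_
  rwa [Real.coe_toNNReal _ (Finset.sum_nonneg fun i _ => by have := hb i; positivity)]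

end Gaussian

/-! ### Orthogonality of the trigonometric system -/

section Trigonometric

theorem hasDerivAt_trigBasis (n : ℤ) (x : ℝ) :
    HasDerivAt (trigBasis n) (-n * trigBasis (-n) x) x := by
  rcases lt_trichotomy n 0 with h | rfl | h
  · have h1 : ¬ 0 < n := h.le.not_gt
    have h2 : 0 < -n := by omega
    have : trigBasis n = fun x : ℝ => Real.sin (-n * x) / √Real.pi := by
      ext x; simp [trigBasis, h.ne, h1]
    rw [this]
    have h3 := ((((hasDerivAt_id x).const_mul (-n : ℝ)).sin).div_const √Real.pi)
    refine h3.congr_deriv ?_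
    simp [trigBasis, h.ne, h]
    ring
  · have : trigBasis 0 = fun _ : ℝ => (1 : ℝ) := by ext x; simp [trigBasis]
    rw [this]
    simpa using hasDerivAt_const x (1 : ℝ)
  · have : trigBasis n = fun x : ℝ => Real.cos (n * x) / √Real.pi := by
      ext x; simp [trigBasis, h.ne', h]
    rw [this]
    have h3 := ((((hasDerivAt_id x).const_mul (n : ℝ)).cos).div_const √Real.pi)
    refine h3.congr_deriv ?_
    simp [trigBasis, h.ne', h.le.not_gt]
    ring

@[fun_prop]
theorem continuous_trigBasis (n : ℤ) : Continuous (trigBasis n) :=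
  continuous_iff_continuousAt.2 fun x => (hasDerivAt_trigBasis n x).continuousAt

theorem abs_trigBasis_le (n : ℤ) (x : ℝ) : |trigBasis n x| ≤ 1 := by
  have hp : 1 ≤ √Real.pi := Real.one_le_sqrt.2 (by linarith [Real.pi_gt_three])
  unfold trigBasis
  split_ifs
  · simp
  · rw [abs_div, abs_of_pos (by linarith : 0 < √Real.pi), div_le_one (by linarith)]
    exact (Real.abs_cos_le_one _).trans hp
  · rw [abs_div, abs_of_pos (by linarith : 0 < √Real.pi), div_le_one (by linarith)]
    exact (Real.abs_sin_le_one _).trans hp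

theorem trigBasis_periodic (n : ℤ) : Function.Periodic (trigBasis n) (2 * Real.pi) := by
  intro x
  unfold trigBasis
  split_ifs
  · rfl
  · rw [mul_add, Real.cos_add_int_mul_two_pi]
  · have : (-n : ℝ) * (x + 2 * Real.pi) = -n * x + (-n : ℤ) * (2 * Real.pi) := by push_cast; ring
    rw [this, Real.sin_add_int_mul_two_pi]

theorem integral_cos_int_mul (n : ℤ) :
    ∫ x in (0 : ℝ)..(2 * Real.pi), Real.cos (n * x) = if n = 0 then 2 * Real.pi else 0 := by
  split_ifs with h
  · simp [h]
  · have hn : (n : ℝ) ≠ 0 := by exact_mod_cast h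
    have : Real.sin ((n : ℝ) * (2 * Real.pi)) = 0 := by
      have := Real.sin_int_mul_pi (2 * n)
      push_cast at this
      rwa [show (n : ℝ) * (2 * Real.pi) = 2 * n * Real.pi by ring]
    rw [intervalIntegral.integral_comp_mul_left _ hn, integral_cos]
    simp [this]

theorem integral_sin_int_mul (n : ℤ) :
    ∫ x in (0 : ℝ)..(2 * Real.pi), Real.sin (n * x) = 0 := by
  by_cases h : n = 0
  · simp [h]
  · have hn : (n : ℝ) ≠ 0 := by exact_mod_cast h
    rw [intervalIntegral.integral_comp_mul_left _ hn, integral_sin]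
    simp [Real.cos_int_mul_two_pi]

theorem integral_trigBasis {n : ℤ} (hn : n ≠ 0) :
    ∫ x in (0 : ℝ)..(2 * Real.pi), trigBasis n x = 0 := by
  rcases hn.lt_or_gt with h | h
  · have h1 : ¬ 0 < n := h.le.not_gt
    simp only [trigBasis, hn, if_false, h1, intervalIntegral.integral_div]
    have := integral_sin_int_mul (-n)
    push_cast at this
    rw [this, zero_div]
  · simp only [trigBasis, hn, if_false, h, if_true, intervalIntegral.integral_div,
      integral_cos_int_mul, zero_div]

theorem integral_trigBasis_mul {n m : ℤ} (hn : n ≠ 0) (hm : m ≠ 0) :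
    ∫ x in (0 : ℝ)..(2 * Real.pi), trigBasis n x * trigBasis m x = if n = m then 1 else 0 := by
  have hpi := Real.pi_pos
  have hpp : √Real.pi * √Real.pi = Real.pi := Real.mul_self_sqrt hpi.le
  have ic (k : ℤ) : IntervalIntegrable (fun x => Real.cos (k * x)) volume 0 (2 * Real.pi) :=
    (by fun_prop : Continuous fun x : ℝ => Real.cos (k * x)).intervalIntegrable _ _
  have is (k : ℤ) : IntervalIntegrable (fun x => Real.sin (k * x)) volume 0 (2 * Real.pi) :=
    (by fun_prop : Continuous fun x : ℝ => Real.sin (k * x)).intervalIntegrable _ _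
  rcases hn.lt_or_gt with h | h <;> rcases hm.lt_or_gt with h' | h'
  · have e (x : ℝ) : trigBasis n x * trigBasis m x =
        (Real.cos (((n - m : ℤ) : ℝ) * x) - Real.cos (((n + m : ℤ) : ℝ) * x)) / (2 * Real.pi) := by
      simp only [trigBasis, hn, hm, if_false, h.le.not_gt, h'.le.not_gt]
      rw [div_mul_div_comm, hpp]
      push_cast
      rw [show ((n : ℝ) - m) * x = n * x - m * x by ring,
        show ((n : ℝ) + m) * x = n * x + m * x by ring, Real.cos_sub, Real.cos_add, neg_mul, neg_mul,
        Real.sin_neg, Real.sin_neg]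
      field_simp; ring
    simp_rw [e]
    rw [intervalIntegral.integral_div, intervalIntegral.integral_sub (ic _) (ic _),
      integral_cos_int_mul, integral_cos_int_mul, if_neg (by omega : n + m ≠ 0)]
    by_cases hnm : n = m
    · simp [hnm, hpi.ne']
    · simp [hnm, sub_eq_zero]
  · have e (x : ℝ) : trigBasis n x * trigBasis m x =
        (Real.sin (((-n + m : ℤ) : ℝ) * x) + Real.sin (((-n - m : ℤ) : ℝ) * x)) /
          (2 * Real.pi) := by
      simp only [trigBasis, hn, hm, if_false, h.le.not_gt, h', if_true]
      rw [div_mul_div_comm, hpp]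
      push_cast
      rw [show (-(n : ℝ) - m) * x = -n * x - m * x by ring,
        show (-(n : ℝ) + m) * x = -n * x + m * x by ring, Real.sin_sub, Real.sin_add]
      field_simp; ring
    simp_rw [e]
    rw [intervalIntegral.integral_div, intervalIntegral.integral_add (is _) (is _),
      integral_sin_int_mul, integral_sin_int_mul, if_neg (by omega : n ≠ m)]
    simp
  · have e (x : ℝ) : trigBasis n x * trigBasis m x =
        (Real.sin (((-m + n : ℤ) : ℝ) * x) + Real.sin (((-m - n : ℤ) : ℝ) * x)) /
          (2 * Real.pi) := by
      simp only [trigBasis, hn, hm, if_false, h'.le.not_gt, h, if_true]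
      rw [div_mul_div_comm, hpp]
      push_cast
      rw [show (-(m : ℝ) - n) * x = -m * x - n * x by ring,
        show (-(m : ℝ) + n) * x = -m * x + n * x by ring, Real.sin_sub, Real.sin_add]
      field_simp; ring
    simp_rw [e]
    rw [intervalIntegral.integral_div, intervalIntegral.integral_add (is _) (is _),
      integral_sin_int_mul, integral_sin_int_mul, if_neg (by omega : n ≠ m)]
    simp
  · have e (x : ℝ) : trigBasis n x * trigBasis m x =
        (Real.cos (((n - m : ℤ) : ℝ) * x) + Real.cos (((n + m : ℤ) : ℝ) * x)) / (2 * Real.pi) := by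
      simp only [trigBasis, hn, hm, if_false, h, h', if_true]
      rw [div_mul_div_comm, hpp]
      push_cast
      rw [show ((n : ℝ) - m) * x = n * x - m * x by ring,
        show ((n : ℝ) + m) * x = n * x + m * x by ring, Real.cos_sub, Real.cos_add]
      field_simp; ring
    simp_rw [e]
    rw [intervalIntegral.integral_div, intervalIntegral.integral_add (ic _) (ic _),
      integral_cos_int_mul, integral_cos_int_mul, if_neg (by omega : n + m ≠ 0)]
    by_cases hnm : n = m
    · simp [hnm, hpi.ne']
    · simp [hnm, sub_eq_zero]

variable {ι : Type*} [Fintype ι] {f : ι → ℤ}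

theorem integral_trigSum_mul_trigBasis (hf : Function.Injective f) (hf0 : ∀ i, f i ≠ 0)
    (c : ι → ℝ) (i : ι) :
    ∫ x in (0 : ℝ)..(2 * Real.pi), (∑ j, c j * trigBasis (f j) x) * trigBasis (f i) x = c i := by
  classical
  simp_rw [Finset.sum_mul, mul_assoc]
  rw [intervalIntegral.integral_finsetSum fun j _ =>
    (by fun_prop : Continuous _).intervalIntegrable _ _]
  simp_rw [intervalIntegral.integral_const_mul, integral_trigBasis_mul (hf0 _) (hf0 _), hf.eq_iff]
  simp

theorem integral_trigSum_sq (hf : Function.Injective f) (hf0 : ∀ i, f i ≠ 0) (c : ι → ℝ) :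
    ∫ x in (0 : ℝ)..(2 * Real.pi), (∑ j, c j * trigBasis (f j) x) ^ 2 = ∑ i, c i ^ 2 := by
  have e (x : ℝ) : (∑ j, c j * trigBasis (f j) x) ^ 2 =
      ∑ i, c i * ((∑ j, c j * trigBasis (f j) x) * trigBasis (f i) x) := by
    rw [sq, Finset.mul_sum]
    exact Finset.sum_congr rfl fun i _ => by ring
  simp_rw [e]
  rw [intervalIntegral.integral_finsetSum fun j _ =>
    (by fun_prop : Continuous _).intervalIntegrable _ _]
  simp_rw [intervalIntegral.integral_const_mul, integral_trigSum_mul_trigBasis hf hf0]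
  exact Finset.sum_congr rfl fun i _ => by ring

theorem integral_trigSum (hf0 : ∀ i, f i ≠ 0) (c : ι → ℝ) :
    ∫ x in (0 : ℝ)..(2 * Real.pi), (∑ j, c j * trigBasis (f j) x) = 0 := by
  rw [intervalIntegral.integral_finsetSum fun j _ =>
    (by fun_prop : Continuous _).intervalIntegrable _ _]
  simp [intervalIntegral.integral_const_mul, integral_trigBasis (hf0 _)]

end Trigonometric

/-! ### Splitting a state into mean and oscillation -/

section Splitting

/-- The zero wavenumber. -/
def zeroMode (N : ℕ) : Modes N := ⟨0, by simp⟩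

/-- The nonzero wavenumbers `n` with `|n| ≤ N`. -/
abbrev NonzeroModes (N : ℕ) : Type := {n : Modes N // ¬ (n : ℤ) = 0}

variable {N : ℕ}

instance : Unique {n : Modes N // (n : ℤ) = 0} where
  default := ⟨zeroMode N, rfl⟩
  uniq a := Subtype.ext (Subtype.ext a.2)

/-- The oscillating function with the given nonzero Fourier coefficients. -/
def fluct (y : NonzeroModes N → ℝ) (x : ℝ) : ℝ := ∑ n, y n * trigBasis n x

/-- The state space as the product of the line of means and the space of oscillations. -/
def glue (N : ℕ) : (ℝ × (NonzeroModes N → ℝ)) ≃L[ℝ] State N :=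
  LinearEquiv.toContinuousLinearEquiv
    { toFun := fun p => WithLp.toLp 2 fun n => if h : (n : ℤ) = 0 then p.1 else p.2 ⟨n, h⟩
      invFun := fun u => (mean u, fun n : NonzeroModes N => u n)
      map_add' := fun p q => by ext n; by_cases h : (n : ℤ) = 0 <;> simp [h]
      map_smul' := fun c p => by ext n; by_cases h : (n : ℤ) = 0 <;> simp [h]
      left_inv := fun p => by
        refine Prod.ext ?_ (funext fun n => ?_)
        · simp [mean]
        · simp [n.2]
      right_inv := fun u => by
        ext n
        by_cases h : (n : ℤ) = 0
        · have : n = zeroMode N := Subtype.ext h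
          subst this
          simp [mean, zeroMode]
        · simp [h] }

theorem glue_apply (p : ℝ × (NonzeroModes N → ℝ)) (n : Modes N) :
    glue N p n = if h : (n : ℤ) = 0 then p.1 else p.2 ⟨n, h⟩ := rfl

theorem glue_apply_nonzero (p : ℝ × (NonzeroModes N → ℝ)) (n : NonzeroModes N) :
    glue N p n = p.2 n := by
  rw [glue_apply, dif_neg n.2]

@[simp] theorem mean_glue (p : ℝ × (NonzeroModes N → ℝ)) : mean (glue N p) = p.1 := by
  simp [mean, glue_apply]

theorem continuous_mean : Continuous (mean (N := N)) :=
  continuous_fst.comp (glue N).symm.continuous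

theorem measurePreserving_glue (N : ℕ) : MeasurePreserving (glue N) := by
  have h1 := (volume_preserving_funUnique {n : Modes N // (n : ℤ) = 0} ℝ).symm
  have h2 : MeasurePreserving (id : (NonzeroModes N → ℝ) → _) := MeasurePreserving.id _
  have h3 := (volume_preserving_piEquivPiSubtypeProd (fun _ : Modes N => ℝ)
    (fun n => (n : ℤ) = 0)).symm
  have h4 := PiLp.volume_preserving_toLp (Modes N)
  have h1' : MeasurePreserving (MeasurableEquiv.funUnique {n : Modes N // (n : ℤ) = 0} ℝ).symm
      volume volume := by
    convert h1
  have h5 : MeasurePreserving (Prod.map (MeasurableEquiv.funUnique {n : Modes N // (n : ℤ) = 0} ℝ).symm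
      (id : (NonzeroModes N → ℝ) → _)) volume volume := by
    exact h1'.prod h2
  exact h4.comp (h3.comp h5)

theorem measurableEmbedding_glue (N : ℕ) : MeasurableEmbedding (glue N) :=
  (glue N).toHomeomorph.measurableEmbedding

theorem lintegral_state {f : State N → ENNReal} (hf : AEMeasurable f) :
    ∫⁻ u, f u = ∫⁻ y, ∫⁻ a, f (glue N (a, y)) := by
  rw [← (measurePreserving_glue N).lintegral_comp_emb (measurableEmbedding_glue N),
    Measure.volume_eq_prod, lintegral_prod_symm]
  exact hf.comp_quasiMeasurePreserving (measurePreserving_glue N).quasiMeasurePreserving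

theorem ae_ae_of_ae_state {p : State N → Prop} (h : ∀ᵐ u, p u) :
    ∀ᵐ y, ∀ᵐ a, p (glue N (a, y)) := by
  have h1 := (measurePreserving_glue N).quasiMeasurePreserving.ae h
  rw [Measure.volume_eq_prod] at h1
  have h2 := Measure.measurePreserving_swap (μ := (volume : Measure (NonzeroModes N → ℝ)))
    (ν := (volume : Measure ℝ)) |>.quasiMeasurePreserving.ae h1
  exact Measure.ae_ae_of_ae_prod h2

theorem sum_modes (f : Modes N → ℝ) :
    ∑ n, f n = f (zeroMode N) + ∑ n : NonzeroModes N, f n := by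
  rw [← Fintype.sum_subtype_add_sum_subtype (fun n : Modes N => (n : ℤ) = 0)]
  congr 1
  rw [Fintype.sum_unique]
  rfl

theorem toFun_glue (a : ℝ) (y : NonzeroModes N → ℝ) :
    toFun (glue N (a, y)) = fun x => a + fluct y x := by
  ext x
  rw [toFun, sum_modes, fluct]
  simp_rw [glue_apply_nonzero]
  simp [glue_apply, zeroMode, trigBasis]

theorem lpBlock_oscillation_glue (P : DyadicPartition) (j : ℕ) (a : ℝ) (y : NonzeroModes N → ℝ)
    (x : ℝ) : lpBlock P j (oscillation (glue N (a, y))) x =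
      ∑ n : NonzeroModes N, P.multiplier j ((n : ℤ) : ℝ) * y n * trigBasis n x := by
  rw [lpBlock, sum_modes]
  have h (n : NonzeroModes N) : oscillation (glue N (a, y)) n = y n := by
    simp [oscillation, n.2, glue_apply_nonzero]
  simp_rw [h]
  simp [oscillation, zeroMode]

theorem nonzeroModes_injective : Function.Injective fun n : NonzeroModes N => (n : ℤ) :=
  Subtype.val_injective.comp Subtype.val_injective

@[fun_prop]
theorem continuous_fluct : Continuous fun p : (NonzeroModes N → ℝ) × ℝ => fluct p.1 p.2 := by
  unfold fluct
  fun_prop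

theorem continuous_fluct_right (y : NonzeroModes N → ℝ) : Continuous (fluct y) :=
  continuous_fluct.comp (Continuous.prodMk_right y)

theorem integral_fluct_sq (y : NonzeroModes N → ℝ) :
    ∫ x in (0 : ℝ)..(2 * Real.pi), fluct y x ^ 2 = ∑ n, y n ^ 2 :=
  integral_trigSum_sq nonzeroModes_injective (fun n => n.2) y

theorem integral_fluct (y : NonzeroModes N → ℝ) :
    ∫ x in (0 : ℝ)..(2 * Real.pi), fluct y x = 0 :=
  integral_trigSum (fun n => n.2) y

theorem integral_deriv_fluct_sq (y : NonzeroModes N → ℝ) :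
    ∫ x in (0 : ℝ)..(2 * Real.pi), deriv (fluct y) x ^ 2 = ∑ n : NonzeroModes N, (n : ℝ) ^ 2 * y n ^ 2 := by
  have h (x : ℝ) : deriv (fluct y) x = ∑ n : NonzeroModes N, (-(n : ℝ) * y n) * trigBasis (-(n : ℤ)) x := by
    refine HasDerivAt.deriv ?_
    have := HasDerivAt.fun_sum (u := Finset.univ) fun (n : NonzeroModes N) _ =>
      (hasDerivAt_trigBasis n x).const_mul (y n)
    refine this.congr_deriv (Finset.sum_congr rfl fun n _ => by ring)
  simp_rw [h]
  -- Differentiation exchanges the modes n and -n, so orthonormality is applied along the reflected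
  -- family.
  rw [integral_trigSum_sq (f := fun n : NonzeroModes N => -(n : ℤ))
    (neg_injective.comp nonzeroModes_injective) (fun n => neg_ne_zero.2 n.2)]
  exact Finset.sum_congr rfl fun n _ => by ring

theorem continuous_deriv_fluct (y : NonzeroModes N → ℝ) : Continuous (deriv (fluct y)) := by
  have h (x : ℝ) : deriv (fluct y) x = ∑ n : NonzeroModes N, y n * (-(n : ℤ) * trigBasis (-(n : ℤ)) x) :=
    (HasDerivAt.fun_sum fun (n : NonzeroModes N) _ =>
      (hasDerivAt_trigBasis n x).const_mul (y n)).deriv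
  rw [funext h]
  fun_prop

theorem energy_glue (γ β : ℝ) (k : ℕ) (a : ℝ) (y : NonzeroModes N → ℝ) :
    energy γ β k (glue N (a, y)) = ∑ n : NonzeroModes N, (n : ℝ) ^ 2 * y n ^ 2 / 2
      - γ / β * (∫ x in (0 : ℝ)..(2 * Real.pi), Real.cos (β * (a + fluct y x)))
      + (max 0 (|a| - k * (2 * Real.pi / β))) ^ 2 := by
  have hc := continuous_fluct_right y
  have hd := continuous_deriv_fluct y
  rw [energy, toFun_glue, mean_glue]
  simp only [deriv_const_add']
  rw [intervalIntegral.integral_sub, intervalIntegral.integral_div,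
    intervalIntegral.integral_const_mul, integral_deriv_fluct_sq, Finset.sum_div]
  · exact (by fun_prop : Continuous _).intervalIntegrable _ _
  · exact (by fun_prop : Continuous _).intervalIntegrable _ _

theorem continuous_energy (γ β : ℝ) (k : ℕ) : Continuous (energy γ β k (N := N)) := by
  have h : Continuous fun p : ℝ × (NonzeroModes N → ℝ) => energy γ β k (glue N p) := by
    have : (fun p : ℝ × (NonzeroModes N → ℝ) => energy γ β k (glue N p)) = fun p =>
      ∑ n : NonzeroModes N, (n : ℝ) ^ 2 * p.2 n ^ 2 / 2
      - γ / β * (∫ x in (0 : ℝ)..(2 * Real.pi), Real.cos (β * (p.1 + fluct p.2 x)))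
      + (max 0 (|p.1| - k * (2 * Real.pi / β))) ^ 2 := funext fun p => energy_glue _ _ _ _ _
    rw [this]
    have h2 : Continuous fun p : ℝ × (NonzeroModes N → ℝ) =>
        ∫ x in (0 : ℝ)..(2 * Real.pi), Real.cos (β * (p.1 + fluct p.2 x)) := by
      refine intervalIntegral.continuous_parametric_intervalIntegral_of_continuous' ?_ _ _
      fun_prop
    fun_prop
  have := h.comp (glue N).symm.continuous
  simpa [Function.comp_def] using this

theorem prod_nonzeroModes (f : ℤ → ℝ) :
    ∏ n ∈ (Finset.Icc (-(N : ℤ)) N).filter (fun n => 0 < |n|), f n =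
      ∏ n : NonzeroModes N, f n := by
  symm
  refine Finset.prod_bij (fun (n : NonzeroModes N) _ => (n : ℤ)) (fun n _ => ?_)
    (fun n _ m _ h => nonzeroModes_injective h) (fun n hn => ?_) (fun n _ => rfl)
  · exact Finset.mem_filter.2 ⟨n.1.2, abs_pos.2 n.2⟩
  · rw [Finset.mem_filter, abs_pos] at hn
    exact ⟨⟨⟨n, hn.1⟩, hn.2⟩, Finset.mem_univ _, rfl⟩

end Splitting

/-! ### Moments of the oscillation, uniformly in the number of modes -/

section Fluctuations

variable {N : ℕ} {γ β ε : ℝ}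

/-- The inverse variances of the Fourier coefficients under the Gaussian law of the oscillations at
the saddle. -/
def modeRate (γ β ε : ℝ) (n : NonzeroModes N) : ℝ := ((n : ℝ) ^ 2 - γ * β) / ε

theorem one_le_sq_nonzeroModes (n : NonzeroModes N) : (1 : ℝ) ≤ (n : ℝ) ^ 2 := by
  have h : (1 : ℤ) ≤ (n : ℤ) ^ 2 := by
    have := sq_pos_of_ne_zero n.2
    omega
  exact_mod_cast h

theorem modeRate_pos (h : γ * β < 1) (hε : 0 < ε) (n : NonzeroModes N) : 0 < modeRate γ β ε n :=
  div_pos (by linarith [one_le_sq_nonzeroModes n]) hε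

theorem le_modeRate (h0 : 0 < γ * β) (hε : 0 < ε) (n : NonzeroModes N) :
    (1 - γ * β) * (n : ℝ) ^ 2 / ε ≤ modeRate γ β ε n := by
  unfold modeRate
  gcongr
  nlinarith [one_le_sq_nonzeroModes n]

/-- A bound for the pointwise variance of the oscillations, per unit of temperature. -/
def varBound (γ β : ℝ) : ℝ := (∑' n : ℤ, 1 / (n : ℝ) ^ 2) / (1 - γ * β) + 1

theorem one_le_varBound (h : γ * β < 1) : 1 ≤ varBound γ β := by
  have : 0 ≤ (∑' n : ℤ, 1 / (n : ℝ) ^ 2) / (1 - γ * β) :=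
    div_nonneg (tsum_nonneg fun n => by positivity) (by linarith)
  unfold varBound
  linarith

/-- This is the source of the uniformity in N: the inverse variances grow like n²/ε and ∑ 1/n²
converges. The series over all integers is harmless, as its term at n = 0 is 1/0 = 0. -/
theorem sum_sq_div_modeRate_le (h0 : 0 < γ * β) (h : γ * β < 1) (hε : 0 < ε)
    {c : NonzeroModes N → ℝ} (hc : ∀ n, |c n| ≤ 1) :
    ∑ n, c n ^ 2 / modeRate γ β ε n ≤ ε * varBound γ β := by
  have h1 : ∑ n : NonzeroModes N, 1 / (n : ℝ) ^ 2 ≤ ∑' n : ℤ, 1 / (n : ℝ) ^ 2 := by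
    have hs : Summable fun n : ℤ => 1 / (n : ℝ) ^ 2 := Real.summable_one_div_int_pow.2 one_lt_two
    have := hs.sum_le_tsum (Finset.univ.map ⟨_, nonzeroModes_injective (N := N)⟩)
      fun n _ => by positivity
    rwa [Finset.sum_map] at this
  calc ∑ n, c n ^ 2 / modeRate γ β ε n
      ≤ ∑ n : NonzeroModes N, ε / (1 - γ * β) * (1 / (n : ℝ) ^ 2) := by
        refine Finset.sum_le_sum fun n _ => ?_
        have h2 := one_le_sq_nonzeroModes n
        have h3 : 0 < (1 - γ * β) * (n : ℝ) ^ 2 / ε :=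
          div_pos (mul_pos (by linarith) (by linarith)) hε
        have h4 : c n ^ 2 ≤ 1 := (sq_le_one_iff_abs_le_one _).2 (hc n)
        calc c n ^ 2 / modeRate γ β ε n ≤ 1 / ((1 - γ * β) * (n : ℝ) ^ 2 / ε) :=
              div_le_div₀ zero_le_one h4 h3 (le_modeRate h0 hε n)
          _ = _ := by field_simp
    _ ≤ ε / (1 - γ * β) * ∑' n : ℤ, 1 / (n : ℝ) ^ 2 := by
        rw [← Finset.mul_sum]
        exact mul_le_mul_of_nonneg_left h1 (div_nonneg hε.le (by linarith))
    _ ≤ _ := by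
        unfold varBound
        rw [mul_add, mul_one, div_mul_eq_mul_div, mul_div_assoc]
        linarith

theorem lintegral_exp_fluct_sq_le (h0 : 0 < γ * β) (h : γ * β < 1) (hε : 0 < ε) {a : ℝ}
    (ha : 0 ≤ a) (ha' : a * (ε * varBound γ β) ≤ 1 / 4) (x : ℝ) :
    ∫⁻ y : NonzeroModes N → ℝ, ENNReal.ofReal (Real.exp (a * fluct y x ^ 2))
      ∂gaussPi (modeRate γ β ε) ≤ 2 := by
  have e (y : NonzeroModes N → ℝ) : fluct y x = ∑ n : NonzeroModes N, trigBasis n x * y n :=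
    Finset.sum_congr rfl fun n _ => mul_comm _ _
  simp_rw [e]
  refine lintegral_exp_sq_linear_gaussPi_le (modeRate_pos h hε) (le_trans ?_ ha')
  exact mul_le_mul_of_nonneg_left
    (sum_sq_div_modeRate_le h0 h hε fun n => abs_trigBasis_le _ _) ha

theorem lintegral_integral_le_of_le {α : Type*} [MeasurableSpace α] {μ : Measure α} [SFinite μ]
    {f : α → ℝ → ℝ} (hf : Measurable (Function.uncurry f)) {s t : ℝ} (hst : s ≤ t)
    {M : ENNReal} (h : ∀ x, ∫⁻ y, ENNReal.ofReal (f y x) ∂μ ≤ M) :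
    ∫⁻ y, ENNReal.ofReal (∫ x in s..t, f y x) ∂μ ≤ ENNReal.ofReal (t - s) * M := by
  calc ∫⁻ y, ENNReal.ofReal (∫ x in s..t, f y x) ∂μ
      ≤ ∫⁻ y, (∫⁻ x in Set.Ioc s t, ENNReal.ofReal (f y x)) ∂μ := by
        refine lintegral_mono fun y => ?_
        rw [intervalIntegral.integral_of_le hst]
        by_cases hi : Integrable (f y) (volume.restrict (Set.Ioc s t))
        · refine (ENNReal.ofReal_le_ofReal (integral_mono_ae hi hi.pos_part
            (Filter.Eventually.of_forall fun x => le_max_left _ 0))).trans ?_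
          rw [ofReal_integral_eq_lintegral_ofReal hi.pos_part
            (Filter.Eventually.of_forall fun x => le_max_right _ _)]
          refine lintegral_mono fun x => ?_
          simp [ENNReal.ofReal_max]
        -- A non-integrable section has Bochner integral 0 by convention.
        · simp [integral_undef hi]
    _ = ∫⁻ x in Set.Ioc s t, ∫⁻ y, ENNReal.ofReal (f y x) ∂μ :=
        lintegral_lintegral_swap hf.ennreal_ofReal.aemeasurable
    _ ≤ ∫⁻ x in Set.Ioc s t, M := lintegral_mono fun x => h x
    _ = _ := by rw [setLIntegral_const, Real.volume_Ioc, mul_comm]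

/-- Tonelli exchanges x and y, after which only the law of v(x) at one point matters. Both error
terms of order ε, at the saddle and along the lines, are averaged through this bound. -/
theorem lintegral_integral_fluct_le (h0 : 0 < γ * β) (h : γ * β < 1) (hε : 0 < ε) {a K : ℝ}
    (ha : 0 ≤ a) (ha' : a * (ε * varBound γ β) ≤ 1 / 4) (hK : 0 ≤ K) {ψ : ℝ → ℝ}
    (hψ : Continuous ψ) (hle : ∀ t, ψ t ≤ K * Real.exp (a * t ^ 2)) :
    ∫⁻ y : NonzeroModes N → ℝ, ENNReal.ofReal (∫ x in (0 : ℝ)..(2 * Real.pi), ψ (fluct y x))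
      ∂gaussPi (modeRate γ β ε) ≤ ENNReal.ofReal (4 * Real.pi * K) := by
  have := lintegral_integral_le_of_le (μ := gaussPi (modeRate (N := N) γ β ε))
    (f := fun y x => ψ (fluct y x)) (by fun_prop : Continuous _).measurable
    (by positivity : (0 : ℝ) ≤ 2 * Real.pi) (M := ENNReal.ofReal K * 2) fun x => ?_
  · refine this.trans (le_of_eq ?_)
    rw [sub_zero, show (2 : ENNReal) = ENNReal.ofReal 2 by simp, ← ENNReal.ofReal_mul hK,
      ← ENNReal.ofReal_mul (by positivity)]
    congr 1; ring
  · calc _ ≤ ∫⁻ y : NonzeroModes N → ℝ, ENNReal.ofReal K *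
          ENNReal.ofReal (Real.exp (a * fluct y x ^ 2)) ∂gaussPi (modeRate γ β ε) := by
          refine lintegral_mono fun y => ?_
          rw [← ENNReal.ofReal_mul hK]
          exact ENNReal.ofReal_le_ofReal (hle _)
      _ ≤ _ := by
          rw [lintegral_const_mul' _ _ ENNReal.ofReal_ne_top]
          gcongr
          exact lintegral_exp_fluct_sq_le h0 h hε ha ha' x

/-- Jensen's inequality for the normalized measure on the circle, which is why 2π appears in the
exponent. It moves the exponential inside the x-integral, so that no joint law of the values of v is
needed. -/
theorem exp_integral_le {φ : ℝ → ℝ} (hφ : Continuous φ) :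
    Real.exp (∫ x in (0 : ℝ)..(2 * Real.pi), φ x) ≤
      (∫ x in (0 : ℝ)..(2 * Real.pi), Real.exp (2 * Real.pi * φ x)) / (2 * Real.pi) := by
  have hp : (0 : ℝ) < 2 * Real.pi := by positivity
  have hc : Continuous fun x => 2 * Real.pi * φ x := by fun_prop
  have := convexOn_exp.map_set_average_le Real.continuous_exp.continuousOn isClosed_univ
    (t := Set.Ioc 0 (2 * Real.pi)) (μ := volume) (f := fun x => 2 * Real.pi * φ x)
    (by simp [Real.pi_pos]) (by simp [ENNReal.mul_eq_top]) (by simp)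
    (hc.integrableOn_Ioc) (by exact (Real.continuous_exp.comp hc).integrableOn_Ioc)
  rw [setAverage_eq, setAverage_eq, measureReal_def, Real.volume_Ioc, sub_zero,
    ENNReal.toReal_ofReal hp.le, ← intervalIntegral.integral_of_le hp.le,
    ← intervalIntegral.integral_of_le hp.le, intervalIntegral.integral_const_mul, smul_eq_mul,
    smul_eq_mul, inv_mul_cancel_left₀ hp.ne'] at this
  rwa [div_eq_inv_mul]

end Fluctuations

/-! ### Integral of the Gibbs weight over the oscillations near a saddle -/

section Saddle

variable {N : ℕ} {γ β ε : ℝ}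

theorem abs_sin_sub_self_le_sq (z : ℝ) : |Real.sin z - z| ≤ 2 * z ^ 2 := by
  rcases le_or_gt |z| 1 with h | h
  · have h1 := abs_le.1 (Real.sin_bound h)
    have h2 : |z| ^ 2 = z ^ 2 := sq_abs z
    have h3 : |z ^ 3| = |z| ^ 3 := abs_pow z 3
    have h4 := abs_le.1 h3.le
    have h5 : |z| ^ 3 ≤ |z| ^ 2 := pow_le_pow_of_le_one (abs_nonneg z) h (by norm_num)
    have h6 : |z| ^ 5 ≤ |z| ^ 2 := pow_le_pow_of_le_one (abs_nonneg z) h (by norm_num)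
    rw [abs_le]
    constructor <;> nlinarith [h1.1, h1.2, h4.1, h4.2, sq_nonneg |z|]
  · calc |Real.sin z - z| ≤ |Real.sin z| + |z| := abs_sub _ _
      _ ≤ |z| + |z| := add_le_add_left Real.abs_sin_le_abs _
      _ ≤ 2 * z ^ 2 := by nlinarith [sq_abs z]

theorem abs_sin_sub_self_le_cube (z : ℝ) : |Real.sin z - z| ≤ 2 * |z| ^ 3 := by
  rcases le_or_gt |z| 1 with h | h
  · have h1 := abs_le.1 (Real.sin_bound h)
    have h3 : |z ^ 3| = |z| ^ 3 := abs_pow z 3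
    have h4 := abs_le.1 h3.le
    have h6 : |z| ^ 5 ≤ |z| ^ 3 := pow_le_pow_of_le_one (abs_nonneg z) h (by norm_num)
    have h7 : 0 ≤ |z| ^ 3 := by positivity
    rw [abs_le]
    constructor <;> nlinarith [h1.1, h1.2, h4.1, h4.2]
  · refine (abs_sin_sub_self_le_sq z).trans ?_
    rw [← sq_abs]
    gcongr <;> first | exact h.le | norm_num

/-- In cos s cos w - sin s sin w the first product costs at most w²/2, since cos w ≥ 1 - w²/2. Only
the second leaves a nonlinear remainder, and it is multiplied by sin s. Hence the remainder vanishes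
at the saddle itself. -/
theorem cos_add_ge (s w : ℝ) : Real.cos s - w ^ 2 / 2 - Real.sin s * w - |s| * |Real.sin w - w| ≤
    Real.cos (s + w) := by
  have h1 : |Real.cos s * (Real.cos w - 1)| ≤ w ^ 2 / 2 := by
    rw [abs_mul]
    have := Real.one_sub_sq_div_two_le_cos (x := w)
    have h2 : |Real.cos w - 1| ≤ w ^ 2 / 2 := by
      rw [abs_le]; constructor <;> linarith [Real.cos_le_one w, sq_nonneg w]
    nlinarith [Real.abs_cos_le_one s, abs_nonneg (Real.cos w - 1), abs_nonneg (Real.cos s)]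
  have h3 : |Real.sin s * (Real.sin w - w)| ≤ |s| * |Real.sin w - w| := by
    rw [abs_mul]
    exact mul_le_mul_of_nonneg_right Real.abs_sin_le_abs (abs_nonneg _)
  rw [Real.cos_add]
  linarith [(abs_le.1 h1).1, (abs_le.1 h3).2]

/-- A shift of the mean by half a period changes the sign of the cosine, so `cos_add_ge` bounds the
energy from below. The term linear in v integrates to zero, the quadratic one turns n² into n² - γβ,
and the confining square is dropped. -/
theorem le_energy_near_saddle (hγ : 0 < γ) (hβ : 0 < β) (k : ℕ) {σ : ℝ} (hσ : σ = 1 ∨ σ = -1)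
    (s : ℝ) (y : NonzeroModes N → ℝ) :
    ∑ n : NonzeroModes N, ((n : ℝ) ^ 2 - γ * β) * y n ^ 2 / 2
        + 2 * Real.pi * γ / β * Real.cos (β * s)
        - γ * |s| * (∫ x in (0 : ℝ)..(2 * Real.pi),
            |Real.sin (β * fluct y x) - β * fluct y x|) ≤
      energy γ β k (glue N (σ * (Real.pi / β + s), y)) := by
  have hc := continuous_fluct_right y
  have h1 (x : ℝ) : Real.cos (β * (σ * (Real.pi / β + s) + fluct y x)) ≤
      -Real.cos (β * s) + β ^ 2 / 2 * fluct y x ^ 2 + (Real.sin (β * s) * σ * β) * fluct y x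
        + β * |s| * |Real.sin (β * fluct y x) - β * fluct y x| := by
    have h2 := cos_add_ge (β * s) (σ * (β * fluct y x))
    have h3 : |Real.sin (σ * (β * fluct y x)) - σ * (β * fluct y x)| =
        |Real.sin (β * fluct y x) - β * fluct y x| := by
      rcases hσ with rfl | rfl
      · simp
      · rw [neg_one_mul, Real.sin_neg, ← neg_sub_neg, abs_sub_comm]
        congr 1; ring
    have h4 : Real.cos (β * (σ * (Real.pi / β + s) + fluct y x)) =
        -Real.cos (β * s + σ * (β * fluct y x)) := by
      rcases hσ with rfl | rfl
      · rw [← Real.cos_add_pi]; congr 1; field_simp; ring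
      · rw [← Real.cos_add_pi, ← Real.cos_neg]; congr 1; field_simp; ring
    rw [h3, abs_mul, abs_of_pos hβ] at h2
    rw [h4]
    have h5 : (σ * (β * fluct y x)) ^ 2 = β ^ 2 * fluct y x ^ 2 := by
      rcases hσ with rfl | rfl <;> ring
    rw [h5] at h2
    linarith
  have h2 := intervalIntegral.integral_mono_on (a := 0) (b := 2 * Real.pi) (μ := volume)
    (by positivity) ((by fun_prop : Continuous _).intervalIntegrable _ _)
    ((by fun_prop : Continuous _).intervalIntegrable _ _) fun x _ => h1 x
  rw [intervalIntegral.integral_add, intervalIntegral.integral_add, intervalIntegral.integral_add,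
    intervalIntegral.integral_const, intervalIntegral.integral_const_mul,
    intervalIntegral.integral_const_mul, intervalIntegral.integral_const_mul,
    integral_fluct, integral_fluct_sq] at h2
  · rw [energy_glue]
    have h3 := mul_le_mul_of_nonneg_left h2 (div_pos hγ hβ).le
    have h4 := sq_nonneg (max 0 (|σ * (Real.pi / β + s)| - k * (2 * Real.pi / β)))
    have h5 : γ / β * ((2 * Real.pi - 0) • -Real.cos (β * s) + β ^ 2 / 2 * ∑ n, y n ^ 2 +
        Real.sin (β * s) * σ * β * 0 + β * |s| * ∫ x in (0 : ℝ)..(2 * Real.pi),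
            |Real.sin (β * fluct y x) - β * fluct y x|) =
        -(2 * Real.pi * γ / β * Real.cos (β * s)) + γ * β / 2 * ∑ n, y n ^ 2 +
        γ * |s| * ∫ x in (0 : ℝ)..(2 * Real.pi),
            |Real.sin (β * fluct y x) - β * fluct y x| := by
      rw [smul_eq_mul]
      field_simp
      ring
    have h6 : ∑ n : NonzeroModes N, ((n : ℝ) ^ 2 - γ * β) * y n ^ 2 / 2 =
        ∑ n : NonzeroModes N, (n : ℝ) ^ 2 * y n ^ 2 / 2 - γ * β / 2 * ∑ n, y n ^ 2 := by
      rw [Finset.mul_sum, ← Finset.sum_sub_distrib]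
      exact Finset.sum_congr rfl fun n _ => by ring
    rw [h5] at h3
    rw [h6]
    linarith
  all_goals exact (by fun_prop : Continuous _).intervalIntegrable _ _

theorem exp_le_one_add_mul_exp {w : ℝ} : Real.exp w ≤ 1 + w * Real.exp w := by
  have h := Real.add_one_le_exp (-w)
  have h2 := mul_le_mul_of_nonneg_right h (Real.exp_pos w).le
  rw [← Real.exp_add, neg_add_cancel, Real.exp_zero] at h2
  linarith

/-- The normalization of the Gaussian law of the oscillations at the saddle. -/
def gaussConst (γ β ε : ℝ) (N : ℕ) : ℝ := ∏ n : NonzeroModes N, √(2 * Real.pi / modeRate γ β ε n)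

theorem gaussConst_nonneg : 0 ≤ gaussConst γ β ε N :=
  Finset.prod_nonneg fun _ _ => Real.sqrt_nonneg _

/-- The half-width of the window around the saddle in which the oscillations are controlled. -/
def window (γ β : ℝ) : ℝ := 1 / (32 * Real.pi * γ * β ^ 2 * varBound γ β)

theorem window_pos (hγ : 0 < γ) (hβ : 0 < β) (h : γ * β < 1) : 0 < window γ β := by
  have := one_le_varBound h
  unfold window; positivity

/-- The exponent is estimated twice: quadratically in t, to remain integrable under the Gaussian
law, and cubically, to be small. The inequality e^w ≤ 1 + w e^w uses the cubic bound in the factor w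
and the quadratic one in the exponential. -/
theorem exp_remainder_le (hγ : 0 < γ) (hβ : 0 < β) (h : γ * β < 1) (hε : 0 < ε) {s : ℝ}
    (hs : 2 * |s| ≤ window γ β) (t : ℝ) :
    Real.exp (2 * Real.pi * (γ * |s| / ε * |Real.sin (β * t) - β * t|)) ≤
      1 + 2 * Real.pi * γ * β ^ 3 * (8 * varBound γ β + 128 * varBound γ β ^ 2) * (s ^ 2 + ε) *
        Real.exp (1 / (4 * varBound γ β * ε) * t ^ 2) := by
  set V := varBound γ β with hV
  have hV1 : 1 ≤ V := one_le_varBound h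
  set w := 2 * Real.pi * (γ * |s| / ε * |Real.sin (β * t) - β * t|) with hw
  set X := t ^ 2 / ε with hX
  have hX0 : 0 ≤ X := by positivity
  -- The width of `window` is chosen for this: it makes the quadratic bound a small fraction of the
  -- exponent 1/(4V) allowed by the variance bound.
  have hw2 : w ≤ X / (8 * V) := by
    have h1 := abs_sin_sub_self_le_sq (β * t)
    calc w ≤ 2 * Real.pi * (γ * |s| / ε * (2 * (β * t) ^ 2)) := by rw [hw]; gcongr
      _ = (2 * |s|) * (2 * Real.pi * γ * β ^ 2 * X) := by rw [hX]; field_simp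
      _ ≤ window γ β * (2 * Real.pi * γ * β ^ 2 * X) := by gcongr
      _ = X / (16 * V) := by rw [window, ← hV]; field_simp; ring
      _ ≤ _ := by gcongr; norm_num
  -- The inequality 2|s||t| ≤ s² + t² splits the mixed term |s||t|³/ε into s² t²/ε and t⁴/ε, which
  -- are of Gaussian order s² and ε.
  have hw3 : w ≤ 2 * Real.pi * γ * β ^ 3 * (s ^ 2 * X + ε * X ^ 2) := by
    have h1 := abs_sin_sub_self_le_cube (β * t)
    have h2 : 2 * (|s| * |t|) ≤ s ^ 2 + t ^ 2 := by
      nlinarith [sq_nonneg (|s| - |t|), sq_abs s, sq_abs t]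
    have h3 : ε * X = t ^ 2 := by rw [hX]; field_simp
    calc w ≤ 2 * Real.pi * (γ * |s| / ε * (2 * |β * t| ^ 3)) := by rw [hw]; gcongr
      _ = 2 * Real.pi * γ * β ^ 3 * (2 * (|s| * |t|) * X) := by
          rw [abs_mul, abs_of_pos hβ, hX, ← sq_abs t]; field_simp
      _ ≤ 2 * Real.pi * γ * β ^ 3 * ((s ^ 2 + t ^ 2) * X) := by gcongr
      _ = _ := by rw [← h3]; ring
  -- One factor e^q comes from the exponential and a second absorbs the powers of X; together they
  -- give exactly e^{X/(4V)}, the critical moment.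
  set q := X / (8 * V) with hq
  have hq0 : 0 ≤ q := by positivity
  have hXq : X = 8 * V * q := by rw [hq]; field_simp
  have e1 : q ≤ Real.exp q := by linarith [Real.add_one_le_exp q]
  have e2 : q ^ 2 ≤ 2 * Real.exp q := by linarith [Real.quadratic_le_exp_of_nonneg hq0]
  have e3 : Real.exp (1 / (4 * V * ε) * t ^ 2) = Real.exp q * Real.exp q := by
    rw [← Real.exp_add, hq, hX]; congr 1; field_simp; ring
  rw [e3]
  have hA : 0 < 2 * Real.pi * γ * β ^ 3 := by positivity
  calc Real.exp w ≤ 1 + w * Real.exp w := exp_le_one_add_mul_exp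
    _ ≤ 1 + (2 * Real.pi * γ * β ^ 3 * (s ^ 2 * X + ε * X ^ 2)) * Real.exp q := by
        have hw0 : 0 ≤ w := by positivity
        gcongr
    _ ≤ 1 + (2 * Real.pi * γ * β ^ 3 * ((s ^ 2 * (8 * V) + ε * (128 * V ^ 2)) * Real.exp q)) *
          Real.exp q := by
        gcongr
        rw [hXq]
        nlinarith [mul_le_mul_of_nonneg_left e1 (by positivity : 0 ≤ s ^ 2 * (8 * V)),
          mul_le_mul_of_nonneg_left e2 (by positivity : 0 ≤ ε * (64 * V ^ 2))]
    _ ≤ 1 + (2 * Real.pi * γ * β ^ 3 * (((8 * V + 128 * V ^ 2) * (s ^ 2 + ε)) * Real.exp q)) *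
          Real.exp q := by
        gcongr
        nlinarith [mul_nonneg (sq_nonneg s) (sq_nonneg V), mul_nonneg hε.le (by linarith : 0 ≤ V)]
    _ = _ := by ring

/-- The relative error of the Gaussian approximation at the saddle. -/
def saddleError (γ β : ℝ) : ℝ :=
  4 * Real.pi * γ * β ^ 3 * (8 * varBound γ β + 128 * varBound γ β ^ 2)

theorem saddleError_pos (hγ : 0 < γ) (hβ : 0 < β) (h : γ * β < 1) : 0 < saddleError γ β := by
  have := one_le_varBound h
  unfold saddleError; positivity

/-- The quadratic part of the energy is absorbed into the Gaussian law and its normalization. The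
remainder then has an exponential expectation, which Jensen and `exp_remainder_le` bound by 1 + O(s²
+ ε) for every N. -/
theorem lintegral_exp_neg_energy_le (hγ : 0 < γ) (hβ : 0 < β) (h : γ * β < 1) (hε : 0 < ε) (k : ℕ)
    {σ : ℝ} (hσ : σ = 1 ∨ σ = -1) {s : ℝ} (hs : 2 * |s| ≤ window γ β) :
    ∫⁻ y : NonzeroModes N → ℝ, ENNReal.ofReal
        (Real.exp (-energy γ β k (glue N (σ * (Real.pi / β + s), y)) / ε)) ≤
      ENNReal.ofReal (Real.exp (-(2 * Real.pi * γ / β * Real.cos (β * s)) / ε) *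
        gaussConst γ β ε N * (1 + saddleError γ β * (s ^ 2 + ε))) := by
  have h0 : 0 < γ * β := mul_pos hγ hβ
  have hV1 : 1 ≤ varBound γ β := one_le_varBound h
  have hp := Real.pi_pos
  set R : (NonzeroModes N → ℝ) → ℝ := fun y => ∫ x in (0 : ℝ)..(2 * Real.pi),
    γ * |s| / ε * |Real.sin (β * fluct y x) - β * fluct y x| with hR
  have hRc : Continuous R := by
    refine intervalIntegral.continuous_parametric_intervalIntegral_of_continuous' ?_ _ _
    fun_prop
  set E0 := Real.exp (-(2 * Real.pi * γ / β * Real.cos (β * s)) / ε) with hE0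
  have h1 (y : NonzeroModes N → ℝ) :
      ENNReal.ofReal (Real.exp (-energy γ β k (glue N (σ * (Real.pi / β + s), y)) / ε)) ≤
      ENNReal.ofReal E0 * (ENNReal.ofReal (Real.exp (-∑ n, modeRate γ β ε n * y n ^ 2 / 2)) *
        ENNReal.ofReal (Real.exp (R y))) := by
    rw [← ENNReal.ofReal_mul (Real.exp_pos _).le, ← ENNReal.ofReal_mul (Real.exp_pos _).le,
      ← Real.exp_add, ← Real.exp_add]
    refine ENNReal.ofReal_le_ofReal (Real.exp_le_exp.2 ?_)
    have h2 := le_energy_near_saddle hγ hβ k hσ s y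
    have h3 : ∑ n : NonzeroModes N, modeRate γ β ε n * y n ^ 2 / 2 =
        (∑ n : NonzeroModes N, ((n : ℝ) ^ 2 - γ * β) * y n ^ 2 / 2) / ε := by
      rw [Finset.sum_div]
      exact Finset.sum_congr rfl fun n _ => by rw [modeRate]; ring
    have h4 : R y = γ * |s| * (∫ x in (0 : ℝ)..(2 * Real.pi),
        |Real.sin (β * fluct y x) - β * fluct y x|) / ε := by
      simp only [hR]
      rw [intervalIntegral.integral_const_mul]; ring
    rw [h3, h4, ← neg_div, ← add_div, ← add_div]
    gcongr
    linarith
  set K := 2 * Real.pi * γ * β ^ 3 * (8 * varBound γ β + 128 * varBound γ β ^ 2) * (s ^ 2 + ε)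
    with hK
  have hK0 : 0 ≤ K := by positivity
  have h2 : ∫⁻ y, ENNReal.ofReal (Real.exp (R y)) ∂gaussPi (modeRate (N := N) γ β ε) ≤
      ENNReal.ofReal (1 + 2 * K) := by
    set J : (NonzeroModes N → ℝ) → ℝ := fun y => ∫ x in (0 : ℝ)..(2 * Real.pi),
      K * Real.exp (1 / (4 * varBound γ β * ε) * fluct y x ^ 2) with hJ
    have hJ0 (y) : 0 ≤ J y := intervalIntegral.integral_nonneg (by positivity)
      fun x _ => by positivity
    have h3 (y : NonzeroModes N → ℝ) : Real.exp (R y) ≤ 1 + J y / (2 * Real.pi) := by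
      have hc := continuous_fluct_right y
      refine (exp_integral_le (by fun_prop)).trans ?_
      rw [div_le_iff₀ (by positivity), add_mul, div_mul_cancel₀ _ (by positivity), one_mul]
      have h4 := intervalIntegral.integral_mono_on (a := 0) (b := 2 * Real.pi) (μ := volume)
        (by positivity) ((by fun_prop : Continuous _).intervalIntegrable _ _)
        ((by fun_prop : Continuous _).intervalIntegrable _ _)
        fun x _ => exp_remainder_le hγ hβ h hε hs (fluct y x)
      rw [intervalIntegral.integral_add, intervalIntegral.integral_const, sub_zero, smul_eq_mul,
        mul_one] at h4
      · exact h4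
      all_goals exact (by fun_prop : Continuous _).intervalIntegrable _ _
    calc _ ≤ ∫⁻ y, (1 + ENNReal.ofReal (1 / (2 * Real.pi)) * ENNReal.ofReal (J y))
          ∂gaussPi (modeRate (N := N) γ β ε) := by
          refine lintegral_mono fun y => ?_
          rw [← ENNReal.ofReal_mul (by positivity), ← ENNReal.ofReal_one,
            ← ENNReal.ofReal_add zero_le_one (mul_nonneg (by positivity) (hJ0 y))]
          refine ENNReal.ofReal_le_ofReal ((h3 y).trans (le_of_eq ?_))
          ring
      _ ≤ 1 + ENNReal.ofReal (1 / (2 * Real.pi)) * ENNReal.ofReal (4 * Real.pi * K) := by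
          rw [lintegral_add_left measurable_const, lintegral_const_mul' _ _ ENNReal.ofReal_ne_top]
          gcongr
          · simp
          · refine lintegral_integral_fluct_le h0 h hε
              (ψ := fun t => K * Real.exp (1 / (4 * varBound γ β * ε) * t ^ 2))
              (a := 1 / (4 * varBound γ β * ε)) (by positivity) (le_of_eq ?_) hK0 (by fun_prop)
              fun t => le_rfl
            field_simp
      _ = _ := by
          rw [← ENNReal.ofReal_mul (by positivity), ← ENNReal.ofReal_one,
            ← ENNReal.ofReal_add zero_le_one (by positivity)]
          congr 1; field_simp; ring
  have hm : Measurable fun y => Real.exp (R y) := (Real.continuous_exp.comp hRc).measurable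
  calc _ ≤ ∫⁻ y : NonzeroModes N → ℝ, ENNReal.ofReal E0 *
        (ENNReal.ofReal (Real.exp (-∑ n, modeRate γ β ε n * y n ^ 2 / 2)) *
        ENNReal.ofReal (Real.exp (R y))) := lintegral_mono h1
    _ = ENNReal.ofReal E0 * (ENNReal.ofReal (gaussConst γ β ε N) *
        ∫⁻ y, ENNReal.ofReal (Real.exp (R y)) ∂gaussPi (modeRate (N := N) γ β ε)) := by
        rw [lintegral_const_mul' _ _ ENNReal.ofReal_ne_top,
          lintegral_exp_mul_eq_gaussPi (modeRate_pos h hε) hm.ennreal_ofReal]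
        rfl
    _ ≤ ENNReal.ofReal E0 * (ENNReal.ofReal (gaussConst γ β ε N) *
        ENNReal.ofReal (1 + 2 * K)) := by gcongr
    _ = _ := by
        rw [← ENNReal.ofReal_mul gaussConst_nonneg, ← ENNReal.ofReal_mul (Real.exp_pos _).le]
        congr 1
        rw [hK, saddleError]; ring

end Saddle

/-! ### Test functions of the mean and the resulting capacity bound -/

section TestFunction

variable {N : ℕ} {γ β ε : ℝ}

/-- Coercivity: n² ≥ 1 controls the oscillation and the confining square controls the mean. It makes
the Gibbs measure finite, so that bounded functions belong to L². -/
theorem half_norm_sq_sub_le_energy (hγ : 0 < γ) (hβ : 0 < β) (k : ℕ) (u : State N) :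
    ‖u‖ ^ 2 / 2 - (2 * Real.pi * γ / β + (k * (2 * Real.pi / β)) ^ 2) ≤ energy γ β k u := by
  obtain ⟨⟨a, y⟩, rfl⟩ := (glue N).surjective u
  have h1 : ∫ x in (0 : ℝ)..(2 * Real.pi), Real.cos (β * (a + fluct y x)) ≤ 2 * Real.pi := by
    have hc := continuous_fluct_right y
    have := intervalIntegral.integral_mono_on (a := 0) (b := 2 * Real.pi) (μ := volume)
      (by positivity) ((by fun_prop : Continuous _).intervalIntegrable _ _)
      (_root_.intervalIntegrable_const (c := (1 : ℝ)))
      fun x _ => Real.cos_le_one (β * (a + fluct y x))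
    simpa using this
  have h2 := mul_le_mul_of_nonneg_left h1 (div_pos hγ hβ).le
  have h3 : ‖glue N (a, y)‖ ^ 2 = a ^ 2 + ∑ n, y n ^ 2 := by
    rw [EuclideanSpace.norm_sq_eq, sum_modes]
    simp_rw [glue_apply_nonzero, Real.norm_eq_abs, sq_abs]
    simp [glue_apply, zeroMode]
  have h4 : (∑ n, y n ^ 2) / 2 ≤ ∑ n : NonzeroModes N, (n : ℝ) ^ 2 * y n ^ 2 / 2 := by
    rw [Finset.sum_div]
    refine Finset.sum_le_sum fun n _ => ?_
    nlinarith [one_le_sq_nonzeroModes n, sq_nonneg (y n)]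
  have h5 : a ^ 2 / 2 - (k * (2 * Real.pi / β)) ^ 2 ≤
      (max 0 (|a| - k * (2 * Real.pi / β))) ^ 2 := by
    set K := k * (2 * Real.pi / β) with hK
    have hK0 : 0 ≤ K := by positivity
    set m := max 0 (|a| - K) with hm
    have h6 : |a| ≤ K + m := by linarith [le_max_right 0 (|a| - K)]
    have h7 : |a| ^ 2 ≤ (K + m) ^ 2 := by gcongr
    rw [sq_abs] at h7
    nlinarith [sq_nonneg (K - m)]
  rw [energy_glue, h3]
  have h6 : γ / β * (2 * Real.pi) = 2 * Real.pi * γ / β := by ring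
  linarith

theorem isFiniteMeasure_gibbs_energy (hγ : 0 < γ) (hβ : 0 < β) (hε : 0 < ε) (k : ℕ) :
    IsFiniteMeasure (gibbs (energy γ β k (N := N)) ε) := by
  refine isFiniteMeasure_withDensity_ofReal ?_
  set c := 2 * Real.pi * γ / β + (k * (2 * Real.pi / β)) ^ 2
  have h1 := (GaussianFourier.integrable_cexp_neg_mul_sq_norm_add (V := State N)
    (b := ((1 / (2 * ε) : ℝ) : ℂ)) (by rw [Complex.ofReal_re]; positivity) 0 0).norm
  have h2 : Integrable fun u : State N => Real.exp (c / ε) * Real.exp (-(1 / (2 * ε)) * ‖u‖ ^ 2) := by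
    refine Integrable.const_mul ?_ _
    refine h1.congr (Filter.Eventually.of_forall fun u => ?_)
    simp only [Complex.norm_exp]
    congr 1
    simp [← Complex.ofReal_pow]
  refine (h2.mono' (((continuous_energy γ β k).neg.div_const ε).rexp.aestronglyMeasurable)
    (Filter.Eventually.of_forall fun u => ?_)).2
  rw [Real.norm_eq_abs, abs_of_pos (Real.exp_pos _), ← Real.exp_add]
  refine Real.exp_le_exp.2 ?_
  have := half_norm_sq_sub_le_energy hγ hβ k u
  rw [div_le_iff₀ hε, add_mul, div_mul_cancel₀ _ hε.ne']
  have h3 : -(1 / (2 * ε)) * ‖u‖ ^ 2 * ε = -(‖u‖ ^ 2 / 2) := by field_simp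
  rw [h3]
  change -energy γ β k u ≤ _
  linarith

/-- The mean as a linear functional. -/
def meanL (N : ℕ) : State N →L[ℝ] ℝ :=
  (ContinuousLinearMap.fst ℝ ℝ (NonzeroModes N → ℝ)).comp (glue N).symm.toContinuousLinearMap

theorem meanL_apply (u : State N) : meanL N u = mean u := rfl

theorem isWeakGradient_comp_mean {h h' : ℝ → ℝ} (hd : ∀ a, HasDerivAt h (h' a) a)
    (hc : Continuous h') :
    IsWeakGradient (fun u : State N => h (mean u))
      (fun u => h' (mean u) • EuclideanSpace.single (zeroMode N) (1 : ℝ)) := by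
  have hm := continuous_mean (N := N)
  have hh : Continuous h := continuous_iff_continuousAt.2 fun a => (hd a).continuousAt
  have hg : Continuous fun u : State N => h (mean u) := hh.comp hm
  have hg' : Continuous fun u : State N => h' (mean u) := hc.comp hm
  refine ⟨hg.locallyIntegrable, (hg'.smul continuous_const).locallyIntegrable,
    fun ψ hψ hψc v => ?_⟩
  have hfd (u : State N) : HasFDerivAt (fun u : State N => h (mean u)) (h' (mean u) • meanL N) u :=
    (hd (mean u)).comp_hasFDerivAt u (meanL N).hasFDerivAt
  have e (u : State N) : inner ℝ (h' (mean u) • EuclideanSpace.single (zeroMode N) (1 : ℝ)) v =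
      fderiv ℝ (fun u : State N => h (mean u)) u v := by
    rw [(hfd u).fderiv, real_inner_smul_left, EuclideanSpace.inner_single_left]
    simp [meanL_apply, mean, zeroMode]
  have hψ' : Continuous fun u => fderiv ℝ ψ u v :=
    (hψ.continuous_fderiv (by simp)).clm_apply continuous_const
  have hg'' : Continuous fun u => fderiv ℝ (fun u : State N => h (mean u)) u v := by
    simp_rw [← e]
    fun_prop
  simp_rw [e]
  rw [integral_mul_fderiv_eq_neg_fderiv_mul_of_integrable]
  · simp_rw [mul_comm]
  · exact (hg''.mul hψ.continuous).integrable_of_hasCompactSupport hψc.mul_left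
  · refine (hg.mul hψ').integrable_of_hasCompactSupport (HasCompactSupport.mul_left ?_)
    exact hψc.fderiv_apply (𝕜 := ℝ) v
  · exact (hg.mul hψ.continuous).integrable_of_hasCompactSupport hψc.mul_left
  · exact fun u _ => (hfd u).differentiableAt
  · exact fun u _ => hψ.differentiable (by simp) u

theorem lintegral_state' {f : State N → ENNReal} (hf : AEMeasurable f) :
    ∫⁻ u, f u = ∫⁻ a, ∫⁻ y, f (glue N (a, y)) := by
  rw [← (measurePreserving_glue N).lintegral_comp_emb (measurableEmbedding_glue N),
    Measure.volume_eq_prod, lintegral_prod]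
  exact hf.comp_quasiMeasurePreserving (measurePreserving_glue N).quasiMeasurePreserving

/-- The capacity is bounded by the Dirichlet form of a function of `|mean|`. -/
theorem capacity_le_of_profile (hγ : 0 < γ) (hβ : 0 < β) (hε : 0 < ε) (k : ℕ) {X Y : Set (State N)}
    {p : ℝ → ℝ} {l r : ℝ} (hl : 0 ≤ l) (hpc : Continuous p) (hp0 : ∀ a, 0 ≤ p a)
    (hpl : ∀ a, a ≤ l → p a = 0) (hpr : ∀ a, r ≤ a → p a = 0) (hpi : ∫ a, p a = 1)
    (hX : ∀ u ∈ X, r ≤ |mean u|) (hY : ∀ u ∈ Y, |mean u| ≤ l) :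
    capacity (energy γ β k) ε X Y ≤ ENNReal.ofReal ε * ∫⁻ a, ENNReal.ofReal (p a ^ 2) *
      ((∫⁻ y : NonzeroModes N → ℝ,
          ENNReal.ofReal (Real.exp (-energy γ β k (glue N (a, y)) / ε))) +
        ∫⁻ y : NonzeroModes N → ℝ,
          ENNReal.ofReal (Real.exp (-energy γ β k (glue N (-a, y)) / ε))) := by
  -- Otherwise the integral would be 0 by convention, not 1.
  have hint : Integrable p := by
    by_contra h
    rw [integral_undef h] at hpi
    norm_num at hpi
  set H : ℝ → ℝ := fun a => ∫ t in (0 : ℝ)..a, p t with hH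
  have hHd (a : ℝ) : HasDerivAt H (p a) a :=
    intervalIntegral.integral_hasDerivAt_right (hpc.intervalIntegrable _ _)
      (hpc.stronglyMeasurableAtFilter _ _) hpc.continuousAt
  have hHl (a : ℝ) (ha : a ≤ l) : H a = 0 := by
    have : Set.EqOn p (fun _ => 0) (Set.uIcc 0 a) := fun t ht => hpl t <| by
      rcases Set.mem_uIcc.1 ht with h | h <;> linarith [h.1, h.2]
    simp only [hH]
    rw [intervalIntegral.integral_congr this]
    simp
  have hH0 (a : ℝ) : 0 ≤ H a := by
    rcases le_total a l with h | h
    · exact (hHl a h).ge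
    · exact intervalIntegral.integral_nonneg (hl.trans h) fun t _ => hp0 t
  have hH1 (a : ℝ) : H a ≤ 1 := by
    rcases le_total a l with h | h
    · rw [hHl a h]; exact zero_le_one
    · simp only [hH]
      rw [intervalIntegral.integral_of_le (hl.trans h), ← hpi]
      exact setIntegral_le_integral hint (Filter.Eventually.of_forall hp0)
  have hHr (a : ℝ) (ha : r ≤ a) (ha0 : 0 ≤ a) : H a = 1 := by
    simp only [hH]
    rw [intervalIntegral.integral_of_le ha0, ← hpi]
    refine setIntegral_eq_integral_of_forall_compl_eq_zero fun t ht => ?_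
    by_cases h0 : 0 < t
    · exact hpr t (ha.trans (not_le.1 fun h => ht ⟨h0, h⟩).le)
    · exact hpl t (by linarith)
  -- Since l ≥ 0, at each point at least one of the two terms vanishes, so the sum is a smooth
  -- substitute for H(|a|).
  set h : ℝ → ℝ := fun a => H a + H (-a) with hh
  set h' : ℝ → ℝ := fun a => p a - p (-a) with hh'
  have hd (a : ℝ) : HasDerivAt h (h' a) a := by
    have := (hHd a).add ((hHd (-a)).comp a (hasDerivAt_neg a))
    refine this.congr_deriv ?_
    simp only [hh']; ring
  have hc' : Continuous h' := by fun_prop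
  have hhc : Continuous h := continuous_iff_continuousAt.2 fun a => (hd a).continuousAt
  set g : State N → ℝ := fun u => h (mean u) with hg
  set G : State N → State N := fun u => h' (mean u) • EuclideanSpace.single (zeroMode N) (1 : ℝ)
    with hG
  have hGc : Continuous G := (hc'.comp continuous_mean).smul continuous_const
  have hfin := isFiniteMeasure_gibbs_energy (N := N) hγ hβ hε k
  obtain ⟨B, hB⟩ : ∃ B, ∀ a, p a ≤ B := by
    obtain ⟨B, hB⟩ := (isCompact_Icc (a := l) (b := r)).bddAbove_image hpc.continuousOn
    refine ⟨max B 0, fun a => ?_⟩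
    by_cases ha : a ∈ Set.Icc l r
    · exact (hB ⟨a, ha, rfl⟩).trans (le_max_left _ _)
    · refine (le_of_eq ?_).trans (le_max_right _ _)
      rcases le_total a l with h | h
      · exact hpl a h
      · exact hpr a (not_le.1 fun h2 => ha ⟨h, h2⟩).le
  have hadm : IsAdmissible (energy γ β k) ε X Y g G := by
    refine ⟨?_, ?_, isWeakGradient_comp_mean hd hc', Filter.Eventually.of_forall fun u hu => ?_,
      Filter.Eventually.of_forall fun u hu => ?_⟩
    · refine MemLp.of_bound (hhc.comp continuous_mean).aestronglyMeasurable 2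
        (Filter.Eventually.of_forall fun u => ?_)
      rw [Real.norm_eq_abs, abs_le]
      constructor <;> linarith [hH0 (mean u), hH0 (-mean u), hH1 (mean u), hH1 (-mean u)]
    · refine MemLp.of_bound hGc.aestronglyMeasurable B (Filter.Eventually.of_forall fun u => ?_)
      simp only [hG]
      rw [norm_smul, PiLp.norm_single, norm_one, mul_one, Real.norm_eq_abs, abs_le]
      constructor <;> linarith [hB (mean u), hB (-mean u), hp0 (mean u), hp0 (-mean u)]
    · have h1 := hX u hu
      simp only [hg, hh]
      rcases le_total 0 (mean u) with h2 | h2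
      · rw [abs_of_nonneg h2] at h1
        rw [hHr _ h1 h2]; linarith [hH0 (-mean u)]
      · rw [abs_of_nonpos h2] at h1
        rw [hHr _ h1 (by linarith)]; linarith [hH0 (mean u)]
    · have h1 := abs_le.1 (hY u hu)
      simp only [hg, hh]
      rw [hHl _ h1.2, hHl _ (by linarith), add_zero]
  rw [capacity]
  refine le_trans (iInf_le_of_le g (iInf_le_of_le G (iInf_le_of_le hadm le_rfl))) ?_
  gcongr
  set w : State N → ENNReal := fun u => ENNReal.ofReal (Real.exp (-energy γ β k u / ε)) with hw
  have hwm : Measurable w :=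
    ((continuous_energy γ β k).neg.div_const ε).rexp.measurable.ennreal_ofReal
  have hGm : Measurable fun u => ‖G u‖ₑ ^ 2 := hGc.measurable.enorm.pow_const 2
  rw [gibbs, lintegral_withDensity_eq_lintegral_mul _ hwm hGm,
    lintegral_state' (hwm.mul hGm).aemeasurable]
  have hGe (a : ℝ) (y : NonzeroModes N → ℝ) : ‖G (glue N (a, y))‖ₑ ^ 2 =
      ENNReal.ofReal (h' a ^ 2) := by
    rw [← ofReal_norm, ← ENNReal.ofReal_pow (norm_nonneg _)]
    simp only [hG]
    rw [norm_smul, PiLp.norm_single, norm_one, mul_one, mean_glue, Real.norm_eq_abs,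
      sq_abs]
  set Z : ℝ → ENNReal := fun a => ∫⁻ y : NonzeroModes N → ℝ, w (glue N (a, y)) with hZ
  have hZm : Measurable Z :=
    (hwm.comp (glue N).continuous.measurable).lintegral_prod_right'
  have hpm : Measurable fun a => ENNReal.ofReal (p a ^ 2) := (hpc.pow 2).measurable.ennreal_ofReal
  have hpZ : Measurable fun a => ENNReal.ofReal (p a ^ 2) * Z a := hpm.mul hZm
  calc _ = ∫⁻ a, ENNReal.ofReal (h' a ^ 2) * Z a := by
        refine lintegral_congr fun a => ?_
        simp only [Pi.mul_apply, hGe, hZ]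
        rw [lintegral_mul_const' _ _ ENNReal.ofReal_ne_top, mul_comm]
    -- The cross term p(a) p(-a) in the square is nonnegative and enters with a minus sign.
    _ ≤ ∫⁻ a, (ENNReal.ofReal (p a ^ 2) * Z a + ENNReal.ofReal (p (-a) ^ 2) * Z a) := by
        refine lintegral_mono fun a => ?_
        rw [← add_mul, ← ENNReal.ofReal_add (by positivity) (by positivity)]
        gcongr
        simp only [hh']
        nlinarith [mul_nonneg (hp0 a) (hp0 (-a))]
    _ = (∫⁻ a, ENNReal.ofReal (p a ^ 2) * Z a) + ∫⁻ a, ENNReal.ofReal (p a ^ 2) * Z (-a) := by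
        rw [lintegral_add_left hpZ]
        congr 1
        have hneg : Measurable fun a => ENNReal.ofReal (p (-a) ^ 2) * Z a :=
          (hpm.comp measurable_neg).mul hZm
        rw [← (Measure.measurePreserving_neg volume).lintegral_comp hneg]
        simp
    _ = _ := by
        rw [← lintegral_add_left hpZ]
        simp_rw [← mul_add]
        rfl

end TestFunction

/-! ### One-dimensional Laplace estimates with explicit error -/

section Laplace

theorem sqrt_two_mul_pi_div_le {b : ℝ} (hb : 0 < b) :
    √(Real.pi / (b / 2)) ≤ 2 * √(Real.pi / b) := by
  rw [Real.sqrt_le_left (by positivity), mul_pow, Real.sq_sqrt (by positivity)]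
  rw [show Real.pi / (b / 2) = 2 * (Real.pi / b) by field_simp]
  nlinarith [show 0 < Real.pi / b by positivity]

/-- Half of the Gaussian exponent can be spent on absorbing polynomial factors; this widens the
Gaussian and costs a factor √2 ≤ 2. -/
theorem integrable_and_integral_le_of_le_gaussian {f : ℝ → ℝ} {b K : ℝ} (hb : 0 < b)
    (hf : Continuous f) (hf0 : ∀ s, 0 ≤ f s) (hK : 0 ≤ K)
    (hle : ∀ s, f s ≤ K * Real.exp (-(b / 2) * s ^ 2)) :
    Integrable f ∧ ∫ s, f s ≤ 2 * K * √(Real.pi / b) := by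
  have h1 := (integrable_exp_neg_mul_sq (half_pos hb)).const_mul K
  have h2 : Integrable f := h1.mono' hf.aestronglyMeasurable (Filter.Eventually.of_forall fun s => by
    rw [Real.norm_eq_abs, abs_of_nonneg (hf0 s)]; exact hle s)
  refine ⟨h2, (integral_mono h2 h1 hle).trans ?_⟩
  rw [integral_const_mul, integral_gaussian]
  nlinarith [mul_le_mul_of_nonneg_left (sqrt_two_mul_pi_div_le hb) hK]

theorem integrable_and_integral_sq_mul_gaussian_le {b : ℝ} (hb : 0 < b) :
    Integrable (fun s : ℝ => s ^ 2 * Real.exp (-b * s ^ 2)) ∧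
      ∫ s : ℝ, s ^ 2 * Real.exp (-b * s ^ 2) ≤ 2 * (2 / b) * √(Real.pi / b) := by
  refine integrable_and_integral_le_of_le_gaussian hb (by fun_prop) (fun s => by positivity)
    (by positivity) fun s => ?_
  have h1 : b / 2 * s ^ 2 ≤ Real.exp (b / 2 * s ^ 2) := by
    linarith [Real.add_one_le_exp (b / 2 * s ^ 2)]
  have h2 : Real.exp (-(b / 2) * s ^ 2) = Real.exp (b / 2 * s ^ 2) * Real.exp (-b * s ^ 2) := by
    rw [← Real.exp_add]; congr 1; ring
  rw [h2, ← mul_assoc]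
  gcongr
  calc s ^ 2 = 2 / b * (b / 2 * s ^ 2) := by field_simp
    _ ≤ _ := by gcongr

theorem integrable_and_integral_four_mul_gaussian_le {b : ℝ} (hb : 0 < b) :
    Integrable (fun s : ℝ => s ^ 4 * Real.exp (-b * s ^ 2)) ∧
      ∫ s : ℝ, s ^ 4 * Real.exp (-b * s ^ 2) ≤ 2 * (8 / b ^ 2) * √(Real.pi / b) := by
  refine integrable_and_integral_le_of_le_gaussian hb (by fun_prop) (fun s => by positivity)
    (by positivity) fun s => ?_
  have h1 : (b / 2 * s ^ 2) ^ 2 / 2 ≤ Real.exp (b / 2 * s ^ 2) := by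
    have h0 : 0 ≤ b / 2 * s ^ 2 := by positivity
    linarith [Real.quadratic_le_exp_of_nonneg h0]
  have h2 : Real.exp (-(b / 2) * s ^ 2) = Real.exp (b / 2 * s ^ 2) * Real.exp (-b * s ^ 2) := by
    rw [← Real.exp_add]; congr 1; ring
  rw [h2, ← mul_assoc]
  gcongr
  calc s ^ 4 = 8 / b ^ 2 * ((b / 2 * s ^ 2) ^ 2 / 2) := by field_simp; norm_num
    _ ≤ _ := by gcongr

theorem cos_le_one_sub_sq_add_four (z : ℝ) : Real.cos z ≤ 1 - z ^ 2 / 2 + z ^ 4 / 2 := by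
  rcases le_or_gt |z| 1 with h | h
  · have h1 := (abs_le.1 (Real.cos_bound h)).2
    have h4 : |z| ^ 4 = z ^ 4 := by rw [← abs_pow, abs_of_nonneg (by positivity)]
    nlinarith [sq_nonneg (z ^ 2)]
  · have h1 : 1 ≤ z ^ 2 := by rw [← sq_abs]; nlinarith
    nlinarith [Real.cos_le_one z]

/-- Writing t cos z = t - t z²/2 + w with 0 ≤ w ≤ t z⁴/2, the inequality e^w ≤ 1 + w e^w leaves the
exact Gaussian plus a correction with full exponent t (cos z - 1). That correction is a fourth
Gaussian moment, hence smaller by a factor 1/t. -/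
theorem integral_exp_cos_le {t : ℝ} (ht : 0 < t) :
    ∫ z in (-Real.pi)..Real.pi, Real.exp (t * Real.cos z) ≤
      Real.exp t * (√(2 * Real.pi / t) * (1 + Real.pi ^ 5 / t)) := by
  have hp := Real.pi_pos
  -- The rate comes from 1 - cos z ≥ 2 z²/π², valid on the whole interval |z| ≤ π.
  set b := 2 * t / Real.pi ^ 2 with hb
  have hb0 : 0 < b := by positivity
  obtain ⟨i4, l4⟩ := integrable_and_integral_four_mul_gaussian_le hb0
  have i0 : Integrable fun z : ℝ => Real.exp (-(t / 2) * z ^ 2) :=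
    integrable_exp_neg_mul_sq (half_pos ht)
  have h1 (z : ℝ) (hz : z ∈ Set.Icc (-Real.pi) Real.pi) : Real.exp (t * Real.cos z) ≤
      Real.exp t * (Real.exp (-(t / 2) * z ^ 2) + t / 2 * (z ^ 4 * Real.exp (-b * z ^ 2))) := by
    have e1 : Real.exp (t * Real.cos z) = Real.exp t * (Real.exp (-(t / 2) * z ^ 2) *
        Real.exp (t * (Real.cos z - 1 + z ^ 2 / 2))) := by
      rw [← Real.exp_add, ← Real.exp_add]; congr 1; ring
    have e2 : Real.exp (-(t / 2) * z ^ 2) * Real.exp (t * (Real.cos z - 1 + z ^ 2 / 2)) =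
        Real.exp (t * (Real.cos z - 1)) := by
      rw [← Real.exp_add]; congr 1; ring
    have e3 : Real.exp (t * (Real.cos z - 1)) ≤ Real.exp (-b * z ^ 2) := by
      refine Real.exp_le_exp.2 ?_
      have := Real.cos_le_one_sub_mul_cos_sq (abs_le.2 hz)
      calc t * (Real.cos z - 1) ≤ t * (-(2 / Real.pi ^ 2 * z ^ 2)) := by gcongr; linarith
        _ = _ := by rw [hb]; ring
    have e4 : Real.exp (-(t / 2) * z ^ 2) * Real.exp (t * (Real.cos z - 1 + z ^ 2 / 2)) ≤
        Real.exp (-(t / 2) * z ^ 2) +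
          t * (Real.cos z - 1 + z ^ 2 / 2) * Real.exp (t * (Real.cos z - 1)) := by
      rw [← e2]
      nlinarith [mul_le_mul_of_nonneg_left (exp_le_one_add_mul_exp
        (w := t * (Real.cos z - 1 + z ^ 2 / 2))) (Real.exp_pos (-(t / 2) * z ^ 2)).le]
    rw [e1]
    refine mul_le_mul_of_nonneg_left (e4.trans (add_le_add le_rfl ?_)) (Real.exp_pos _).le
    have e5 : 0 ≤ Real.cos z - 1 + z ^ 2 / 2 := by
      linarith [Real.one_sub_sq_div_two_le_cos (x := z)]
    calc t * (Real.cos z - 1 + z ^ 2 / 2) * Real.exp (t * (Real.cos z - 1))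
        ≤ t * (z ^ 4 / 2) * Real.exp (-b * z ^ 2) := by
          gcongr
          linarith [cos_le_one_sub_sq_add_four z]
      _ = _ := by ring
  have i1 : Integrable fun z : ℝ => Real.exp t *
      (Real.exp (-(t / 2) * z ^ 2) + t / 2 * (z ^ 4 * Real.exp (-b * z ^ 2))) :=
    (i0.add (i4.const_mul _)).const_mul _
  calc _ ≤ ∫ z in (-Real.pi)..Real.pi, Real.exp t *
        (Real.exp (-(t / 2) * z ^ 2) + t / 2 * (z ^ 4 * Real.exp (-b * z ^ 2))) :=
        intervalIntegral.integral_mono_on (by linarith)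
          ((by fun_prop : Continuous _).intervalIntegrable _ _)
          ((by fun_prop : Continuous _).intervalIntegrable _ _) h1
    _ ≤ ∫ z, Real.exp t *
        (Real.exp (-(t / 2) * z ^ 2) + t / 2 * (z ^ 4 * Real.exp (-b * z ^ 2))) := by
        rw [intervalIntegral.integral_of_le (by linarith)]
        exact setIntegral_le_integral i1 (Filter.Eventually.of_forall fun z => by positivity)
    _ ≤ _ := by
        rw [integral_const_mul, integral_add i0 (i4.const_mul _), integral_const_mul,
          integral_gaussian]
        gcongr
        have e1 : √(Real.pi / b) = √(2 * Real.pi / t) * (Real.pi / 2) := by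
          rw [← Real.sqrt_sq (by positivity : 0 ≤ Real.pi / 2), ← Real.sqrt_mul (by positivity)]
          congr 1
          rw [hb]; field_simp
        have e2 : Real.pi / (t / 2) = 2 * Real.pi / t := by field_simp
        rw [e1] at l4
        rw [e2, mul_add, mul_one]
        refine add_le_add le_rfl ?_
        calc _ ≤ t / 2 * (2 * (8 / b ^ 2) * (√(2 * Real.pi / t) * (Real.pi / 2))) := by gcongr
          _ = _ := by rw [hb]; field_simp; ring

end Laplace

/-! ### The upper bound for the capacity -/

section UpperBound

variable {N : ℕ} {γ β ε : ℝ}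

theorem gaussConst_eq (h : γ * β < 1) (hε : 0 < ε) : gaussConst γ β ε N =
    √(∏ n ∈ (Finset.Icc (-(N : ℤ)) N).filter (fun n => 0 < |n|),
        2 * Real.pi * ε / ((n : ℝ) ^ 2 - γ * β)) := by
  rw [prod_nonzeroModes fun n : ℤ => 2 * Real.pi * ε / ((n : ℝ) ^ 2 - γ * β), gaussConst,
    Real.sqrt_prod]
  · refine Finset.prod_congr rfl fun n _ => ?_
    congr 1
    rw [modeRate]; field_simp
  · intro n _
    have := one_le_sq_nonzeroModes n
    exact div_nonneg (by positivity) (by linarith)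

theorem capacityAsymptotics_eq (hγ : 0 < γ) (hβ : 0 < β) (h : γ * β < 1) (hε : 0 < ε) :
    capacityAsymptotics γ β ε N =
      2 * (√(ε * γ * β) * gaussConst γ β ε N) * Real.exp (-(2 * Real.pi * γ / β) / ε) := by
  rw [capacityAsymptotics, Real.sqrt_mul (by positivity), ← gaussConst_eq h hε]
  congr 2
  field_simp

theorem exists_mul_log_le {η : ℝ} (hη : 0 < η) :
    ∃ ε₀ : ℝ, 0 < ε₀ ∧ ∀ ε : ℝ, 0 < ε → ε < ε₀ → √ε * Real.log (1 / ε) ≤ η := by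
  have h := tendsto_log_mul_rpow_nhdsGT_zero (r := 1 / 2) (by norm_num)
  have h2 := (h.neg.eventually (gt_mem_nhds (show -(0 : ℝ) < η by simpa using hη)))
  obtain ⟨ε₀, h0, h3⟩ := (mem_nhdsGT_iff_exists_Ioo_subset).1 h2
  refine ⟨ε₀, h0, fun ε h4 h5 => ?_⟩
  have h6 := h3 ⟨h4, h5⟩
  simp only [Set.mem_ofPred_eq] at h6
  rw [Real.sqrt_eq_rpow, one_div ε, Real.log_inv]
  linarith

/-- The optimal transition across an inverted parabola has a Gaussian derivative. The factor 1 -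
s²/s₀² gives it compact support and keeps it continuous; by the second moment, the lost mass is at
most the fraction 4/(b s₀²), here of order ε. -/
theorem exists_profile {b s₀ m : ℝ} (hb : 0 < b) (hs₀ : 0 < s₀) (hlt : 4 / b / s₀ ^ 2 < 1) :
    ∃ p : ℝ → ℝ, Continuous p ∧ (∀ a, 0 ≤ p a) ∧ (∀ a, s₀ ≤ |a - m| → p a = 0) ∧ ∫ a, p a = 1 ∧
      ∀ a, p a ≤ Real.exp (-b * (a - m) ^ 2) / (√(Real.pi / b) * (1 - 4 / b / s₀ ^ 2)) := by
  have hp := Real.pi_pos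
  have hW0 : 0 < √(Real.pi / b) := by positivity
  obtain ⟨i2, l2⟩ := integrable_and_integral_sq_mul_gaussian_le hb
  have i0 := integrable_exp_neg_mul_sq hb
  have v0 : ∫ s : ℝ, Real.exp (-b * s ^ 2) = √(Real.pi / b) := integral_gaussian b
  obtain ⟨φ, hφ⟩ : ∃ φ : ℝ → ℝ, φ = fun s => Real.exp (-b * s ^ 2) * max 0 (1 - s ^ 2 / s₀ ^ 2) :=
    ⟨_, rfl⟩
  have hφc : Continuous φ := by rw [hφ]; fun_prop
  have hφ0 (s : ℝ) : 0 ≤ φ s := by rw [hφ]; positivity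
  have hφ1 (s : ℝ) : φ s ≤ Real.exp (-b * s ^ 2) := by
    rw [hφ]
    refine mul_le_of_le_one_right (Real.exp_pos _).le (max_le zero_le_one ?_)
    linarith [show 0 ≤ s ^ 2 / s₀ ^ 2 by positivity]
  have hφs (s : ℝ) (hs : s₀ ≤ |s|) : φ s = 0 := by
    have : 1 ≤ s ^ 2 / s₀ ^ 2 := by
      rw [one_le_div (by positivity), ← sq_abs s]
      gcongr
    rw [hφ]
    simp only
    rw [max_eq_left (by linarith), mul_zero]
  have iφ : Integrable φ := i0.mono' hφc.aestronglyMeasurable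
    (Filter.Eventually.of_forall fun s => by
      rw [Real.norm_eq_abs, abs_of_nonneg (hφ0 s)]; exact hφ1 s)
  have hMge : √(Real.pi / b) * (1 - 4 / b / s₀ ^ 2) ≤ ∫ s, φ s := by
    have e1 : ∫ s : ℝ, (Real.exp (-b * s ^ 2) - 1 / s₀ ^ 2 * (s ^ 2 * Real.exp (-b * s ^ 2))) ≤
        ∫ s, φ s := by
      refine integral_mono (i0.sub (i2.const_mul _)) iφ fun s => ?_
      rw [hφ]
      have := mul_le_mul_of_nonneg_left (le_max_right 0 (1 - s ^ 2 / s₀ ^ 2))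
        (Real.exp_pos (-b * s ^ 2)).le
      refine le_trans (le_of_eq ?_) this
      ring
    rw [integral_sub i0 (i2.const_mul _), integral_const_mul, v0] at e1
    have e2 : √(Real.pi / b) * (4 / b / s₀ ^ 2) = 1 / s₀ ^ 2 * (2 * (2 / b) * √(Real.pi / b)) := by
      ring
    have e3 := mul_le_mul_of_nonneg_left l2 (by positivity : 0 ≤ 1 / s₀ ^ 2)
    linarith
  have hQ : 0 < √(Real.pi / b) * (1 - 4 / b / s₀ ^ 2) := mul_pos hW0 (by linarith)
  refine ⟨fun a => φ (a - m) / ∫ s, φ s, by fun_prop, fun a => div_nonneg (hφ0 _) (hQ.trans_le hMge).le,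
    fun a ha => by simp only [hφs _ ha, zero_div], ?_, fun a => ?_⟩
  · rw [integral_div, integral_sub_right_eq_self φ, div_self (hQ.trans_le hMge).ne']
  · exact div_le_div₀ (Real.exp_pos _).le (hφ1 _) hQ hMge

/-- The squared Gaussian profile meets the weight of the saddle, which grows at most like the
inverse Gaussian by cos z ≥ 1 - z²/2. One Gaussian remains. -/
theorem sq_profile_mul_le (hγ : 0 < γ) (hβ : 0 < β) (hε : 0 < ε) {q Q Gc D s : ℝ} (hq : 0 ≤ q)
    (hQ : 0 < Q) (hGc : 0 ≤ Gc) (hD : 0 ≤ D)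
    (hle : q ≤ Real.exp (-(Real.pi * γ * β / ε) * s ^ 2) / Q) :
    q ^ 2 * (Real.exp (-(2 * Real.pi * γ / β * Real.cos (β * s)) / ε) * Gc *
        (1 + D * (s ^ 2 + ε))) ≤
      Real.exp (-(2 * Real.pi * γ / β) / ε) * Gc / Q ^ 2 *
        (Real.exp (-(Real.pi * γ * β / ε) * s ^ 2) * (1 + D * ε) +
          D * (s ^ 2 * Real.exp (-(Real.pi * γ * β / ε) * s ^ 2))) := by
  set E0 := Real.exp (-(2 * Real.pi * γ / β) / ε) with hE0
  have hp := Real.pi_pos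
  have e1 : Real.exp (-(2 * Real.pi * γ / β * Real.cos (β * s)) / ε) ≤
      E0 * Real.exp (Real.pi * γ * β / ε * s ^ 2) := by
    rw [hE0, ← Real.exp_add]
    refine Real.exp_le_exp.2 ?_
    have e2 := Real.one_sub_sq_div_two_le_cos (x := β * s)
    have e3 : 2 * Real.pi * γ / β * (1 - (β * s) ^ 2 / 2) ≤
      2 * Real.pi * γ / β * Real.cos (β * s) := by gcongr
    have e4 : -(2 * Real.pi * γ / β) / ε + Real.pi * γ * β / ε * s ^ 2 =
        -(2 * Real.pi * γ / β * (1 - (β * s) ^ 2 / 2)) / ε := by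
      field_simp; ring
    rw [e4]
    gcongr
  have e6 : Real.exp (-(Real.pi * γ * β / ε) * s ^ 2) * Real.exp (Real.pi * γ * β / ε * s ^ 2) = 1 := by
    rw [← Real.exp_add, ← Real.exp_zero]; congr 1; ring
  set u := Real.exp (-(Real.pi * γ * β / ε) * s ^ 2)
  set v := Real.exp (Real.pi * γ * β / ε * s ^ 2)
  calc _ ≤ (u / Q) ^ 2 * ((E0 * v) * Gc * (1 + D * (s ^ 2 + ε))) := by gcongr
    _ = (u * v) * (E0 * Gc / Q ^ 2 * (u * (1 + D * (s ^ 2 + ε)))) := by ring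
    _ = _ := by rw [e6]; ring

theorem one_add_le_one_add_mul_sq {x y : ℝ} (hx : 0 ≤ x) (hy : 0 ≤ y) (hy' : y ≤ 1 / 4) :
    1 + x ≤ (1 + (x + 4 * y + 4 * (x * y))) * (1 - y) ^ 2 := by
  have f1 : 1 ≤ (1 + 4 * y) * (1 - y) ^ 2 := by
    nlinarith [mul_nonneg hy hy, mul_nonneg hy (mul_nonneg hy hy)]
  calc 1 + x = (1 + x) * 1 := (mul_one _).symm
    _ ≤ (1 + x) * ((1 + 4 * y) * (1 - y) ^ 2) := by gcongr
    _ = _ := by ring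

/-- The two sets enter only through |û(0)|: for small ε they lie on opposite sides of the window of
width s₀ around π/β. This is why the constants do not depend on k, the partition of unity or c₀. -/
theorem capacity_upper (hγ : 0 < γ) (hβ : 0 < β) (h : γ * β < 1) :
    ∃ ε₀ C : ℝ, 0 < ε₀ ∧ 0 < C ∧ ∀ ε : ℝ, 0 < ε → ε < ε₀ → ∀ (N k : ℕ) (P : DyadicPartition)
      (κ c₀ : ℝ), capacity (energy γ β k (N := N)) ε (setA β ε N) (setB P κ c₀ ε N)
          ≤ ENNReal.ofReal (capacityAsymptotics γ β ε N * (1 + C * ε)) := by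
  have hp := Real.pi_pos
  obtain ⟨ε₁, h1, hε₁⟩ := exists_mul_log_le (show 0 < Real.pi / (2 * β) by positivity)
  -- The saddle estimate requires 2|s| ≤ `window γ β`, and π/(2β) keeps the support of the profile
  -- in the positive half-line and away from both sets.
  obtain ⟨s₀, hs₀0, hs1, hs2⟩ : ∃ s₀ : ℝ, 0 < s₀ ∧ s₀ ≤ window γ β / 2 ∧ s₀ ≤ Real.pi / (2 * β) :=
    ⟨min (window γ β / 2) (Real.pi / (2 * β)),
      lt_min (half_pos (window_pos hγ hβ h)) (by positivity), min_le_left _ _, min_le_right _ _⟩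
  have hD0 : 0 < saddleError γ β := saddleError_pos hγ hβ h
  obtain ⟨D, hD⟩ : ∃ D, D = saddleError γ β := ⟨_, rfl⟩
  rw [← hD] at hD0
  obtain ⟨C1, hC1⟩ : ∃ C1, C1 = D * (4 / (Real.pi * γ * β) + 1) := ⟨_, rfl⟩
  obtain ⟨C2, hC2⟩ : ∃ C2, C2 = 4 / (Real.pi * γ * β) / s₀ ^ 2 := ⟨_, rfl⟩
  have hC10 : 0 < C1 := by rw [hC1]; positivity
  have hC20 : 0 < C2 := by rw [hC2]; positivity
  refine ⟨min ε₁ (min 1 (1 / (4 * C2))), C1 + 4 * C2 + 4 * (C1 * C2), by positivity, by positivity,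
    fun ε hε hlt N k P κ c₀ => ?_⟩
  have hlt1 : ε < ε₁ := hlt.trans_le (min_le_left _ _)
  have hlt2 : ε < 1 := hlt.trans_le ((min_le_right _ _).trans (min_le_left _ _))
  have hlt3 : C2 * ε ≤ 1 / 4 := by
    have := (hlt.trans_le ((min_le_right _ _).trans (min_le_right _ _))).le
    rw [le_div_iff₀ (by positivity)] at this
    linarith
  have hδ := hε₁ ε hε hlt1
  -- With this b the Gaussian e^{-b s²} is inverse to the quadratic growth of the weight at the
  -- saddle.
  obtain ⟨b, hb⟩ : ∃ b, b = Real.pi * γ * β / ε := ⟨_, rfl⟩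
  have hb0 : 0 < b := by rw [hb]; positivity
  have hbC : 4 / b / s₀ ^ 2 = C2 * ε := by rw [hb, hC2]; field_simp
  obtain ⟨p, hpc, hp0, hps, hpi, hpe⟩ := exists_profile (m := Real.pi / β) hb0 hs₀0
    (by rw [hbC]; linarith)
  rw [hbC] at hpe
  obtain ⟨W, hW⟩ : ∃ W, W = √(Real.pi / b) := ⟨_, rfl⟩
  have hW0 : 0 < W := by rw [hW]; positivity
  obtain ⟨Q, hQ⟩ : ∃ Q, Q = W * (1 - C2 * ε) := ⟨_, rfl⟩
  have hQ0 : 0 < Q := by rw [hQ]; exact mul_pos hW0 (by linarith)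
  rw [← hW, ← hQ] at hpe
  have hhalf : Real.pi / (2 * β) = Real.pi / β / 2 := by field_simp
  have hcap := capacity_le_of_profile (N := N) hγ hβ hε k (X := setA β ε N) (Y := setB P κ c₀ ε N)
    (p := p) (l := Real.pi / β - s₀) (r := Real.pi / β + s₀)
    (by rw [hhalf] at hs2; linarith [show 0 < Real.pi / β by positivity])
    hpc hp0
    (fun a ha => hps a <| by
      rw [abs_sub_comm]; exact (by linarith : s₀ ≤ Real.pi / β - a).trans (le_abs_self _))
    (fun a ha => hps a <| (by linarith : s₀ ≤ a - Real.pi / β).trans (le_abs_self _))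
    hpi
    (fun u hu => by
      have hu' : 2 * Real.pi / β - √ε * Real.log (1 / ε) < |mean u| := hu
      have : 2 * Real.pi / β = 2 * (Real.pi / β) := by ring
      linarith)
    (fun u hu => by
      have hu' : |mean u| < √ε * Real.log (1 / ε) := hu.1
      linarith)
  refine hcap.trans ?_
  obtain ⟨Gc, hGc⟩ : ∃ Gc, Gc = gaussConst γ β ε N := ⟨_, rfl⟩
  have hGc0 : 0 ≤ Gc := by rw [hGc]; exact gaussConst_nonneg
  obtain ⟨E0, hE0⟩ : ∃ E0, E0 = Real.exp (-(2 * Real.pi * γ / β) / ε) := ⟨_, rfl⟩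
  have hE00 : 0 < E0 := by rw [hE0]; exact Real.exp_pos _
  obtain ⟨i2, l2⟩ := integrable_and_integral_sq_mul_gaussian_le hb0
  have i0 := integrable_exp_neg_mul_sq hb0
  have v0 : ∫ s : ℝ, Real.exp (-b * s ^ 2) = W := by rw [hW]; exact integral_gaussian b
  obtain ⟨f, hf⟩ : ∃ f : ℝ → ℝ, f = fun s => 2 * (E0 * Gc / Q ^ 2 *
    (Real.exp (-b * s ^ 2) * (1 + D * ε) + D * (s ^ 2 * Real.exp (-b * s ^ 2)))) := ⟨_, rfl⟩
  have hf0 (s : ℝ) : 0 ≤ f s := by rw [hf]; positivity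
  have ifi : Integrable f := by
    rw [hf]; exact (((i0.mul_const _).add (i2.const_mul _)).const_mul _).const_mul _
  have hpt (a : ℝ) : ENNReal.ofReal (p a ^ 2) *
      ((∫⁻ y : NonzeroModes N → ℝ,
          ENNReal.ofReal (Real.exp (-energy γ β k (glue N (a, y)) / ε))) +
        ∫⁻ y : NonzeroModes N → ℝ,
          ENNReal.ofReal (Real.exp (-energy γ β k (glue N (-a, y)) / ε))) ≤
      ENNReal.ofReal (f (a - Real.pi / β)) := by
    rcases le_or_gt s₀ |a - Real.pi / β| with h2 | h2
    · rw [hps _ h2]; simp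
    · have h3 : 2 * |a - Real.pi / β| ≤ window γ β := by linarith
      have z1 := lintegral_exp_neg_energy_le (N := N) hγ hβ h hε k (σ := 1) (Or.inl rfl) h3
      have z2 := lintegral_exp_neg_energy_le (N := N) hγ hβ h hε k (σ := -1) (Or.inr rfl) h3
      have e := hpe a
      rw [show 1 * (Real.pi / β + (a - Real.pi / β)) = a by ring] at z1
      rw [show -1 * (Real.pi / β + (a - Real.pi / β)) = -a by ring] at z2
      rw [← hGc, ← hD] at z1 z2
      generalize a - Real.pi / β = s at *
      refine (mul_le_mul_right (add_le_add z1 z2) _).trans ?_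
      rw [← two_mul, ← ENNReal.ofReal_ofNat, ← ENNReal.ofReal_mul (by norm_num),
        ← ENNReal.ofReal_mul (sq_nonneg _)]
      refine ENNReal.ofReal_le_ofReal ?_
      rw [hb] at e
      have := sq_profile_mul_le hγ hβ hε (hp0 a) hQ0 hGc0 hD0.le e
      rw [← hE0, ← hb] at this
      rw [hf]
      linarith
  have e1 : ∫ s, f s ≤ 2 * (E0 * Gc / Q ^ 2 * (W * (1 + C1 * ε))) := by
    rw [hf]
    simp only
    rw [integral_const_mul, integral_const_mul, integral_add (i0.mul_const _) (i2.const_mul _),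
      integral_mul_const, integral_const_mul, v0]
    gcongr
    have e2 := mul_le_mul_of_nonneg_left l2 hD0.le
    have e3 : W * (1 + C1 * ε) = W * (1 + D * ε) + D * (2 * (2 / b) * W) := by
      rw [hC1, hb]; field_simp; ring
    rw [e3, hW]
    linarith
  have e2 : (1 + C1 * ε) ≤ (1 + (C1 + 4 * C2 + 4 * (C1 * C2)) * ε) * (1 - C2 * ε) ^ 2 := by
    refine (one_add_le_one_add_mul_sq (mul_nonneg hC10.le hε.le) (mul_nonneg hC20.le hε.le)
      hlt3).trans ?_
    gcongr
    have : C1 * C2 * (ε * ε) ≤ C1 * C2 * ε := by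
      refine mul_le_mul_of_nonneg_left ?_ (mul_nonneg hC10.le hC20.le)
      nlinarith
    nlinarith
  -- The mass of the profile is W = √(ε/(γβ)); after division by the square of this mass, the
  -- prefactor ε of the capacity becomes √(εγβ).
  have e3 : ε = √(ε * γ * β) * W := by
    rw [hW, hb, ← Real.sqrt_mul (by positivity),
      show ε * γ * β * (Real.pi / (Real.pi * γ * β / ε)) = ε ^ 2 by field_simp,
      Real.sqrt_sq hε.le]
  calc _ ≤ ENNReal.ofReal ε * ∫⁻ a, ENNReal.ofReal (f (a - Real.pi / β)) := by
        gcongr with a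
        exact hpt a
    _ = ENNReal.ofReal (ε * ∫ s, f s) := by
        rw [lintegral_sub_right_eq_self (fun s => ENNReal.ofReal (f s)),
          ← ofReal_integral_eq_lintegral_ofReal ifi (Filter.Eventually.of_forall hf0),
          ← ENNReal.ofReal_mul hε.le]
    _ ≤ _ := by
        refine ENNReal.ofReal_le_ofReal ?_
        rw [capacityAsymptotics_eq hγ hβ h hε, ← hE0, ← hGc]
        have hS0 : 0 ≤ √(ε * γ * β) := Real.sqrt_nonneg _
        generalize √(ε * γ * β) = S at *
        generalize (1 + (C1 + 4 * C2 + 4 * (C1 * C2)) * ε) = T at *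
        have e5 : 1 - C2 * ε ≠ 0 := by linarith
        calc ε * ∫ s, f s ≤ (S * W) * (2 * (E0 * Gc / Q ^ 2 * (W * (T * (1 - C2 * ε) ^ 2)))) := by
              rw [← e3]
              refine mul_le_mul_of_nonneg_left (e1.trans ?_) hε.le
              gcongr
          _ = _ := by rw [hQ]; field_simp

end UpperBound

/-! ### Resistance of the lines in the direction of the mean -/

section Lines

variable {N : ℕ} {γ β ε : ℝ}

/-- The rotation-invariant integral `∫_{-π}^{π} exp (t cos z) dz`. -/
def circleIntegralExp (t : ℝ) : ℝ := ∫ z in (-Real.pi)..Real.pi, Real.exp (t * Real.cos z)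

theorem circleIntegralExp_nonneg (t : ℝ) : 0 ≤ circleIntegralExp t :=
  intervalIntegral.integral_nonneg (by linarith [Real.pi_pos]) fun _ _ => (Real.exp_pos _).le

/-- In amplitude-phase form the phase is irrelevant, since the integral runs over a full period. -/
theorem integral_exp_cos_add_sin (A B : ℝ) :
    ∫ z in (0 : ℝ)..(2 * Real.pi), Real.exp (A * Real.cos z + B * Real.sin z) =
      circleIntegralExp √(A ^ 2 + B ^ 2) := by
  set w : ℂ := ⟨A, B⟩ with hw
  have hn : ‖w‖ = √(A ^ 2 + B ^ 2) := by
    rw [Complex.norm_def, Complex.normSq_apply]; congr 1; simp only [hw]; ring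
  have hA : A = ‖w‖ * Real.cos w.arg := (Complex.norm_mul_cos_arg w).symm
  have hB : B = ‖w‖ * Real.sin w.arg := (Complex.norm_mul_sin_arg w).symm
  have e (z : ℝ) : Real.exp (A * Real.cos z + B * Real.sin z) =
      Real.exp (‖w‖ * Real.cos (z - w.arg)) := by
    rw [Real.cos_sub]
    congr 1
    linear_combination Real.cos z * hA + Real.sin z * hB
  simp_rw [e]
  rw [intervalIntegral.integral_comp_sub_right fun z => Real.exp (‖w‖ * Real.cos z)]
  have hper : Function.Periodic (fun z => Real.exp (‖w‖ * Real.cos z)) (2 * Real.pi) := fun z => by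
    simp
  have := hper.intervalIntegral_add_eq (0 - w.arg) (-Real.pi)
  rw [show 0 - w.arg + 2 * Real.pi = 2 * Real.pi - w.arg by ring,
    show -Real.pi + 2 * Real.pi = Real.pi by ring] at this
  rw [this, hn, circleIntegralExp]

theorem sq_integral_le {f : ℝ → ℝ} (hf : Continuous f) :
    (∫ x in (0 : ℝ)..(2 * Real.pi), f x) ^ 2 ≤
      2 * Real.pi * ∫ x in (0 : ℝ)..(2 * Real.pi), f x ^ 2 := by
  have hp := Real.pi_pos
  set I := ∫ x in (0 : ℝ)..(2 * Real.pi), f x with hI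
  set m := I / (2 * Real.pi) with hm
  have h : 0 ≤ ∫ x in (0 : ℝ)..(2 * Real.pi), (f x - m) ^ 2 :=
    intervalIntegral.integral_nonneg (by positivity) fun _ _ => sq_nonneg _
  have e (x : ℝ) : (f x - m) ^ 2 = f x ^ 2 - 2 * m * f x + m ^ 2 := by ring
  simp_rw [e] at h
  rw [intervalIntegral.integral_add, intervalIntegral.integral_sub,
    intervalIntegral.integral_const_mul, intervalIntegral.integral_const, smul_eq_mul, ← hI,
    sub_zero] at h
  · have e2 : 2 * m * I - 2 * Real.pi * m ^ 2 = I ^ 2 / (2 * Real.pi) := by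
      rw [hm]; field_simp; ring
    have e3 : I ^ 2 / (2 * Real.pi) ≤ ∫ x in (0 : ℝ)..(2 * Real.pi), f x ^ 2 := by linarith
    rw [div_le_iff₀ (by positivity)] at e3
    linarith
  all_goals exact (by fun_prop : Continuous _).intervalIntegrable _ _

/-- The constant in the quadratic approximation of the effective barrier. -/
def barrierError (γ β : ℝ) : ℝ :=
  γ / β * (β ^ 4 + 4 * β ^ 6) + β ^ 2 + Real.pi ^ 4 * β / γ

theorem barrierError_pos (hγ : 0 < γ) (hβ : 0 < β) : 0 < barrierError γ β := by
  unfold barrierError; have := Real.pi_pos; positivity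

/-- Here q, F₄ and F₆ stand for the integrals of v², v⁴ and v⁶. The amplitude ρ = √(c² + s²) equals
2π - β²q/2 up to O(F₄ + F₆), so the exponential e^{γρ/(βε)} of the resistance cancels the two other
exponentials up to e^{O((F₄ + F₆)/ε)}. The Laplace prefactor adds relative errors O(q) and O(ε). -/
theorem circleIntegralExp_le_of_quadratic (hγ : 0 < γ) (hβ : 0 < β) (hε : 0 < ε)
    {q F₄ F₆ c s : ℝ} (hq : 0 ≤ q) (hF₄ : 0 ≤ F₄) (hF₆ : 0 ≤ F₆)
    (h1 : 2 * Real.pi - β ^ 2 * q / 2 ≤ c)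
    (h2 : c ≤ 2 * Real.pi - β ^ 2 * q / 2 + β ^ 4 / 2 * F₄)
    (h3 : s ^ 2 ≤ 2 * Real.pi * (4 * β ^ 6 * F₆)) :
    √(γ * β / ε) * Real.exp (-(2 * Real.pi * γ / β) / ε) * Real.exp (γ * β / (2 * ε) * q) *
      (1 - barrierError γ β * (ε + (q + (F₄ + F₆) / ε))) *
      (circleIntegralExp (γ / (β * ε) * √(c ^ 2 + s ^ 2)) / β) ≤ 1 := by
  have hp := Real.pi_pos
  have hp3 := Real.pi_gt_three
  have hI := circleIntegralExp_nonneg (γ / (β * ε) * √(c ^ 2 + s ^ 2))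
  -- If the claimed factor is not positive there is nothing to prove. Otherwise its positivity
  -- supplies the smallness β²q ≤ 1, and with it c ≥ π.
  rcases le_or_gt (1 - barrierError γ β * (ε + (q + (F₄ + F₆) / ε))) 0 with h0 | h0
  · refine le_trans (mul_nonpos_of_nonpos_of_nonneg (mul_nonpos_of_nonneg_of_nonpos
      (by positivity) h0) (by positivity)) zero_le_one
  have hC := barrierError_pos hγ hβ
  have hq1 : β ^ 2 * q ≤ 1 := by
    have e1 : β ^ 2 * q ≤ barrierError γ β * (ε + (q + (F₄ + F₆) / ε)) := by
      gcongr
      · unfold barrierError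
        have : 0 ≤ γ / β * (β ^ 4 + 4 * β ^ 6) + Real.pi ^ 4 * β / γ := by positivity
        linarith
      · have : 0 ≤ (F₄ + F₆) / ε := by positivity
        linarith
    linarith
  have hc : Real.pi ≤ c := by linarith
  set ρ := √(c ^ 2 + s ^ 2) with hρ
  have hρc : c ≤ ρ := Real.le_sqrt_of_sq_le (by linarith [sq_nonneg s])
  have hρ0 : 0 < ρ := by linarith
  -- The square of the right side exceeds c² by at least 2c · 4β⁶F₆, and c ≥ π makes this at least
  -- s².
  have hρle : ρ ≤ c + 4 * β ^ 6 * F₆ := by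
    refine Real.sqrt_le_iff.2 ⟨add_nonneg (by linarith) (by positivity), ?_⟩
    have : 0 ≤ 4 * β ^ 6 * F₆ := by positivity
    nlinarith [mul_le_mul_of_nonneg_right hc this]
  set t := γ / (β * ε) * ρ with ht
  have ht0 : 0 < t := by positivity
  have hJ : circleIntegralExp t ≤ Real.exp t * (√(2 * Real.pi / t) * (1 + Real.pi ^ 5 / t)) :=
    integral_exp_cos_le ht0
  set x := β ^ 2 * q / (4 * Real.pi) with hx
  have hx0 : 0 ≤ x := by positivity
  have hx1 : x ≤ 1 / 2 := by
    rw [hx, div_le_iff₀ (by positivity)]; linarith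
  have b1 : √(γ * β / ε) * √(2 * Real.pi / t) / β ≤ Real.exp x := by
    have e1 : √(γ * β / ε) * √(2 * Real.pi / t) / β = √(2 * Real.pi / ρ) := by
      rw [← Real.sqrt_mul (by positivity), show γ * β / ε * (2 * Real.pi / t) =
        2 * Real.pi / ρ * β ^ 2 by rw [ht]; field_simp, Real.sqrt_mul (by positivity),
        Real.sqrt_sq hβ.le, mul_div_cancel_right₀ _ hβ.ne']
    rw [e1, Real.sqrt_le_left (Real.exp_pos _).le, ← Real.exp_nat_mul]
    have e2 : 2 * Real.pi * (1 - x) ≤ ρ := by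
      have : 2 * Real.pi * (1 - x) = 2 * Real.pi - β ^ 2 * q / 2 := by
        rw [hx]; field_simp; ring
      linarith
    have e3 : 2 * Real.pi / ρ ≤ 1 + 2 * x := by
      rw [div_le_iff₀ hρ0]
      have : 2 * Real.pi ≤ (1 + 2 * x) * (2 * Real.pi * (1 - x)) := by
        nlinarith [mul_nonneg hx0 (by linarith : 0 ≤ 1 - 2 * x)]
      exact this.trans (by gcongr)
    push_cast
    linarith [Real.add_one_le_exp (2 * x)]
  have b2 : 1 + Real.pi ^ 5 / t ≤ Real.exp (Real.pi ^ 4 * β / γ * ε) := by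
    have e1 : Real.pi ^ 5 / t ≤ Real.pi ^ 4 * β / γ * ε := by
      rw [div_le_iff₀ ht0]
      calc Real.pi ^ 5 = Real.pi ^ 4 * β / γ * ε * (γ / (β * ε) * Real.pi) := by field_simp
        _ ≤ _ := by rw [ht]; gcongr; linarith
    linarith [Real.add_one_le_exp (Real.pi ^ 4 * β / γ * ε)]
  have b3 : Real.exp (-(2 * Real.pi * γ / β) / ε) * Real.exp (γ * β / (2 * ε) * q) * Real.exp t ≤
      Real.exp (γ / β * (β ^ 4 + 4 * β ^ 6) * ((F₄ + F₆) / ε)) := by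
    rw [← Real.exp_add, ← Real.exp_add]
    refine Real.exp_le_exp.2 ?_
    calc _ = γ / (β * ε) * (ρ - (2 * Real.pi - β ^ 2 * q / 2)) := by rw [ht]; field_simp; ring
      _ ≤ γ / (β * ε) * ((β ^ 4 + 4 * β ^ 6) * (F₄ + F₆)) := by
          gcongr
          nlinarith [mul_nonneg (pow_pos hβ 4).le hF₆, mul_nonneg (pow_pos hβ 6).le hF₄,
            mul_nonneg (pow_pos hβ 4).le hF₄]
      _ = _ := by field_simp
  have b4 : 1 - barrierError γ β * (ε + (q + (F₄ + F₆) / ε)) ≤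
      Real.exp (-(barrierError γ β * (ε + (q + (F₄ + F₆) / ε)))) := by
    linarith [Real.add_one_le_exp (-(barrierError γ β * (ε + (q + (F₄ + F₆) / ε))))]
  calc _ ≤ √(γ * β / ε) * Real.exp (-(2 * Real.pi * γ / β) / ε) * Real.exp (γ * β / (2 * ε) * q) *
        Real.exp (-(barrierError γ β * (ε + (q + (F₄ + F₆) / ε)))) *
        (Real.exp t * (√(2 * Real.pi / t) * (1 + Real.pi ^ 5 / t)) / β) := by
        gcongr
    _ = (Real.exp (-(2 * Real.pi * γ / β) / ε) * Real.exp (γ * β / (2 * ε) * q) * Real.exp t) *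
        (√(γ * β / ε) * √(2 * Real.pi / t) / β) * (1 + Real.pi ^ 5 / t) *
        Real.exp (-(barrierError γ β * (ε + (q + (F₄ + F₆) / ε)))) := by ring
    _ ≤ Real.exp (γ / β * (β ^ 4 + 4 * β ^ 6) * ((F₄ + F₆) / ε)) * Real.exp x *
        Real.exp (Real.pi ^ 4 * β / γ * ε) *
        Real.exp (-(barrierError γ β * (ε + (q + (F₄ + F₆) / ε)))) := by gcongr
    _ ≤ 1 := by
        rw [← Real.exp_add, ← Real.exp_add, ← Real.exp_add, Real.exp_le_one_iff]
        have hxq : x ≤ β ^ 2 * q := by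
          rw [hx]; exact div_le_self (by positivity) (by linarith)
        have c1 : 0 ≤ γ / β * (β ^ 4 + 4 * β ^ 6) := by positivity
        have c2 : 0 ≤ Real.pi ^ 4 * β / γ := by positivity
        have hF : 0 ≤ (F₄ + F₆) / ε := by positivity
        unfold barrierError
        generalize γ / β * (β ^ 4 + 4 * β ^ 6) = u at *
        generalize Real.pi ^ 4 * β / γ = v at *
        generalize (F₄ + F₆) / ε = F at *
        nlinarith [mul_nonneg c1 hε.le, mul_nonneg c1 hq, mul_nonneg c2 hq, mul_nonneg c2 hF,
          mul_nonneg (sq_nonneg β) hε.le, mul_nonneg (sq_nonneg β) hF]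

/-- The local error density in the lower bound. -/
def errorDensity (ε t : ℝ) : ℝ := t ^ 2 + (t ^ 4 + t ^ 6) / ε

/-- The relative error of the lower bound at a given oscillation. -/
def lineError (ε : ℝ) (y : NonzeroModes N → ℝ) : ℝ :=
  ∫ x in (0 : ℝ)..(2 * Real.pi), errorDensity ε (fluct y x)

theorem integral_cos_add_fluct (β a : ℝ) (y : NonzeroModes N → ℝ) :
    ∫ x in (0 : ℝ)..(2 * Real.pi), Real.cos (β * (a + fluct y x)) =
      Real.cos (β * a) * (∫ x in (0 : ℝ)..(2 * Real.pi), Real.cos (β * fluct y x)) -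
      Real.sin (β * a) * ∫ x in (0 : ℝ)..(2 * Real.pi), Real.sin (β * fluct y x) := by
  have hc := continuous_fluct_right y
  simp_rw [mul_add, Real.cos_add]
  rw [intervalIntegral.integral_sub, intervalIntegral.integral_const_mul,
    intervalIntegral.integral_const_mul]
  all_goals exact (by fun_prop : Continuous _).intervalIntegrable _ _

/-- After the addition theorem the exponent is linear in cos βa and sin βa. The segment between
neighbouring wells is exactly one period, so only the amplitude of (c, s) matters and the integral
is exact. -/
theorem integral_exp_energy_line (hγ : 0 < γ) (hβ : 0 < β) (hε : 0 < ε) {k : ℕ} (hk : 1 ≤ k) {σ : ℝ}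
    (hσ : σ = 1 ∨ σ = -1) (y : NonzeroModes N → ℝ) :
    ∫ a in (0 : ℝ)..(2 * Real.pi / β), Real.exp (energy γ β k (glue N (σ * a, y)) / ε) =
      Real.exp ((∑ n : NonzeroModes N, (n : ℝ) ^ 2 * y n ^ 2 / 2) / ε) *
        (circleIntegralExp (γ / (β * ε) *
          √((∫ x in (0 : ℝ)..(2 * Real.pi), Real.cos (β * fluct y x)) ^ 2 +
            (∫ x in (0 : ℝ)..(2 * Real.pi), Real.sin (β * fluct y x)) ^ 2)) / β) := by
  have hp := Real.pi_pos
  set S := ∑ n : NonzeroModes N, (n : ℝ) ^ 2 * y n ^ 2 / 2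
  set c := ∫ x in (0 : ℝ)..(2 * Real.pi), Real.cos (β * fluct y x)
  set s := ∫ x in (0 : ℝ)..(2 * Real.pi), Real.sin (β * fluct y x)
  have h1 (a : ℝ) (ha : a ∈ Set.uIcc 0 (2 * Real.pi / β)) :
      Real.exp (energy γ β k (glue N (σ * a, y)) / ε) = Real.exp (S / ε) *
        Real.exp ((-(γ / (β * ε)) * c) * Real.cos (β * a) +
          (σ * (γ / (β * ε)) * s) * Real.sin (β * a)) := by
    rw [Set.uIcc_of_le (by positivity)] at ha
    have e1 : |σ * a| = a := by
      rw [abs_mul, abs_of_nonneg ha.1]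
      rcases hσ with rfl | rfl <;> simp
    -- The assumption k ≥ 1 keeps the confining term away from the segment.
    have e2 : max 0 (|σ * a| - k * (2 * Real.pi / β)) = 0 := by
      refine max_eq_left ?_
      have : (1 : ℝ) ≤ k := by exact_mod_cast hk
      have : 2 * Real.pi / β ≤ k * (2 * Real.pi / β) := le_mul_of_one_le_left (by positivity) this
      rw [e1]; linarith [ha.2]
    have e3 : Real.cos (β * (σ * a)) = Real.cos (β * a) := by
      rcases hσ with rfl | rfl
      · simp
      · rw [← Real.cos_neg]; congr 1; ring
    have e4 : Real.sin (β * (σ * a)) = σ * Real.sin (β * a) := by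
      rcases hσ with rfl | rfl
      · simp
      · rw [neg_one_mul, neg_one_mul, ← Real.sin_neg]; congr 1; ring
    rw [energy_glue, e2, integral_cos_add_fluct, e3, e4, ← Real.exp_add]
    congr 1
    field_simp
    ring
  rw [intervalIntegral.integral_congr h1, intervalIntegral.integral_const_mul]
  congr 1
  rw [intervalIntegral.integral_comp_mul_left (fun z => Real.exp ((-(γ / (β * ε)) * c) * Real.cos z +
          (σ * (γ / (β * ε)) * s) * Real.sin z)) hβ.ne', mul_zero, mul_div_cancel₀ _ hβ.ne',
    integral_exp_cos_add_sin, smul_eq_mul, inv_mul_eq_div]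
  congr 2
  have hσ2 : σ ^ 2 = 1 := by rcases hσ with rfl | rfl <;> norm_num
  rw [show (-(γ / (β * ε)) * c) ^ 2 + (σ * (γ / (β * ε)) * s) ^ 2 =
    (γ / (β * ε)) ^ 2 * (c ^ 2 + s ^ 2) by rw [mul_pow, mul_pow, mul_pow, hσ2]; ring,
    Real.sqrt_mul (by positivity), Real.sqrt_sq (by positivity)]

/-- The one-dimensional Eyring-Kramers bound on each line. It holds for every oscillation, with the
Gaussian weight of the saddle already displayed; large oscillations are only penalized through the
error. -/
theorem le_inv_lintegral_exp_energy_line (hγ : 0 < γ) (hβ : 0 < β) (hε : 0 < ε) {k : ℕ}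
    (hk : 1 ≤ k) {σ : ℝ} (hσ : σ = 1 ∨ σ = -1) (y : NonzeroModes N → ℝ) :
    ENNReal.ofReal (√(γ * β / ε) * Real.exp (-(2 * Real.pi * γ / β) / ε) *
        Real.exp (-∑ n, modeRate γ β ε n * y n ^ 2 / 2) *
          (1 - barrierError γ β * (ε + lineError ε y))) ≤
      (∫⁻ a in Set.Ioc 0 (2 * Real.pi / β),
        ENNReal.ofReal (Real.exp (energy γ β k (glue N (σ * a, y)) / ε)))⁻¹ := by
  have hp := Real.pi_pos
  have hc := continuous_fluct_right y
  set S := ∑ n : NonzeroModes N, (n : ℝ) ^ 2 * y n ^ 2 / 2 with hS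
  set q := ∫ x in (0 : ℝ)..(2 * Real.pi), fluct y x ^ 2 with hq
  set F₄ := ∫ x in (0 : ℝ)..(2 * Real.pi), fluct y x ^ 4 with hF₄
  set F₆ := ∫ x in (0 : ℝ)..(2 * Real.pi), fluct y x ^ 6 with hF₆
  set c := ∫ x in (0 : ℝ)..(2 * Real.pi), Real.cos (β * fluct y x) with hcdef
  set s := ∫ x in (0 : ℝ)..(2 * Real.pi), Real.sin (β * fluct y x) with hsdef
  have ii {f : ℝ → ℝ} (hf : Continuous f) : IntervalIntegrable f volume 0 (2 * Real.pi) :=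
    hf.intervalIntegrable _ _
  have hq0 : 0 ≤ q := intervalIntegral.integral_nonneg (by positivity) fun x _ => by positivity
  have hF₄0 : 0 ≤ F₄ := intervalIntegral.integral_nonneg (by positivity) fun x _ => by positivity
  have hF₆0 : 0 ≤ F₆ := intervalIntegral.integral_nonneg (by positivity) fun x _ => by positivity
  have hQ : lineError ε y = q + (F₄ + F₆) / ε := by
    simp only [lineError, errorDensity]
    rw [intervalIntegral.integral_add (ii (by fun_prop)) (ii (by fun_prop)),
      intervalIntegral.integral_div,
      intervalIntegral.integral_add (ii (by fun_prop)) (ii (by fun_prop))]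
  have h1 : 2 * Real.pi - β ^ 2 * q / 2 ≤ c := by
    have := intervalIntegral.integral_mono_on (a := 0) (b := 2 * Real.pi) (μ := volume)
      (f := fun x => 1 - β ^ 2 / 2 * fluct y x ^ 2) (g := fun x => Real.cos (β * fluct y x))
      (by positivity) (ii (by fun_prop)) (ii (by fun_prop))
      fun x _ => by
        have := Real.one_sub_sq_div_two_le_cos (x := β * fluct y x)
        linarith
    rw [intervalIntegral.integral_sub (ii (by fun_prop)) (ii (by fun_prop)),
      intervalIntegral.integral_const_mul, intervalIntegral.integral_const, smul_eq_mul] at this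
    linarith
  have h2 : c ≤ 2 * Real.pi - β ^ 2 * q / 2 + β ^ 4 / 2 * F₄ := by
    have := intervalIntegral.integral_mono_on (a := 0) (b := 2 * Real.pi) (μ := volume)
      (g := fun x => 1 - β ^ 2 / 2 * fluct y x ^ 2 + β ^ 4 / 2 * fluct y x ^ 4)
      (f := fun x => Real.cos (β * fluct y x))
      (by positivity) (ii (by fun_prop)) (ii (by fun_prop))
      fun x _ => by
        have := cos_le_one_sub_sq_add_four (β * fluct y x)
        linarith
    rw [intervalIntegral.integral_add (ii (by fun_prop)) (ii (by fun_prop)),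
      intervalIntegral.integral_sub (ii (by fun_prop)) (ii (by fun_prop)),
      intervalIntegral.integral_const_mul, intervalIntegral.integral_const_mul,
      intervalIntegral.integral_const, smul_eq_mul] at this
    linarith
  have h3 : s ^ 2 ≤ 2 * Real.pi * (4 * β ^ 6 * F₆) := by
    -- Subtracting the mean-zero function βv makes s a cubic quantity, so s² is bounded by the sixth
    -- moment.
    have e1 : s = ∫ x in (0 : ℝ)..(2 * Real.pi), (Real.sin (β * fluct y x) - β * fluct y x) := by
      rw [intervalIntegral.integral_sub (ii (by fun_prop)) (ii (by fun_prop)),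
        intervalIntegral.integral_const_mul, integral_fluct, mul_zero, sub_zero]
    rw [e1, hF₆, ← intervalIntegral.integral_const_mul]
    refine (sq_integral_le (by fun_prop)).trans ?_
    gcongr
    refine intervalIntegral.integral_mono_on (by positivity) (ii (by fun_prop)) (ii (by fun_prop))
      fun x _ => ?_
    have := abs_sin_sub_self_le_cube (β * fluct y x)
    calc _ = |Real.sin (β * fluct y x) - β * fluct y x| ^ 2 := (sq_abs _).symm
      _ ≤ (2 * |β * fluct y x| ^ 3) ^ 2 := by gcongr
      _ = 4 * (|β * fluct y x| ^ 2) ^ 3 := by ring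
      _ = _ := by rw [sq_abs]; ring
  have hmain := circleIntegralExp_le_of_quadratic hγ hβ hε hq0 hF₄0 hF₆0 h1 h2 h3
  have hK := integral_exp_energy_line hγ hβ hε hk hσ y
  rw [← hS, ← hcdef, ← hsdef] at hK
  have hcont : Continuous fun a : ℝ => Real.exp (energy γ β k (glue N (σ * a, y)) / ε) :=
    (((continuous_energy γ β k).comp ((glue N).continuous.comp (by fun_prop))).div_const ε).rexp
  rw [intervalIntegral.integral_of_le (by positivity)] at hK
  rw [← ofReal_integral_eq_lintegral_ofReal hcont.integrableOn_Ioc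
    (Filter.Eventually.of_forall fun a => (Real.exp_pos _).le), hK, ENNReal.le_inv_iff_mul_le,
    ← ENNReal.ofReal_mul' (mul_nonneg (Real.exp_pos _).le
      (div_nonneg (circleIntegralExp_nonneg _) hβ.le)), ← ENNReal.ofReal_one]
  refine ENNReal.ofReal_le_ofReal (le_trans (le_of_eq ?_) hmain)
  -- The Dirichlet energy cancels. What remains, γβq/(2ε), is the lowering of the barrier by the
  -- oscillation, which the expansion of c compensates.
  have e2 : Real.exp (-∑ n, modeRate γ β ε n * y n ^ 2 / 2) * Real.exp (S / ε) =
      Real.exp (γ * β / (2 * ε) * q) := by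
    rw [← Real.exp_add]
    congr 1
    rw [hq, integral_fluct_sq, hS, Finset.sum_div, Finset.mul_sum, ← Finset.sum_neg_distrib,
      ← Finset.sum_add_distrib]
    refine Finset.sum_congr rfl fun n _ => ?_
    rw [modeRate]
    field_simp
    ring
  rw [hQ, ← e2]
  ring

/-- Since v(x)² has Gaussian order ε, the terms t², t⁴/ε and t⁶/ε have orders ε, ε and ε²; the last
is reduced to ε by ε ≤ 1. -/
theorem lintegral_lineError_le (hγ : 0 < γ) (hβ : 0 < β) (h : γ * β < 1) (hε : 0 < ε) (hε1 : ε ≤ 1) :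
    ∫⁻ y : NonzeroModes N → ℝ, ENNReal.ofReal (lineError ε y) ∂gaussPi (modeRate γ β ε) ≤
      ENNReal.ofReal (4 * Real.pi * ((4 * varBound γ β + 32 * varBound γ β ^ 2 +
        384 * varBound γ β ^ 3) * ε)) := by
  have hV1 : 1 ≤ varBound γ β := one_le_varBound h
  unfold lineError
  refine lintegral_integral_fluct_le (mul_pos hγ hβ) h hε (a := 1 / (4 * varBound γ β * ε))
    (by positivity) (le_of_eq (by field_simp)) (by positivity) (by unfold errorDensity; fun_prop)
    fun t => ?_
  generalize varBound γ β = V at *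
  set X := 1 / (4 * V * ε) * t ^ 2 with hX
  have hX0 : 0 ≤ X := by positivity
  have e1 : X ≤ Real.exp X := by linarith [Real.add_one_le_exp X]
  have e2 : X ^ 2 ≤ 2 * Real.exp X := by
    have := Real.pow_div_factorial_le_exp X hX0 2
    norm_num [Nat.factorial] at this; linarith
  have e3 : X ^ 3 ≤ 6 * Real.exp X := by
    have := Real.pow_div_factorial_le_exp X hX0 3
    norm_num [Nat.factorial] at this; linarith
  have ht : t ^ 2 = 4 * V * ε * X := by rw [hX]; field_simp
  have e4 : errorDensity ε t = 4 * V * ε * X + 16 * V ^ 2 * ε * X ^ 2 +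
      64 * V ^ 3 * ε ^ 2 * X ^ 3 := by
    rw [errorDensity, show t ^ 4 = (t ^ 2) ^ 2 by ring, show t ^ 6 = (t ^ 2) ^ 3 by ring, ht]
    field_simp
    ring
  rw [e4]
  calc _ ≤ 4 * V * ε * Real.exp X + 16 * V ^ 2 * ε * (2 * Real.exp X) +
      64 * V ^ 3 * (ε * 1) * (6 * Real.exp X) := by
        rw [sq ε]
        gcongr
    _ = _ := by ring

end Lines

/-! ### Gaussian tails of the Littlewood-Paley blocks -/

section Tail

variable {N : ℕ} {γ β ε : ℝ}

theorem DyadicPartition.multiplier_nonneg (P : DyadicPartition) (j : ℕ) (x : ℝ) :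
    0 ≤ P.multiplier j x := by
  cases j
  · exact P.nonneg_χ x
  · exact P.nonneg_φ _

theorem DyadicPartition.multiplier_le_one (P : DyadicPartition) (j : ℕ) (x : ℝ) :
    P.multiplier j x ≤ 1 := by
  have h0 := (P.sum_eq x).nonneg fun i => P.nonneg_φ _
  cases j with
  | zero => simpa [DyadicPartition.multiplier] using h0
  | succ j =>
    have h1 := le_hasSum (P.sum_eq x) j fun i _ => P.nonneg_φ _
    have h2 := P.nonneg_χ x
    change P.φ (x / 2 ^ j) ≤ 1
    linarith

/-- The radius of the support of the Littlewood-Paley multipliers at unit scale. -/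
def DyadicPartition.radius (P : DyadicPartition) : ℝ := max P.outer 1

/-- The gap of the Littlewood-Paley multipliers at unit scale. -/
def DyadicPartition.gap (P : DyadicPartition) : ℝ := min (P.inner / 2) 1

theorem DyadicPartition.gap_pos (P : DyadicPartition) : 0 < P.gap :=
  lt_min (half_pos P.inner_pos) one_pos

theorem DyadicPartition.one_le_radius (P : DyadicPartition) : 1 ≤ P.radius := le_max_right _ _

theorem DyadicPartition.abs_le_of_multiplier_ne_zero (P : DyadicPartition) {j : ℕ} {x : ℝ}
    (h : P.multiplier j x ≠ 0) : |x| ≤ P.radius * 2 ^ j := by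
  cases j with
  | zero =>
    rw [pow_zero, mul_one]
    exact (P.support_χ x h).trans (le_max_left _ _)
  | succ j =>
    have h1 := (P.support_φ _ h).2
    have h2 : (0 : ℝ) < 2 ^ j := by positivity
    rw [abs_div, abs_of_pos h2, div_le_iff₀ h2] at h1
    have h3 : P.outer ≤ P.radius := le_max_left _ _
    have h4 := P.one_le_radius
    calc |x| ≤ P.radius * 2 ^ j := h1.trans (by gcongr)
      _ ≤ _ := by gcongr <;> norm_num

/-- The low-frequency block has no lower cutoff, so there |x| ≥ 1 does the work. For the others the
shift of the index by one explains the factor 1/2 in `gap`. -/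
theorem DyadicPartition.le_abs_of_multiplier_ne_zero (P : DyadicPartition) {j : ℕ} {x : ℝ}
    (hx : 1 ≤ |x|) (h : P.multiplier j x ≠ 0) : P.gap * 2 ^ j ≤ |x| := by
  cases j with
  | zero =>
    rw [pow_zero, mul_one]
    exact (min_le_right _ _).trans hx
  | succ j =>
    have h1 := (P.support_φ _ h).1
    have h2 : (0 : ℝ) < 2 ^ j := by positivity
    rw [abs_div, abs_of_pos h2, le_div_iff₀ h2] at h1
    have h3 : P.gap ≤ P.inner / 2 := min_le_left _ _
    calc P.gap * 2 ^ (j + 1) ≤ P.inner / 2 * 2 ^ (j + 1) := by gcongr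
      _ = P.inner * 2 ^ j := by rw [pow_succ]; ring
      _ ≤ _ := h1

theorem card_modes_le {R : ℝ} (hR : 1 ≤ R) {s : Finset (NonzeroModes N)}
    (hs : ∀ n ∈ s, |((n : ℤ) : ℝ)| ≤ R) : (s.card : ℝ) ≤ 3 * R := by
  have h1 : s.card ≤ (Finset.Icc (-⌊R⌋) ⌊R⌋).card := by
    refine Finset.card_le_card_of_injOn (fun n => (n : ℤ)) (fun n hn => ?_)
      nonzeroModes_injective.injOn
    have h2 := abs_le.1 (hs n hn)
    have h3 : (n : ℤ) ≤ ⌊R⌋ := Int.le_floor.2 h2.2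
    have h4 : -(n : ℤ) ≤ ⌊R⌋ := Int.le_floor.2 (by push_cast; linarith)
    simp only [Finset.coe_Icc, Set.mem_Icc]
    omega
  have h2 : 0 ≤ ⌊R⌋ := Int.floor_nonneg.2 (by linarith)
  rw [Int.card_Icc] at h1
  have h3 : (s.card : ℤ) ≤ 2 * ⌊R⌋ + 1 := by omega
  have h4 : (s.card : ℝ) ≤ 2 * (⌊R⌋ : ℝ) + 1 := by exact_mod_cast h3
  linarith [Int.floor_le R]

theorem abs_one_le_nonzeroModes (n : NonzeroModes N) : (1 : ℝ) ≤ |((n : ℤ) : ℝ)| := by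
  have := Int.one_le_abs n.2
  exact_mod_cast this

theorem sum_le_mul_of_support {R B : ℝ} (hR : 1 ≤ R) (hB : 0 ≤ B) {f : NonzeroModes N → ℝ}
    (hs : ∀ n, f n ≠ 0 → |((n : ℤ) : ℝ)| ≤ R) (hf : ∀ n, f n ≤ B) :
    ∑ n, f n ≤ 3 * R * B := by
  classical
  rw [← Finset.sum_filter_ne_zero]
  refine (Finset.sum_le_card_nsmul _ _ B fun n _ => hf n).trans ?_
  rw [nsmul_eq_mul]
  gcongr
  exact card_modes_le hR fun n hn => hs n (Finset.mem_filter.1 hn).2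

theorem abs_trigBasis_sub_le (n : ℤ) (x y : ℝ) :
    |trigBasis n x - trigBasis n y| ≤ |(n : ℝ)| * |x - y| := by
  have := Convex.norm_image_sub_le_of_norm_hasDerivWithin_le (f := trigBasis n)
    (f' := fun x => -n * trigBasis (-n) x) (s := Set.univ) (C := |(n : ℝ)|) (x := y) (y := x)
    (fun z _ => (hasDerivAt_trigBasis n z).hasDerivWithinAt)
    (fun z _ => by
      rw [Real.norm_eq_abs, abs_mul, abs_neg]
      exact mul_le_of_le_one_right (abs_nonneg _) (abs_trigBasis_le _ _))
    convex_univ (Set.mem_univ _) (Set.mem_univ _)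
  simpa [Real.norm_eq_abs] using this

/-- A trigonometric polynomial of degree at most `R` stays large on an interval of length of order
`R⁻²`. -/
theorem exp_le_integral_exp_of_lt {R : ℝ} (hR : 1 ≤ R) {c : NonzeroModes N → ℝ}
    (hc : ∀ n, c n ≠ 0 → |((n : ℤ) : ℝ)| ≤ R) {lam τ x₀ : ℝ} (hlam : 0 ≤ lam) (hτ : 0 ≤ τ)
    (h0 : τ < |fluct c x₀|) :
    Real.exp (lam * τ ^ 2 / 4) ≤
      40 * R ^ 2 * ∫ x in (0 : ℝ)..8, Real.exp (lam * fluct c x ^ 2) := by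
  have hp := Real.pi_pos
  have hp4 := Real.pi_lt_d2
  have hcont := continuous_fluct_right c
  obtain ⟨x₁, hx₁, hmax⟩ := (isCompact_Icc (a := (0 : ℝ)) (b := 2 * Real.pi)).exists_isMaxOn
    ⟨0, by simp [hp.le]⟩ hcont.abs.continuousOn
  set M := |fluct c x₁| with hM
  have hper : Function.Periodic (fluct c) (2 * Real.pi) := fun x => by
    simp only [fluct, trigBasis_periodic _ x]
  have hτM : τ < M := by
    obtain ⟨z, hz, hz'⟩ := hper.exists_mem_Ico₀ (by positivity) x₀
    rw [hz'] at h0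
    exact h0.trans_le (hmax ⟨hz.1, hz.2.le⟩)
  have hM0 : 0 < M := hτ.trans_lt hτM
  -- Fourier coefficients are controlled by the maximum M of the polynomial.
  have hcoef (n : NonzeroModes N) : |c n| ≤ 2 * Real.pi * M := by
    rw [← integral_trigSum_mul_trigBasis nonzeroModes_injective (fun n => n.2) c n]
    have := intervalIntegral.norm_integral_le_of_norm_le_const (a := 0) (b := 2 * Real.pi) (C := M)
      (f := fun x => (∑ n : NonzeroModes N, c n * trigBasis n x) * trigBasis n x) fun x hx => by
        rw [Set.uIoc_of_le (by positivity)] at hx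
        rw [norm_mul, Real.norm_eq_abs, Real.norm_eq_abs]
        exact (mul_le_of_le_one_right (abs_nonneg _) (abs_trigBasis_le _ _)).trans
          (hmax ⟨hx.1.le, hx.2⟩)
    rw [sub_zero, abs_of_pos (by positivity), Real.norm_eq_abs] at this
    linarith
  -- A crude Bernstein inequality: at most 3R modes, with coefficients at most 2πM and slopes at
  -- most R, and 6π ≤ 20. The loss of one power of R is irrelevant.
  have hlip (x : ℝ) : |fluct c x₁ - fluct c x| ≤ 20 * R ^ 2 * M * |x₁ - x| := by
    have h1 : fluct c x₁ - fluct c x =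
        ∑ n : NonzeroModes N, c n * (trigBasis n x₁ - trigBasis n x) := by
      simp only [fluct, ← Finset.sum_sub_distrib, mul_sub]
    rw [h1]
    refine (Finset.abs_sum_le_sum_abs _ _).trans ?_
    refine (sum_le_mul_of_support hR (B := 2 * Real.pi * M * (R * |x₁ - x|)) (by positivity)
      (fun n hn => hc n fun h => hn (by simp [h])) fun n => ?_).trans ?_
    · rw [abs_mul]
      by_cases hn : c n = 0
      · rw [hn, abs_zero, zero_mul]; positivity
      · have := abs_trigBasis_sub_le n x₁ x
        have h2 := hc n hn
        calc |c n| * |trigBasis n x₁ - trigBasis n x|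
            ≤ 2 * Real.pi * M * (|((n : ℤ) : ℝ)| * |x₁ - x|) := by
              gcongr; exact hcoef n
          _ ≤ _ := by gcongr
    · have h3 : 0 ≤ R ^ 2 * M * |x₁ - x| := by positivity
      nlinarith
  set d := 1 / (40 * R ^ 2) with hd
  have hd0 : 0 < d := by positivity
  have hd1 : d ≤ 1 := by
    rw [hd, div_le_one (by positivity)]; nlinarith
  have hlow (x : ℝ) (hx : x ∈ Set.Icc x₁ (x₁ + d)) :
      Real.exp (lam * τ ^ 2 / 4) ≤ Real.exp (lam * fluct c x ^ 2) := by
    refine Real.exp_le_exp.2 ?_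
    have h1 : |x₁ - x| ≤ d := by rw [abs_le]; constructor <;> linarith [hx.1, hx.2]
    have h2 : |fluct c x₁ - fluct c x| ≤ M / 2 := by
      refine (hlip x).trans ?_
      calc 20 * R ^ 2 * M * |x₁ - x| ≤ 20 * R ^ 2 * M * d := by gcongr
        _ = M / 2 := by rw [hd]; field_simp; norm_num
    have h3 : τ / 2 ≤ |fluct c x| := by
      have := abs_sub_abs_le_abs_sub (fluct c x₁) (fluct c x)
      linarith
    have h4 : (τ / 2) ^ 2 ≤ fluct c x ^ 2 := by
      rw [← sq_abs (fluct c x)]; gcongr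
    nlinarith
  have hEc : Continuous fun x => Real.exp (lam * fluct c x ^ 2) := by fun_prop
  have h1 : d * Real.exp (lam * τ ^ 2 / 4) ≤
      ∫ x in x₁..(x₁ + d), Real.exp (lam * fluct c x ^ 2) := by
    have := intervalIntegral.integral_mono_on (a := x₁) (b := x₁ + d) (μ := volume) (by linarith)
      (_root_.intervalIntegrable_const (c := Real.exp (lam * τ ^ 2 / 4)))
      (hEc.intervalIntegrable _ _) hlow
    simpa using this
  -- The maximum may sit at the end of the period; the interval [0, 8] still contains its right
  -- neighbourhood, as 2π + 1 ≤ 8.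
  have h2 : ∫ x in x₁..(x₁ + d), Real.exp (lam * fluct c x ^ 2) ≤
      ∫ x in (0 : ℝ)..8, Real.exp (lam * fluct c x ^ 2) :=
    intervalIntegral.integral_mono_interval hx₁.1 (by linarith) (by linarith [hx₁.2])
      (Filter.Eventually.of_forall fun x => (Real.exp_pos _).le) (hEc.intervalIntegrable _ _)
  calc Real.exp (lam * τ ^ 2 / 4) = 40 * R ^ 2 * (d * Real.exp (lam * τ ^ 2 / 4)) := by
        rw [hd]; field_simp
    _ ≤ _ := by gcongr; exact h1.trans h2

/-- A bound for the variance of the Littlewood-Paley blocks, per unit of temperature. -/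
def blockBound (γ β : ℝ) (P : DyadicPartition) : ℝ :=
  3 * P.radius / ((1 - γ * β) * P.gap ^ 2)

theorem blockBound_pos (h : γ * β < 1) (P : DyadicPartition) : 0 < blockBound γ β P := by
  have h1 := P.gap_pos
  have h2 := P.one_le_radius
  have h3 : 0 < 1 - γ * β := by linarith
  unfold blockBound; positivity

/-- Block j contains at most of order 2^j modes, each of variance at most of order ε 4^{-j}. -/
theorem sum_block_variance_le (h0 : 0 < γ * β) (h : γ * β < 1) (hε : 0 < ε) (P : DyadicPartition)
    (j : ℕ) (x : ℝ) :
    ∑ n : NonzeroModes N, (P.multiplier j ((n : ℤ) : ℝ) * trigBasis n x) ^ 2 / modeRate γ β ε n ≤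
      ε * blockBound γ β P / 2 ^ j := by
  have h1 := P.gap_pos
  have h2 := P.one_le_radius
  have h3 : 0 < 1 - γ * β := by linarith
  have hj : (1 : ℝ) ≤ 2 ^ j := one_le_pow₀ one_le_two
  refine (sum_le_mul_of_support (R := P.radius * 2 ^ j)
    (B := ε / ((1 - γ * β) * (P.gap * 2 ^ j) ^ 2)) (one_le_mul_of_one_le_of_one_le h2 hj)
    (by positivity) (fun n hn => P.abs_le_of_multiplier_ne_zero fun h => hn (by simp [h]))
    fun n => ?_).trans (le_of_eq ?_)
  · by_cases hn : P.multiplier j ((n : ℤ) : ℝ) = 0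
    · rw [hn]; simp only [zero_mul, zero_pow two_ne_zero, zero_div]; positivity
    · have h4 := P.le_abs_of_multiplier_ne_zero (abs_one_le_nonzeroModes n) hn
      have h5 : (P.multiplier j ((n : ℤ) : ℝ) * trigBasis n x) ^ 2 ≤ 1 := by
        rw [sq_le_one_iff_abs_le_one, abs_mul, abs_of_nonneg (P.multiplier_nonneg _ _)]
        exact mul_le_one₀ (P.multiplier_le_one _ _) (abs_nonneg _) (abs_trigBasis_le _ _)
      have h6 : (1 - γ * β) * (P.gap * 2 ^ j) ^ 2 / ε ≤ modeRate γ β ε n := by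
        refine le_trans ?_ (le_modeRate h0 hε n)
        rw [← sq_abs ((n : ℤ) : ℝ)]
        gcongr
      calc _ ≤ 1 / ((1 - γ * β) * (P.gap * 2 ^ j) ^ 2 / ε) :=
            div_le_div₀ zero_le_one h5 (by positivity) h6
        _ = _ := by field_simp
  · rw [blockBound]; field_simp

/-- A large supremum forces a large integral of exp(λ v²), whose expectation is bounded by the
pointwise variance; Markov's inequality concludes. The powers of 2^j lost here are beaten later by
the exponential. -/
theorem gaussPi_block_le (h0 : 0 < γ * β) (h : γ * β < 1) (hε : 0 < ε) (P : DyadicPartition)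
    (j : ℕ) {τ : ℝ} (hτ : 0 ≤ τ) :
    gaussPi (modeRate (N := N) γ β ε) {y | ∃ x,
        τ < |∑ n : NonzeroModes N, P.multiplier j ((n : ℤ) : ℝ) * y n * trigBasis n x|} ≤
      ENNReal.ofReal (640 * (P.radius * 2 ^ j) ^ 2 *
        Real.exp (-(2 ^ j / (4 * blockBound γ β P * ε) * τ ^ 2 / 4))) := by
  have hV := blockBound_pos h P
  have h2 := P.one_le_radius
  have hj : (1 : ℝ) ≤ 2 ^ j := one_le_pow₀ one_le_two
  set R := P.radius * 2 ^ j with hR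
  have hR1 : 1 ≤ R := one_le_mul_of_one_le_of_one_le h2 hj
  -- The value for which λ times the variance bound of the block is the critical 1/4.
  set lam := 2 ^ j / (4 * blockBound γ β P * ε) with hlam
  have hlam0 : 0 < lam := by positivity
  set c : (NonzeroModes N → ℝ) → NonzeroModes N → ℝ :=
    fun y n => P.multiplier j ((n : ℤ) : ℝ) * y n with hc
  have hfc : Continuous fun p : (NonzeroModes N → ℝ) × ℝ => Real.exp (lam * fluct (c p.1) p.2 ^ 2) := by
    simp only [hc, fluct]; fun_prop
  set J : (NonzeroModes N → ℝ) → ℝ := fun y =>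
    ∫ x in (0 : ℝ)..8, Real.exp (lam * fluct (c y) x ^ 2) with hJ
  have hJc : Continuous J :=
    intervalIntegral.continuous_parametric_intervalIntegral_of_continuous' hfc _ _
  set A := Real.exp (lam * τ ^ 2 / 4) with hA
  have hsub : {y : NonzeroModes N → ℝ | ∃ x,
      τ < |∑ n : NonzeroModes N, P.multiplier j ((n : ℤ) : ℝ) * y n * trigBasis n x|} ⊆
      {y | ENNReal.ofReal (A / (40 * R ^ 2)) ≤ ENNReal.ofReal (J y)} := by
    rintro y ⟨x, hx⟩
    refine ENNReal.ofReal_le_ofReal ?_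
    rw [div_le_iff₀ (by positivity)]
    have := exp_le_integral_exp_of_lt hR1 (c := c y)
      (fun n hn => P.abs_le_of_multiplier_ne_zero fun h => hn (by simp [hc, h])) hlam0.le hτ hx
    rw [mul_comm (J y)]
    exact this
  have hint : ∫⁻ y, ENNReal.ofReal (J y) ∂gaussPi (modeRate (N := N) γ β ε) ≤
      ENNReal.ofReal 16 := by
    refine (lintegral_integral_le_of_le (f := fun y x => Real.exp (lam * fluct (c y) x ^ 2))
      hfc.measurable (by norm_num : (0 : ℝ) ≤ 8) (M := 2) fun x => ?_).trans (le_of_eq ?_)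
    · have e (y : NonzeroModes N → ℝ) : fluct (c y) x =
          ∑ n : NonzeroModes N, (P.multiplier j ((n : ℤ) : ℝ) * trigBasis n x) * y n :=
        Finset.sum_congr rfl fun n _ => by simp only [hc]; ring
      simp_rw [e]
      refine lintegral_exp_sq_linear_gaussPi_le (modeRate_pos h hε) ?_
      calc _ ≤ lam * (ε * blockBound γ β P / 2 ^ j) := by
            gcongr; exact sum_block_variance_le h0 h hε P j x
        _ = 1 / 4 := by rw [hlam]; field_simp
        _ ≤ _ := le_rfl
    · rw [show (2 : ENNReal) = ENNReal.ofReal 2 by simp, ← ENNReal.ofReal_mul (by norm_num)]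
      norm_num
  have hA0 : 0 < A / (40 * R ^ 2) := by positivity
  have hmk := (mul_meas_ge_le_lintegral₀ (μ := gaussPi (modeRate (N := N) γ β ε))
    hJc.measurable.ennreal_ofReal.aemeasurable (ENNReal.ofReal (A / (40 * R ^ 2)))).trans hint
  refine (measure_mono hsub).trans ?_
  rw [mul_comm, ← ENNReal.le_div_iff_mul_le (Or.inl (ENNReal.ofReal_pos.2 hA0).ne')
    (Or.inl ENNReal.ofReal_ne_top), ← ENNReal.ofReal_div_of_pos hA0] at hmk
  refine hmk.trans (ENNReal.ofReal_le_ofReal (le_of_eq ?_))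
  rw [Real.exp_neg, ← hA]
  field_simp
  norm_num

end Tail

/-! ### Concentration of the oscillation in the Besov ball -/

section Concentration

variable {N : ℕ} {γ β ε : ℝ}

/-- The factor 1/2 in the hypothesis keeps the inequality strict after the supremum over all blocks.
-/
theorem besovNorm_oscillation_glue_lt {P : DyadicPartition} {s t a : ℝ} (ht : 0 < t)
    {y : NonzeroModes N → ℝ}
    (h : ∀ j : ℕ, ∀ x, |∑ n : NonzeroModes N, P.multiplier j ((n : ℤ) : ℝ) * y n * trigBasis n x| ≤
      t / 2 * (2 : ℝ) ^ (-(((j : ℝ) - 1) * s))) :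
    besovNorm P s (oscillation (glue N (a, y))) < ENNReal.ofReal t := by
  refine lt_of_le_of_lt (iSup_le fun j => ?_)
    ((ENNReal.ofReal_lt_ofReal_iff ht).2 (half_lt_self ht))
  have h1 : ⨆ x : ℝ, ‖lpBlock P j (oscillation (glue N (a, y))) x‖ₑ ≤
      ENNReal.ofReal (t / 2 * (2 : ℝ) ^ (-(((j : ℝ) - 1) * s))) := by
    refine iSup_le fun x => ?_
    rw [lpBlock_oscillation_glue, ← ofReal_norm, Real.norm_eq_abs]
    exact ENNReal.ofReal_le_ofReal (h j x)
  calc _ ≤ ENNReal.ofReal ((2 : ℝ) ^ (((j : ℝ) - 1) * s)) *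
        ENNReal.ofReal (t / 2 * (2 : ℝ) ^ (-(((j : ℝ) - 1) * s))) := by gcongr
    _ = ENNReal.ofReal (t / 2) := by
        rw [← ENNReal.ofReal_mul (by positivity)]
        congr 1
        rw [Real.rpow_neg (by norm_num)]
        have : (0 : ℝ) < 2 ^ (((j : ℝ) - 1) * s) := by positivity
        field_simp

theorem summable_four_pow_mul_exp {κ : ℝ} (hκ : 0 < κ) :
    Summable fun j : ℕ => (4 : ℝ) ^ j * Real.exp (-(2 : ℝ) ^ (2 * κ * j)) := by
  -- With 2κm ≥ 3 the m-th power of 2^{2κj} dominates 8^j, which leaves a geometric factor 2^{-j}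
  -- against 4^j.
  obtain ⟨m, hm⟩ := exists_nat_gt (3 / (2 * κ))
  have hm' : 3 ≤ 2 * κ * m := by
    rw [div_lt_iff₀ (by positivity)] at hm; linarith
  refine Summable.of_nonneg_of_le (fun j => by positivity) (fun j => ?_)
    ((summable_geometric_two).mul_left (m.factorial : ℝ))
  set X := (2 : ℝ) ^ (2 * κ * j) with hX
  have hX0 : 0 < X := by positivity
  have h1 : (8 : ℝ) ^ j ≤ X ^ m := by
    calc (8 : ℝ) ^ j = (2 : ℝ) ^ (3 * (j : ℝ)) := by
          rw [show (8 : ℝ) = (2 : ℝ) ^ (3 : ℝ) by norm_num, ← Real.rpow_natCast,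
            ← Real.rpow_mul (by norm_num)]
      _ ≤ (2 : ℝ) ^ ((2 * κ * j) * m) := by
          refine Real.rpow_le_rpow_of_exponent_le (by norm_num) ?_
          have := mul_le_mul_of_nonneg_right hm' (Nat.cast_nonneg (α := ℝ) j)
          linarith
      _ = X ^ m := by rw [hX, ← Real.rpow_natCast, ← Real.rpow_mul (by norm_num)]
  have h2 : (8 : ℝ) ^ j ≤ m.factorial * Real.exp X := by
    have := Real.pow_div_factorial_le_exp X hX0.le m
    rw [div_le_iff₀ (by positivity)] at this
    linarith
  have h3 : (4 : ℝ) ^ j * 2 ^ j = 8 ^ j := by rw [← mul_pow]; norm_num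
  rw [Real.exp_neg, one_div, inv_pow, ← div_eq_mul_inv, ← div_eq_mul_inv,
    div_le_div_iff₀ (Real.exp_pos _) (by positivity), h3]
  exact h2

/-- Block j has standard deviation of order √ε 2^{-j/2}, while regularity 1/2 - κ permits √(c₀ ε
log(1/ε)) 2^{-j(1/2-κ)}. The tail exponent is therefore of order c₀ log(1/ε) 2^{2κj}, enough both to
extract a factor ε and to sum over all blocks. -/
theorem gaussPi_not_small_le (h0 : 0 < γ * β) (h : γ * β < 1) {κ : ℝ} (hκ : 0 < κ) (hκ' : κ < 1 / 2)
    (P : DyadicPartition) :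
    ∃ c₁ C : ℝ, 0 < c₁ ∧ 0 < C ∧ ∀ c₀ : ℝ, c₁ ≤ c₀ → ∀ ε : ℝ, 0 < ε → 1 ≤ Real.log (1 / ε) →
      ∀ N : ℕ, gaussPi (modeRate (N := N) γ β ε)
        {y | ¬ ∀ a : ℝ, besovNorm P (1 / 2 - κ) (oscillation (glue N (a, y))) <
          ENNReal.ofReal √(c₀ * ε * Real.log (1 / ε))} ≤ ENNReal.ofReal (C * ε) := by
  have hV := blockBound_pos h P
  have hR := P.one_le_radius
  have hs := summable_four_pow_mul_exp hκ
  set T := ∑' j : ℕ, (4 : ℝ) ^ j * Real.exp (-(2 : ℝ) ^ (2 * κ * j)) with hT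
  have hT0 : 0 ≤ T := tsum_nonneg fun j => by positivity
  -- The tail exponent is at least c₀/(64V) · L X with L = log(1/ε) ≥ 1 and X = 2^{2κj} ≥ 1; c₀ ≥
  -- 128V makes it at least 2LX ≥ L + X, and e^{-L} = ε.
  refine ⟨128 * blockBound γ β P, 640 * P.radius ^ 2 * T + 1, by positivity, by positivity,
    fun c₀ hc₀ ε hε hL N => ?_⟩
  set V := blockBound γ β P with hVdef
  set L := Real.log (1 / ε) with hLdef
  have hc₀0 : 0 < c₀ := lt_of_lt_of_le (by positivity) hc₀
  set t := √(c₀ * ε * L) with ht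
  have ht0 : 0 < t := Real.sqrt_pos.2 (by positivity)
  have ht2 : t ^ 2 = c₀ * ε * L := Real.sq_sqrt (by positivity)
  set s := 1 / 2 - κ with hsdef
  set τ : ℕ → ℝ := fun j => t / 2 * (2 : ℝ) ^ (-(((j : ℝ) - 1) * s)) with hτ
  have hτ0 (j : ℕ) : 0 ≤ τ j := by positivity
  have hsub : {y : NonzeroModes N → ℝ | ¬ ∀ a : ℝ, besovNorm P s (oscillation (glue N (a, y))) <
      ENNReal.ofReal t} ⊆ ⋃ j : ℕ, {y | ∃ x,
        τ j < |∑ n : NonzeroModes N, P.multiplier j ((n : ℤ) : ℝ) * y n * trigBasis n x|} := by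
    intro y hy
    by_contra hcon
    simp only [Set.mem_iUnion, Set.mem_ofPred_eq, not_exists, not_lt] at hcon
    exact hy fun a => besovNorm_oscillation_glue_lt ht0 hcon
  have hexp (j : ℕ) : Real.exp (-(2 ^ j / (4 * V * ε) * τ j ^ 2 / 4)) ≤
      ε * Real.exp (-(2 : ℝ) ^ (2 * κ * j)) := by
    set X := (2 : ℝ) ^ (2 * κ * j) with hX
    have hX1 : 1 ≤ X := Real.one_le_rpow (by norm_num) (by positivity)
    have e1 : (2 : ℝ) ^ j * ((2 : ℝ) ^ (-(((j : ℝ) - 1) * s))) ^ 2 = X * (2 : ℝ) ^ (1 - 2 * κ) := by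
      rw [hX, ← Real.rpow_natCast, ← Real.rpow_natCast, ← Real.rpow_mul (by norm_num),
        ← Real.rpow_add (by norm_num), ← Real.rpow_add (by norm_num)]
      congr 1
      rw [hsdef]; push_cast; ring
    have e2 : 1 ≤ (2 : ℝ) ^ (1 - 2 * κ) := Real.one_le_rpow (by norm_num) (by linarith)
    have e3 : 2 * (L * X) ≤ 2 ^ j / (4 * V * ε) * τ j ^ 2 / 4 := by
      have e4 : 2 ^ j / (4 * V * ε) * τ j ^ 2 / 4 =
          c₀ / (64 * V) * L * (2 ^ j * ((2 : ℝ) ^ (-(((j : ℝ) - 1) * s))) ^ 2) := by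
        simp only [hτ]
        rw [mul_pow, div_pow, ht2]
        field_simp
        norm_num
      rw [e4, e1]
      have e5 : 2 ≤ c₀ / (64 * V) := by
        rw [le_div_iff₀ (by positivity)]; linarith
      calc 2 * (L * X) = 2 * L * (X * 1) := by ring
        _ ≤ _ := by gcongr
    have e6 : Real.exp (-L) = ε := by
      rw [hLdef, one_div, Real.log_inv, neg_neg, Real.exp_log hε]
    calc _ ≤ Real.exp (-L + -X) := by
          refine Real.exp_le_exp.2 ?_
          nlinarith
      _ = _ := by rw [Real.exp_add, e6]
  calc _ ≤ ∑' j : ℕ, ENNReal.ofReal (640 * (P.radius * 2 ^ j) ^ 2 *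
          Real.exp (-(2 ^ j / (4 * V * ε) * τ j ^ 2 / 4))) :=
        (measure_mono hsub).trans ((measure_iUnion_le _).trans
          (ENNReal.tsum_le_tsum fun j => gaussPi_block_le h0 h hε P j (hτ0 j)))
    _ ≤ ∑' j : ℕ, ENNReal.ofReal (640 * P.radius ^ 2 * ε *
          ((4 : ℝ) ^ j * Real.exp (-(2 : ℝ) ^ (2 * κ * j)))) := by
        refine ENNReal.tsum_le_tsum fun j => ENNReal.ofReal_le_ofReal ?_
        calc _ ≤ 640 * (P.radius * 2 ^ j) ^ 2 * (ε * Real.exp (-(2 : ℝ) ^ (2 * κ * j))) := by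
              gcongr; exact hexp j
          _ = _ := by
              rw [mul_pow, ← pow_mul, mul_comm j 2, pow_mul]; norm_num; ring
    _ = ENNReal.ofReal (640 * P.radius ^ 2 * ε * T) := by
        rw [← ENNReal.ofReal_tsum_of_nonneg (fun j => by positivity) (hs.mul_left _),
          tsum_mul_left]
    _ ≤ _ := ENNReal.ofReal_le_ofReal (by nlinarith)

end Concentration

/-! ### Weak gradients restricted to almost every line -/

section Slices

variable {N : ℕ}

/-- The vector of nonzero Fourier coefficients. -/
def osc (u : State N) : NonzeroModes N → ℝ := fun n => u n

theorem osc_glue (p : ℝ × (NonzeroModes N → ℝ)) : osc (glue N p) = p.2 :=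
  funext fun n => glue_apply_nonzero p n

theorem continuous_osc : Continuous (osc (N := N)) :=
  continuous_snd.comp (glue N).symm.continuous

theorem hasCompactSupport_mean_mul_osc {φ : ℝ → ℝ} {f : (NonzeroModes N → ℝ) → ℝ}
    (hφ : HasCompactSupport φ) (hf : HasCompactSupport f) :
    HasCompactSupport fun u : State N => φ (mean u) * f (osc u) := by
  refine HasCompactSupport.intro ((hφ.isCompact.prod hf.isCompact).image (glue N).continuous)
    fun u hu => ?_
  obtain ⟨p, rfl⟩ := (glue N).surjective u
  rw [mean_glue, osc_glue]
  by_contra hne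
  exact hu ⟨p, ⟨subset_tsupport _ (left_ne_zero_of_mul hne),
    subset_tsupport _ (right_ne_zero_of_mul hne)⟩, rfl⟩

theorem integrable_mul_slices {g : State N → ℝ} (hg : LocallyIntegrable g) {φ : ℝ → ℝ}
    (hφ : Continuous φ) (hφc : HasCompactSupport φ) {f : (NonzeroModes N → ℝ) → ℝ}
    (hf : Continuous f) (hfc : HasCompactSupport f) :
    Integrable fun u => g u * (φ (mean u) * f (osc u)) := by
  have := hg.integrable_smul_right_of_hasCompactSupport
    ((hφ.comp continuous_mean).mul (hf.comp continuous_osc)) (hasCompactSupport_mean_mul_osc hφc hfc)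
  exact this

theorem integrable_prod_slices {g : State N → ℝ} (hg : LocallyIntegrable g) {φ : ℝ → ℝ}
    (hφ : Continuous φ) (hφc : HasCompactSupport φ) {f : (NonzeroModes N → ℝ) → ℝ}
    (hf : Continuous f) (hfc : HasCompactSupport f) :
    Integrable (fun p : ℝ × (NonzeroModes N → ℝ) => f p.2 * (g (glue N p) * φ p.1))
      (volume.prod volume) := by
  have h1 := ((measurePreserving_glue N).integrable_comp_emb (measurableEmbedding_glue N)).2
    (integrable_mul_slices hg hφ hφc hf hfc)
  refine h1.congr (Filter.Eventually.of_forall fun p => ?_)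
  simp only [Function.comp_apply, mean_glue, osc_glue]
  ring

theorem integral_mul_slices {g : State N → ℝ} (hg : LocallyIntegrable g) {φ : ℝ → ℝ}
    (hφ : Continuous φ) (hφc : HasCompactSupport φ) {f : (NonzeroModes N → ℝ) → ℝ}
    (hf : Continuous f) (hfc : HasCompactSupport f) :
    ∫ u, g u * (φ (mean u) * f (osc u)) = ∫ y, f y * ∫ a, g (glue N (a, y)) * φ a := by
  rw [← (measurePreserving_glue N).integral_comp (measurableEmbedding_glue N)]
  have e (p : ℝ × (NonzeroModes N → ℝ)) : g (glue N p) * (φ (mean (glue N p)) * f (osc (glue N p))) =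
      f p.2 * (g (glue N p) * φ p.1) := by
    rw [mean_glue, osc_glue]; ring
  simp_rw [e]
  rw [Measure.volume_eq_prod, integral_prod_symm _ (integrable_prod_slices hg hφ hφc hf hfc)]
  simp_rw [integral_const_mul]

/-- A continuous cutoff function which is `1` on the ball of radius `R`. -/
theorem exists_cutoff (R : ℝ) : ∃ f : (NonzeroModes N → ℝ) → ℝ, Continuous f ∧
    HasCompactSupport f ∧ ∀ y, ‖y‖ ≤ R → f y = 1 := by
  refine ⟨fun y => max 0 (min 1 (R + 1 - ‖y‖)), by fun_prop,
    HasCompactSupport.intro (isCompact_closedBall 0 (R + 1)) fun y hy => ?_, fun y hy => ?_⟩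
  · rw [mem_closedBall_zero_iff, not_le] at hy
    exact max_eq_left (min_le_of_right_le (by linarith))
  · show max 0 (min 1 (R + 1 - ‖y‖)) = 1
    rw [min_eq_left (by linarith), max_eq_right zero_le_one]

theorem locallyIntegrable_slices {g : State N → ℝ} (hg : LocallyIntegrable g) {φ : ℝ → ℝ}
    (hφ : Continuous φ) (hφc : HasCompactSupport φ) :
    LocallyIntegrable fun y : NonzeroModes N → ℝ => ∫ a, g (glue N (a, y)) * φ a := by
  rw [locallyIntegrable_iff]
  intro K hK
  obtain ⟨R, hR⟩ := hK.isBounded.exists_norm_le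
  obtain ⟨f, hf, hfc, hf1⟩ := exists_cutoff (N := N) R
  have h1 := (integrable_prod_slices hg hφ hφc hf hfc).integral_prod_right
  simp_rw [integral_const_mul] at h1
  refine h1.integrableOn.congr_fun (fun y hy => ?_) hK.measurableSet
  simp only [hf1 y (hR y hy), one_mul]

theorem ae_integrable_slices {g : State N → ℝ} (hg : LocallyIntegrable g) {φ : ℝ → ℝ}
    (hφ : Continuous φ) (hφc : HasCompactSupport φ) :
    ∀ᵐ y : NonzeroModes N → ℝ, Integrable fun a => g (glue N (a, y)) * φ a := by
  have h (n : ℕ) : ∀ᵐ y : NonzeroModes N → ℝ, ‖y‖ ≤ n →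
      Integrable fun a => g (glue N (a, y)) * φ a := by
    obtain ⟨f, hf, hfc, hf1⟩ := exists_cutoff (N := N) n
    filter_upwards [(integrable_prod_slices hg hφ hφc hf hfc).prod_left_ae] with y hy hyn
    simpa only [hf1 y hyn, one_mul] using hy
  filter_upwards [ae_all_iff.2 h] with y hy
  obtain ⟨n, hn⟩ := exists_nat_ge ‖y‖
  exact hy n hn

/-- The definition of the weak gradient is tested with products θ(û(0)) f(û_⊥). Fubini and the
fundamental lemma of the calculus of variations in the variable f isolate the line. The exceptional
null set depends on θ, so only fixed cutoffs may be used afterwards. -/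
theorem ae_integral_slice_eq {g : State N → ℝ} {G : State N → State N} (h : IsWeakGradient g G)
    {θ : ℝ → ℝ} (hθ : ContDiff ℝ ∞ θ) (hθc : HasCompactSupport θ) :
    ∀ᵐ y : NonzeroModes N → ℝ, ∫ a, g (glue N (a, y)) * deriv θ a =
      -∫ a, G (glue N (a, y)) (zeroMode N) * θ a := by
  obtain ⟨hg, hG, hw⟩ := h
  have hG0 : LocallyIntegrable fun u => G u (zeroMode N) := by
    rw [locallyIntegrable_iff] at hG ⊢
    intro K hK
    exact (EuclideanSpace.proj (𝕜 := ℝ) (zeroMode N)).integrable_comp (hG K hK)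
  have hd : Continuous (deriv θ) := hθ.continuous_deriv (by simp)
  have hdc : HasCompactSupport (deriv θ) := hθc.deriv
  have l1 := locallyIntegrable_slices hg hd hdc
  have l2 := locallyIntegrable_slices hG0 hθ.continuous hθc
  have key := ae_eq_zero_of_integral_contDiff_smul_eq_zero (l1.add l2) fun f hf hfc => ?_
  · filter_upwards [key] with y hy
    simp only [Pi.add_apply] at hy
    linarith
  set ψ : State N → ℝ := fun u => θ (mean u) * f (osc u) with hψ
  have hmc : ContDiff ℝ ∞ (mean (N := N)) := (meanL N).contDiff
  have hoc : ContDiff ℝ ∞ (osc (N := N)) :=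
    ((ContinuousLinearMap.snd ℝ ℝ (NonzeroModes N → ℝ)).comp
      (glue N).symm.toContinuousLinearMap).contDiff
  have hψd : ContDiff ℝ ∞ ψ := (hθ.comp hmc).mul (hf.comp hoc)
  have hψc : HasCompactSupport ψ := hasCompactSupport_mean_mul_osc hθc hfc
  set v : State N := EuclideanSpace.single (zeroMode N) (1 : ℝ) with hv
  have hfd (u : State N) : fderiv ℝ ψ u v = deriv θ (mean u) * f (osc u) := by
    rw [← (hψd.differentiable (by simp) u).lineDeriv_eq_fderiv, lineDeriv]
    have e (t : ℝ) : ψ (u + t • v) = θ (t + mean u) * f (osc u) := by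
      simp only [hψ]
      congr 2
      · simp [mean, hv, zeroMode]; ring
      · funext n
        have : (n : Modes N) ≠ zeroMode N := fun h => n.2 (by rw [h]; rfl)
        simp [osc, hv, this]
    simp_rw [e]
    rw [deriv_mul_const_field, deriv_comp_add_const, zero_add]
  have hin (u : State N) : inner ℝ (G u) v = G u (zeroMode N) := by
    rw [hv, EuclideanSpace.inner_single_right]; simp
  have hw' := hw ψ hψd hψc v
  simp_rw [hfd, hin] at hw'
  have e2 (u : State N) : ψ u * G u (zeroMode N) = G u (zeroMode N) * (θ (mean u) * f (osc u)) :=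
    mul_comm _ _
  simp_rw [e2] at hw'
  rw [integral_mul_slices hg hd hdc hf.continuous hfc,
    integral_mul_slices hG0 hθ.continuous hθc hf.continuous hfc] at hw'
  simp only [Pi.add_apply, smul_eq_mul, mul_add]
  rw [integral_add, hw']
  · ring
  · have := (integrable_prod_slices hg hd hdc hf.continuous hfc).integral_prod_right
    simpa only [integral_const_mul] using this
  · have := (integrable_prod_slices hG0 hθ.continuous hθc hf.continuous hfc).integral_prod_right
    simpa only [integral_const_mul] using this

/-- A smooth monotone step from `0` to `1` whose derivative lives in the interval
`(m - r, m + r)`. -/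
theorem exists_step (m : ℝ) {r : ℝ} (hr : 0 < r) : ∃ T : ℝ → ℝ, ContDiff ℝ ∞ T ∧ Monotone T ∧
    (∀ a, a ≤ m - r → T a = 0) ∧ (∀ a, m + r ≤ a → T a = 1) := by
  refine ⟨fun a => Real.smoothTransition ((a - (m - r)) / (2 * r)),
    Real.smoothTransition.contDiff.comp (by fun_prop), fun a b hab => ?_, fun a ha => ?_,
    fun a ha => ?_⟩
  · refine Real.smoothTransition.monotone ?_
    gcongr
  · exact Real.smoothTransition.zero_of_nonpos
      (div_nonpos_of_nonpos_of_nonneg (by linarith) (by linarith))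
  · refine Real.smoothTransition.one_of_one_le ?_
    rw [le_div_iff₀ (by linarith)]; linarith

theorem deriv_step_eq_zero {T : ℝ → ℝ} {l r a : ℝ} (h0 : ∀ a, a ≤ l → T a = 0)
    (h1 : ∀ a, r ≤ a → T a = 1) (ha : a < l ∨ r < a) : deriv T a = 0 := by
  rcases ha with ha | ha
  · have : T =ᶠ[nhds a] fun _ => 0 := by
      filter_upwards [gt_mem_nhds ha] with x hx using h0 x (le_of_lt hx)
    rw [this.deriv_eq, deriv_const]
  · have : T =ᶠ[nhds a] fun _ => 1 := by
      filter_upwards [lt_mem_nhds ha] with x hx using h1 x (le_of_lt hx)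
    rw [this.deriv_eq, deriv_const]

theorem integral_deriv_step {T : ℝ → ℝ} {l r : ℝ} (hT : ContDiff ℝ ∞ T)
    (h0 : ∀ a, a ≤ l → T a = 0) (h1 : ∀ a, r ≤ a → T a = 1) (hc : HasCompactSupport (deriv T)) :
    ∫ a, deriv T a = 1 := by
  have hi : Integrable (deriv T) :=
    (hT.continuous_deriv (by simp)).integrable_of_hasCompactSupport hc
  have := integral_of_hasDerivAt_of_tendsto
    (fun a => (hT.differentiable (by simp) a).hasDerivAt) hi
    (m := 0) (n := 1) ?_ ?_
  · rw [this, sub_zero]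
  · refine tendsto_const_nhds.congr' ?_
    filter_upwards [Filter.eventually_le_atBot l] with a ha using (h0 a ha).symm
  · refine tendsto_const_nhds.congr' ?_
    filter_upwards [Filter.eventually_ge_atTop r] with a ha using (h1 a ha).symm

end Slices

/-! ### Dirichlet energy along a line -/

section LineBound

variable {N : ℕ}

/-- The capacity of an interval is bounded from below by the inverse of its resistance. -/
theorem inv_lintegral_exp_le {α : Type*} [MeasurableSpace α] {μ : Measure α} {f F : α → ℝ}
    (hF : Measurable F) (hfin : ∫⁻ a, ENNReal.ofReal (Real.exp (F a)) ∂μ ≠ ⊤)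
    (h1 : 1 ≤ ∫⁻ a, ‖f a‖ₑ ∂μ) :
    (∫⁻ a, ENNReal.ofReal (Real.exp (F a)) ∂μ)⁻¹ ≤
      ∫⁻ a, ENNReal.ofReal (Real.exp (-F a)) * ‖f a‖ₑ ^ 2 ∂μ := by
  have hm : Measurable fun a => ENNReal.ofReal (Real.exp (F a)) := by fun_prop
  have h0 : ∫⁻ a, ENNReal.ofReal (Real.exp (F a)) ∂μ ≠ 0 := by
    intro h
    rw [lintegral_eq_zero_iff hm] at h
    have : ∫⁻ a, ‖f a‖ₑ ∂μ = ∫⁻ _, 0 ∂μ := by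
      refine lintegral_congr_ae ?_
      filter_upwards [h] with a ha
      exact absurd ha (ENNReal.ofReal_pos.2 (Real.exp_pos _)).ne'
    rw [this, lintegral_zero] at h1
    exact absurd h1 (by simp)
  generalize hB : ∫⁻ a, ENNReal.ofReal (Real.exp (F a)) ∂μ = B at *
  set A := ∫⁻ a, ENNReal.ofReal (Real.exp (-F a)) * ‖f a‖ₑ ^ 2 ∂μ with hA
  -- The pointwise inequality 2|f| ≤ B e^{-F} f² + e^F/B, where B is the resistance, replaces
  -- Cauchy-Schwarz; integrated, it reads 2 ≤ BA + 1. Only e^F has to be measurable.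
  have hpt (a : α) : 2 * ‖f a‖ₑ ≤ B * (ENNReal.ofReal (Real.exp (-F a)) * ‖f a‖ₑ ^ 2) +
      B⁻¹ * ENNReal.ofReal (Real.exp (F a)) := by
    lift B to NNReal using hfin
    have hb : 0 < (B : ℝ) := by
      rw [NNReal.coe_pos]; exact pos_iff_ne_zero.2 (by simpa using h0)
    have e1 : (B : ENNReal) = ENNReal.ofReal B := (ENNReal.ofReal_coe_nnreal).symm
    rw [e1, ← ENNReal.ofReal_inv_of_pos hb, Real.enorm_eq_ofReal_abs,
      ← ENNReal.ofReal_pow (abs_nonneg _), ← ENNReal.ofReal_mul (Real.exp_pos _).le,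
      ← ENNReal.ofReal_mul hb.le, ← ENNReal.ofReal_mul (inv_pos.2 hb).le,
      ← ENNReal.ofReal_add (by positivity) (by positivity),
      show (2 : ENNReal) = ENNReal.ofReal 2 by simp, ← ENNReal.ofReal_mul (by norm_num)]
    refine ENNReal.ofReal_le_ofReal ?_
    rw [Real.exp_neg]
    have he := Real.exp_pos (F a)
    set w := Real.exp (F a)
    have key : (B : ℝ) * (w⁻¹ * |f a| ^ 2) + (B : ℝ)⁻¹ * w - 2 * |f a| =
        (B * |f a| - w) ^ 2 / (B * w) := by field_simp; ring
    have : 0 ≤ (B * |f a| - w) ^ 2 / (B * w) := by positivity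
    linarith
  have h2 : 2 ≤ B * A + 1 := by
    calc (2 : ENNReal) ≤ 2 * ∫⁻ a, ‖f a‖ₑ ∂μ := le_mul_of_one_le_right' h1
      _ = ∫⁻ a, 2 * ‖f a‖ₑ ∂μ := (lintegral_const_mul' _ _ (by simp)).symm
      _ ≤ _ := lintegral_mono hpt
      _ = _ := by
        rw [lintegral_add_right _ (hm.const_mul _), lintegral_const_mul' _ _ hfin,
          lintegral_const_mul' _ _ (ENNReal.inv_ne_top.2 h0), hB, ENNReal.inv_mul_cancel h0 hfin]
  have h3 : 1 ≤ B * A := by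
    rw [← one_add_one_eq_two] at h2
    exact (ENNReal.add_le_add_iff_right ENNReal.one_ne_top).1 h2
  rw [ENNReal.inv_le_iff_le_mul (fun _ => h0) (fun h => absurd h hfin)]
  exact h3

/-- A function with weak gradient `G` which vanishes around the origin and is at least `1` around
`±L` has total variation at least `1` along almost every line between the two regions. -/
theorem ae_one_le_lintegral_slice {g : State N → ℝ} {G : State N → State N}
    (h : IsWeakGradient g G) {X Y : Set (State N)} (hX : ∀ᵐ z, z ∈ X → 1 ≤ g z)
    (hY : ∀ᵐ z, z ∈ Y → g z = 0) {η L : ℝ} (hη : 0 < η) (hL : η < L) {σ : ℝ}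
    (hσ : σ = 1 ∨ σ = -1) :
    ∀ᵐ y : NonzeroModes N → ℝ, (∀ a, |a| < η → glue N (a, y) ∈ Y) →
      (∀ a, L - η < |a| → glue N (a, y) ∈ X) →
      1 ≤ ∫⁻ a in (fun a => σ * a) ⁻¹' Set.Ioc 0 L, ‖G (glue N (a, y)) (zeroMode N)‖ₑ := by
  have hσ2 : σ * σ = 1 := by rcases hσ with rfl | rfl <;> norm_num
  have habs : |σ| = 1 := by rcases hσ with rfl | rfl <;> norm_num
  have habs' (a : ℝ) : |σ * a| = |a| := by rw [abs_mul, habs, one_mul]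
  -- The first step rises on [0, η/2], where g = 0, and the second on [L - η/2, L], where g ≥ 1.
  obtain ⟨T₁, hT₁, hm₁, h₁0, h₁1⟩ := exists_step (η / 4) (r := η / 4) (by positivity)
  obtain ⟨T₂, hT₂, hm₂, h₂0, h₂1⟩ := exists_step (L - η / 4) (r := η / 4) (by positivity)
  rw [sub_self] at h₁0
  rw [show η / 4 + η / 4 = η / 2 by ring] at h₁1
  rw [show L - η / 4 - η / 4 = L - η / 2 by ring] at h₂0
  rw [show L - η / 4 + η / 4 = L by ring] at h₂1
  -- This plateau is an admissible one-dimensional test function bounded by 1. Its ascent does not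
  -- see g and its descent averages g over values at least 1, so the integral of the weak derivative
  -- against it has modulus at least 1.
  set θ₀ : ℝ → ℝ := fun a => T₁ a - T₂ a with hθ₀
  have hz {a : ℝ} (ha : a ∉ Set.Ioc 0 L) : θ₀ a = 0 := by
    rw [Set.mem_Ioc, not_and_or, not_lt, not_le] at ha
    rcases ha with ha | ha
    · simp only [hθ₀]
      rw [h₁0 a ha, h₂0 a (by linarith), sub_self]
    · simp only [hθ₀]
      rw [h₁1 a (by linarith), h₂1 a ha.le, sub_self]
  have hrange {T : ℝ → ℝ} {l r : ℝ} (hT : Monotone T) (h0 : ∀ a, a ≤ l → T a = 0)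
      (h1 : ∀ a, r ≤ a → T a = 1) (a : ℝ) : 0 ≤ T a ∧ T a ≤ 1 := by
    constructor
    · rw [← h0 (min a l) (min_le_right _ _)]; exact hT (min_le_left _ _)
    · rw [← h1 (max a r) (le_max_right _ _)]; exact hT (le_max_left _ _)
  have hθ1 (a : ℝ) : |θ₀ a| ≤ 1 := by
    have i1 := hrange hm₁ h₁0 h₁1 a
    have i2 := hrange hm₂ h₂0 h₂1 a
    rw [abs_le]; constructor <;> simp only [hθ₀] <;> linarith
  have hlin : ContDiff ℝ ∞ fun a : ℝ => σ * a := by fun_prop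
  have hcomp {φ : ℝ → ℝ} {l r : ℝ} (hφ : ∀ a, a < l ∨ r < a → φ a = 0) :
      HasCompactSupport fun a => φ (σ * a) := by
    refine HasCompactSupport.intro (isCompact_closedBall (0 : ℝ) (max (-l) r)) fun a ha => ?_
    rw [mem_closedBall_zero_iff, not_le, Real.norm_eq_abs, ← habs'] at ha
    refine hφ _ ?_
    by_contra! hcon
    exact absurd ha (not_lt.2 (abs_le.2 ⟨by linarith [le_max_left (-l) r],
      hcon.2.trans (le_max_right _ _)⟩))
  have hd₁ {a : ℝ} (ha : a < 0 ∨ η / 2 < a) : deriv T₁ a = 0 := deriv_step_eq_zero h₁0 h₁1 ha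
  have hd₂ {a : ℝ} (ha : a < L - η / 2 ∨ L < a) : deriv T₂ a = 0 := deriv_step_eq_zero h₂0 h₂1 ha
  have hd₂nn (a : ℝ) : 0 ≤ deriv T₂ a := hm₂.deriv_nonneg
  have hθc : HasCompactSupport fun a => θ₀ (σ * a) := hcomp (l := 0) (r := L) fun a ha => hz (by
    rw [Set.mem_Ioc]; rintro ⟨h1, h2⟩; rcases ha with ha | ha <;> linarith)
  have hφc : HasCompactSupport fun a => deriv T₂ (σ * a) := hcomp fun a ha => hd₂ ha
  have hφ : Continuous fun a => deriv T₂ (σ * a) :=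
    (hT₂.continuous_deriv (by simp)).comp hlin.continuous
  have hder (a : ℝ) : deriv (fun a => θ₀ (σ * a)) a =
      σ * (deriv T₁ (σ * a) - deriv T₂ (σ * a)) := by
    have d1 := (hT₁.differentiable (by simp) (σ * a)).hasDerivAt
    have d2 := (hT₂.differentiable (by simp) (σ * a)).hasDerivAt
    have := (d1.sub d2).comp a ((hasDerivAt_id a).const_mul σ)
    rw [mul_one, mul_comm] at this
    exact this.deriv
  have hone : ∫ a, deriv T₂ (σ * a) = 1 := by
    rw [Measure.integral_comp_mul_left, abs_inv, habs, inv_one, one_smul]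
    refine integral_deriv_step hT₂ h₂0 h₂1 ?_
    refine HasCompactSupport.intro (isCompact_Icc (a := L - η / 2) (b := L)) fun a ha => hd₂ ?_
    rw [Set.mem_Icc, not_and_or, not_le, not_le] at ha
    exact ha
  filter_upwards [ae_integral_slice_eq h (hT₁.sub hT₂ |>.comp hlin) hθc,
    ae_integrable_slices h.1 hφ hφc, ae_ae_of_ae_state hX, ae_ae_of_ae_state hY]
    with y hy hint hXy hYy hYl hXl
  have e1 : ∫ a, g (glue N (a, y)) * deriv (fun a => θ₀ (σ * a)) a =
      -σ * ∫ a, g (glue N (a, y)) * deriv T₂ (σ * a) := by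
    rw [← integral_const_mul]
    refine integral_congr_ae ?_
    filter_upwards [hYy] with a ha
    rw [hder]
    by_cases hs : σ * a < 0 ∨ η / 2 < σ * a
    · rw [hd₁ hs]; ring
    · push Not at hs
      rw [ha (hYl a (by rw [← habs', abs_of_nonneg hs.1]; linarith))]; ring
  have e2 : 1 ≤ ∫ a, g (glue N (a, y)) * deriv T₂ (σ * a) := by
    rw [← hone]
    refine integral_mono_ae (hφ.integrable_of_hasCompactSupport hφc) hint ?_
    filter_upwards [hXy] with a ha
    by_cases hs : σ * a < L - η / 2 ∨ L < σ * a
    · simp only [hd₂ hs, mul_zero, le_refl]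
    · push Not at hs
      refine le_mul_of_one_le_left (hd₂nn _) (ha (hXl a ?_))
      rw [← habs', abs_of_nonneg (by linarith)]; linarith
  have e3 : 1 ≤ |∫ a, G (glue N (a, y)) (zeroMode N) * θ₀ (σ * a)| := by
    have e4 : ∫ a, G (glue N (a, y)) (zeroMode N) * θ₀ (σ * a) =
        σ * ∫ a, g (glue N (a, y)) * deriv T₂ (σ * a) := by
      have h3 : ∫ a, g (glue N (a, y)) * deriv (fun a => θ₀ (σ * a)) a =
          -∫ a, G (glue N (a, y)) (zeroMode N) * θ₀ (σ * a) := hy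
      linarith [h3, e1]
    rw [e4, habs']
    exact e2.trans (le_abs_self _)
  calc (1 : ENNReal) ≤ ‖∫ a, G (glue N (a, y)) (zeroMode N) * θ₀ (σ * a)‖ₑ := by
        rw [Real.enorm_eq_ofReal_abs]; exact ENNReal.one_le_ofReal.2 e3
    _ ≤ ∫⁻ a, ‖G (glue N (a, y)) (zeroMode N) * θ₀ (σ * a)‖ₑ := enorm_integral_le_lintegral_enorm _
    _ ≤ ∫⁻ a, ((fun a => σ * a) ⁻¹' Set.Ioc 0 L).indicator
          (fun a => ‖G (glue N (a, y)) (zeroMode N)‖ₑ) a := by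
        refine lintegral_mono fun a => ?_
        by_cases ha : σ * a ∈ Set.Ioc 0 L
        · rw [Set.indicator_of_mem (by exact ha), enorm_mul]
          refine mul_le_of_le_one_right' ?_
          rw [Real.enorm_eq_ofReal_abs]
          exact ENNReal.ofReal_le_one.2 (hθ1 _)
        · rw [hz ha, mul_zero, enorm_zero]; exact zero_le
    _ = _ := lintegral_indicator (measurableSet_Ioc.preimage (by fun_prop)) _

/-- The Dirichlet energy of an admissible function along the lines in the direction of the mean. -/
theorem ae_le_lintegral_line {γ β ε : ℝ} (hγ : 0 < γ) (hβ : 0 < β) (hε : 0 < ε) {k : ℕ}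
    (hk : 1 ≤ k) {g : State N → ℝ} {G : State N → State N}
    (h : IsWeakGradient g G) {X Y : Set (State N)} (hX : ∀ᵐ z, z ∈ X → 1 ≤ g z)
    (hY : ∀ᵐ z, z ∈ Y → g z = 0) {η : ℝ} (hη : 0 < η) (hL : η < 2 * Real.pi / β) :
    ∀ᵐ y : NonzeroModes N → ℝ, (∀ a, |a| < η → glue N (a, y) ∈ Y) →
      (∀ a, 2 * Real.pi / β - η < |a| → glue N (a, y) ∈ X) →
      2 * ENNReal.ofReal (√(γ * β / ε) * Real.exp (-(2 * Real.pi * γ / β) / ε) *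
        Real.exp (-∑ n, modeRate γ β ε n * y n ^ 2 / 2) *
          (1 - barrierError γ β * (ε + lineError ε y))) ≤
      ∫⁻ a, ENNReal.ofReal (Real.exp (-energy γ β k (glue N (a, y)) / ε)) *
        ‖G (glue N (a, y))‖ₑ ^ 2 := by
  have half {σ : ℝ} (hσ : σ = 1 ∨ σ = -1) (y : NonzeroModes N → ℝ)
      (h1 : 1 ≤ ∫⁻ a in (fun a => σ * a) ⁻¹' Set.Ioc 0 (2 * Real.pi / β),
        ‖G (glue N (a, y)) (zeroMode N)‖ₑ) :
      ENNReal.ofReal (√(γ * β / ε) * Real.exp (-(2 * Real.pi * γ / β) / ε) *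
        Real.exp (-∑ n, modeRate γ β ε n * y n ^ 2 / 2) *
          (1 - barrierError γ β * (ε + lineError ε y))) ≤
      ∫⁻ a in (fun a => σ * a) ⁻¹' Set.Ioc 0 (2 * Real.pi / β),
        ENNReal.ofReal (Real.exp (-energy γ β k (glue N (a, y)) / ε)) *
        ‖G (glue N (a, y))‖ₑ ^ 2 := by
    have hσ2 : σ * σ = 1 := by rcases hσ with rfl | rfl <;> norm_num
    have hmp : MeasurePreserving (fun a : ℝ => σ * a) := by
      rcases hσ with rfl | rfl
      · simp only [one_mul]; exact MeasurePreserving.id _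
      · simp only [neg_one_mul]; exact Measure.measurePreserving_neg _
    have hemb : MeasurableEmbedding fun a : ℝ => σ * a :=
      (Homeomorph.mulLeft₀ σ (left_ne_zero_of_mul_eq_one hσ2)).measurableEmbedding
    have hcont : Continuous fun a : ℝ => energy γ β k (glue N (a, y)) / ε :=
      ((continuous_energy γ β k).comp ((glue N).continuous.comp (by fun_prop))).div_const ε
    have hsub := hmp.setLIntegral_comp_preimage_emb hemb
      (fun a => ENNReal.ofReal (Real.exp (energy γ β k (glue N (σ * a, y)) / ε)))
      (Set.Ioc 0 (2 * Real.pi / β))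
    simp_rw [← mul_assoc, hσ2, one_mul] at hsub
    refine (le_inv_lintegral_exp_energy_line hγ hβ hε hk hσ y).trans ?_
    have hfin : ∫⁻ a in Set.Ioc 0 (2 * Real.pi / β),
        ENNReal.ofReal (Real.exp (energy γ β k (glue N (σ * a, y)) / ε)) ≠ ⊤ := by
      have hc2 : Continuous fun a : ℝ => Real.exp (energy γ β k (glue N (σ * a, y)) / ε) :=
        (hcont.comp (continuous_const_mul σ)).rexp
      rw [← ofReal_integral_eq_lintegral_ofReal hc2.integrableOn_Ioc
        (Filter.Eventually.of_forall fun a => (Real.exp_pos _).le)]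
      exact ENNReal.ofReal_ne_top
    rw [← hsub] at hfin ⊢
    refine (inv_lintegral_exp_le hcont.measurable hfin h1).trans (lintegral_mono fun a => ?_)
    rw [neg_div]
    gcongr
    rw [enorm_le_iff_norm_le]
    -- The gradient transverse to the line is discarded here.
    exact PiLp.norm_apply_le _ _
  filter_upwards [ae_one_le_lintegral_slice h hX hY hη hL (Or.inl rfl),
    ae_one_le_lintegral_slice h hX hY hη hL (Or.inr rfl)] with y h1 h2 hYl hXl
  rw [two_mul]
  refine (add_le_add (half (Or.inl rfl) y (h1 hYl hXl)) (half (Or.inr rfl) y (h2 hYl hXl))).trans ?_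
  -- The segments towards the two neighbouring wells are disjoint, and each contributes the same
  -- lower bound.
  rw [← lintegral_union (measurableSet_Ioc.preimage (by fun_prop))]
  · exact setLIntegral_le_lintegral _ _
  · rw [Set.disjoint_left]
    rintro a ⟨ha, -⟩ ⟨hb, -⟩
    simp only at ha hb
    linarith

end LineBound

/-! ### The lower bound for the capacity -/

section Lower

variable {N : ℕ} {γ β ε : ℝ}

/-- Pointwise, 1 is at most (1 - X)⁺ off the exceptional set, plus its indicator, plus X⁺. The
measurable hull avoids having to prove that the Besov-type set is measurable. -/
theorem ofReal_one_sub_le_lintegral {α : Type*} [MeasurableSpace α] {μ : Measure α}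
    [IsProbabilityMeasure μ] {X : α → ℝ} (hX : Measurable X) {S : Set α} {p q : ℝ} (hp : 0 ≤ p)
    (hq : 0 ≤ q) (hS : μ S ≤ ENNReal.ofReal p)
    (hXq : ∫⁻ y, ENNReal.ofReal (X y) ∂μ ≤ ENNReal.ofReal q) :
    ENNReal.ofReal (1 - (p + q)) ≤
      ∫⁻ y, (toMeasurable μ S)ᶜ.indicator (fun y => ENNReal.ofReal (1 - X y)) y ∂μ := by
  set T := toMeasurable μ S with hT
  have hTm : MeasurableSet T := measurableSet_toMeasurable μ S
  have hpt (y : α) : 1 ≤ Tᶜ.indicator (fun y => ENNReal.ofReal (1 - X y)) y +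
      (T.indicator 1 y + ENNReal.ofReal (X y)) := by
    by_cases hy : y ∈ T
    · rw [Set.indicator_of_notMem (by simpa using hy), Set.indicator_of_mem hy, zero_add]
      exact le_self_add
    · rw [Set.indicator_of_mem (by simpa using hy), Set.indicator_of_notMem hy, zero_add,
        ← ENNReal.ofReal_one]
      calc ENNReal.ofReal 1 = ENNReal.ofReal (1 - X y + X y) := by rw [sub_add_cancel]
        _ ≤ _ := ENNReal.ofReal_add_le
  rw [ENNReal.ofReal_sub _ (add_nonneg hp hq), ENNReal.ofReal_one, tsub_le_iff_right,
    ENNReal.ofReal_add hp hq]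
  calc (1 : ENNReal) = ∫⁻ _, 1 ∂μ := by simp
    _ ≤ _ := lintegral_mono hpt
    _ = _ := by
      rw [lintegral_add_right _ (by fun_prop (disch := assumption)),
        lintegral_add_right _ (by fun_prop), lintegral_indicator_one hTm]
    _ ≤ _ := by
      gcongr
      rwa [hT, measure_toMeasurable]

theorem measurable_lineError (ε : ℝ) : Measurable (lineError (N := N) ε) := by
  unfold lineError errorDensity
  refine Continuous.measurable ?_
  refine intervalIntegral.continuous_parametric_intervalIntegral_of_continuous' ?_ _ _
  fun_prop

theorem capacity_lower (hγ : 0 < γ) (hβ : 0 < β) (h : γ * β < 1) {κ : ℝ} (hκ : 0 < κ)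
    (hκ' : κ < 1 / 2) (P : DyadicPartition) :
    ∃ c₁ ε₀ C : ℝ, 0 < c₁ ∧ 0 < ε₀ ∧ 0 < C ∧ ∀ c₀, c₁ ≤ c₀ → ∀ k : ℕ, 1 ≤ k → ∀ ε, 0 < ε →
      ε < ε₀ → ∀ N : ℕ, ENNReal.ofReal (capacityAsymptotics γ β ε N * (1 - C * ε)) ≤
        capacity (energy γ β k (N := N)) ε (setA β ε N) (setB P κ c₀ ε N) := by
  have hp := Real.pi_pos
  obtain ⟨c₁, C₁, hc₁, hC₁, hbad⟩ := gaussPi_not_small_le (mul_pos hγ hβ) h hκ hκ' P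
  obtain ⟨ε₁, hε₁, hlog⟩ := exists_mul_log_le (η := Real.pi / β) (by positivity)
  have hV1 : 1 ≤ varBound γ β := one_le_varBound h
  have hb := barrierError_pos hγ hβ
  set K := 4 * Real.pi * (4 * varBound γ β + 32 * varBound γ β ^ 2 + 384 * varBound γ β ^ 3) with hK
  have hK0 : 0 ≤ K := by positivity
  -- The bound ε < 1/e ensures log(1/ε) ≥ 1. The final constant adds the probability of the
  -- discarded lines to the mean relative error on the others.
  refine ⟨c₁, min ε₁ (Real.exp (-1)), C₁ + barrierError γ β * (1 + K), hc₁,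
    lt_min hε₁ (Real.exp_pos _), by positivity, fun c₀ hc₀ k hk ε hε hεlt N => ?_⟩
  have hεe : ε < Real.exp (-1) := hεlt.trans_le (min_le_right _ _)
  have hε1 : ε ≤ 1 := hεe.le.trans (Real.exp_le_one_iff.2 (by norm_num))
  have hl : 1 ≤ Real.log (1 / ε) := by
    rw [Real.le_log_iff_exp_le (by positivity), le_div_iff₀ hε]
    calc Real.exp 1 * ε ≤ Real.exp 1 * Real.exp (-1) := by gcongr
      _ = 1 := by rw [← Real.exp_add]; simp
  have hη : 0 < √ε * Real.log (1 / ε) := by positivity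
  have hηL : √ε * Real.log (1 / ε) < 2 * Real.pi / β := by
    have := hlog ε hε (hεlt.trans_le (min_le_left _ _))
    have h2 : 2 * Real.pi / β = Real.pi / β + Real.pi / β := by ring
    have : 0 < Real.pi / β := by positivity
    linarith
  refine le_iInf fun g => le_iInf fun G => le_iInf fun hadm => ?_
  obtain ⟨-, -, hw, hX, hY⟩ := hadm
  set μ := gaussPi (modeRate (N := N) γ β ε) with hμ
  set S := {y : NonzeroModes N → ℝ | ¬ ∀ a : ℝ, besovNorm P (1 / 2 - κ)
    (oscillation (glue N (a, y))) < ENNReal.ofReal √(c₀ * ε * Real.log (1 / ε))} with hS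
  set X : (NonzeroModes N → ℝ) → ℝ := fun y => barrierError γ β * (ε + lineError ε y) with hXdef
  have hXm : Measurable X := ((measurable_lineError ε).const_add ε).const_mul _
  set f : (NonzeroModes N → ℝ) → ENNReal :=
    (toMeasurable μ S)ᶜ.indicator fun y => ENNReal.ofReal (1 - X y) with hf
  have hfm : Measurable f :=
    (hXm.const_sub 1).ennreal_ofReal.indicator (measurableSet_toMeasurable μ S).compl
  have hXq : ∫⁻ y, ENNReal.ofReal (X y) ∂μ ≤ ENNReal.ofReal (barrierError γ β * (ε + K * ε)) := by
    calc ∫⁻ y, ENNReal.ofReal (X y) ∂μ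
        ≤ ∫⁻ y, ENNReal.ofReal (barrierError γ β) *
          (ENNReal.ofReal ε + ENNReal.ofReal (lineError ε y)) ∂μ := by
          refine lintegral_mono fun y => ?_
          simp only [hXdef]
          rw [ENNReal.ofReal_mul hb.le]
          gcongr
          exact ENNReal.ofReal_add_le
      _ = ENNReal.ofReal (barrierError γ β) *
          (ENNReal.ofReal ε + ∫⁻ y, ENNReal.ofReal (lineError ε y) ∂μ) := by
          rw [lintegral_const_mul' _ _ ENNReal.ofReal_ne_top,
            lintegral_add_left measurable_const, lintegral_const, measure_univ, mul_one]
      _ ≤ ENNReal.ofReal (barrierError γ β) * (ENNReal.ofReal ε + ENNReal.ofReal (K * ε)) := by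
          gcongr
          refine (lintegral_lineError_le hγ hβ h hε hε1).trans (le_of_eq ?_)
          rw [hK]; congr 1; ring
      _ = _ := by
          rw [← ENNReal.ofReal_add hε.le (by positivity), ← ENNReal.ofReal_mul hb.le]
  have hfint := ofReal_one_sub_le_lintegral (μ := μ) hXm (S := S) (p := C₁ * ε)
    (q := barrierError γ β * (ε + K * ε)) (by positivity) (by positivity)
    (hbad c₀ hc₀ ε hε hl N) hXq
  set E := √(γ * β / ε) * Real.exp (-(2 * Real.pi * γ / β) / ε) with hE
  have hE0 : 0 ≤ E := by positivity
  have hGm : AEMeasurable fun z => ‖G z‖ₑ ^ 2 :=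
    (hw.2.1.aestronglyMeasurable.enorm).pow_const 2
  have hwm : Measurable fun z : State N =>
      ENNReal.ofReal (Real.exp (-energy γ β k z / ε)) :=
    (((continuous_energy γ β k).neg.div_const ε).rexp).measurable.ennreal_ofReal
  have hline : ∫⁻ y, ENNReal.ofReal (Real.exp (-∑ n, modeRate γ β ε n * y n ^ 2 / 2)) *
      (ENNReal.ofReal (2 * E) * f y) ≤ ∫⁻ z, ‖G z‖ₑ ^ 2 ∂gibbs (energy γ β k) ε := by
    rw [gibbs, lintegral_withDensity_eq_lintegral_mul₀ hwm.aemeasurable hGm,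
      lintegral_state (hwm.aemeasurable.mul hGm)]
    refine lintegral_mono_ae ?_
    filter_upwards [ae_le_lintegral_line hγ hβ hε hk hw hX hY hη hηL] with y hy
    by_cases hyT : y ∈ toMeasurable μ S
    · rw [hf, Set.indicator_of_notMem (by simpa using hyT), mul_zero, mul_zero]
      exact zero_le
    · have hyS : ∀ a : ℝ, besovNorm P (1 / 2 - κ) (oscillation (glue N (a, y))) <
          ENNReal.ofReal √(c₀ * ε * Real.log (1 / ε)) := by
        by_contra hcon
        exact hyT (subset_toMeasurable μ S hcon)
      refine le_trans (le_of_eq ?_) (hy (fun a ha => ⟨by rwa [mean_glue], hyS a⟩) fun a ha => ?_)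
      · rw [hf, Set.indicator_of_mem (by simpa using hyT), ← ENNReal.ofReal_mul (by positivity),
          ← ENNReal.ofReal_mul (by positivity), show (2 : ENNReal) = ENNReal.ofReal 2 by simp,
          ← ENNReal.ofReal_mul (by norm_num)]
        congr 1
        simp only [hXdef]
        ring
      · show 2 * Real.pi / β - √ε * Real.log (1 / ε) < |mean (glue N (a, y))|
        rwa [mean_glue]
  rw [lintegral_exp_mul_eq_gaussPi (fun n => modeRate_pos h hε n) (hfm.const_mul _),
    lintegral_const_mul _ hfm] at hline
  refine le_trans ?_ (mul_le_mul_right hline _)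
  refine le_trans (le_of_eq ?_) (mul_le_mul_right (mul_le_mul_right (mul_le_mul_right hfint _) _) _)
  rw [← ENNReal.ofReal_mul (by positivity), ← ENNReal.ofReal_mul (by positivity),
    ← ENNReal.ofReal_mul hε.le, capacityAsymptotics_eq hγ hβ h hε]
  congr 1
  -- The prefactor ε of the Dirichlet form combines with the inverse width of the barrier.
  have e : ε * √(γ * β / ε) = √(ε * γ * β) := by
    rw [show ε * γ * β = ε ^ 2 * (γ * β / ε) by field_simp, Real.sqrt_mul (by positivity),
      Real.sqrt_sq hε.le]
  rw [← e, hE, gaussConst]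
  ring

end Lower

end SineGordon

end

/-! ### Conclusion from the two bounds -/

theorem mainTheorem6 (γ β κ : ℝ) (hγ : 0 < γ) (hβ : 0 < β) (hγβ : γ * β < 1)
    (hκ : 0 < κ) (hκ' : κ < 1 / 2) (P : SineGordon.DyadicPartition) :
    ∃ c₁ : ℝ, 0 < c₁ ∧ ∀ c₀ : ℝ, c₁ ≤ c₀ → ∀ k : ℕ, 1 ≤ k →
      ∃ ε₀ C : ℝ, 0 < ε₀ ∧ 0 < C ∧ ∀ ε : ℝ, 0 < ε → ε < ε₀ → ∀ N : ℕ,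
        SineGordon.capacity (SineGordon.energy γ β k (N := N)) ε
            (SineGordon.setA β ε N) (SineGordon.setB P κ c₀ ε N)
          ≤ ENNReal.ofReal (SineGordon.capacityAsymptotics γ β ε N * (1 + C * ε)) ∧
        ENNReal.ofReal (SineGordon.capacityAsymptotics γ β ε N * (1 - C * ε))
          ≤ SineGordon.capacity (SineGordon.energy γ β k (N := N)) ε
            (SineGordon.setA β ε N) (SineGordon.setB P κ c₀ ε N) := by
  obtain ⟨ε₁, C₁, hε₁, hC₁, hup⟩ := SineGordon.capacity_upper hγ hβ hγβ
  obtain ⟨c₁, ε₂, C₂, hc₁, hε₂, -, hlow⟩ := SineGordon.capacity_lower hγ hβ hγβ hκ hκ' P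
  refine ⟨c₁, hc₁, fun c₀ hc₀ k hk => ⟨min ε₁ ε₂, max C₁ C₂, lt_min hε₁ hε₂,
    lt_max_of_lt_left hC₁, fun ε hε hεlt N => ?_⟩⟩
  have hΛ : 0 ≤ SineGordon.capacityAsymptotics γ β ε N := by
    unfold SineGordon.capacityAsymptotics; positivity
  constructor
  · refine (hup ε hε (hεlt.trans_le (min_le_left _ _)) N k P κ c₀).trans ?_
    gcongr
    exact le_max_left _ _
  · refine le_trans ?_ (hlow c₀ hc₀ k hk ε hε (hεlt.trans_le (min_le_right _ _)) N)
    gcongr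
    exact le_max_right _ _
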